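/- Let $\mathcal E$ be an idempotent-complete exact category (in the sense of Quillen). A cochain complex $E^*$ in $\mathcal E$ is *acyclic* if there are admissible short exact sequences $0\to K^i\xrightarrow{\alpha^i}E^i\xrightarrow{\beta^i}K^{i+1}\to 0$ with $\partial^i=\alpha^{i+1}\circ\beta^i$ for all $i\in\mathbb Z$. Let $\mathbf A(\mathcal E)$ be the full triangulated subcategory of the homotopy category $\mathbf K(\mathcal E)$ of cochain complexes whose objects are the acyclic complexes, let $\mathbf A^b(\mathcal E)\subset\mathbf A(\mathcal E)$ be the full subcategory of bounded acyclic complexes, and let $\mathbf D^b(\mathcal E)=\mathbf K^b(\mathcal E)/\mathbf A^b(\mathcal E)$ be the bounded derived category of $\mathcal E$ (a Verdier quotient). Give $\mathbf A(\mathcal E)$ the t-structure in which $\mathbf A(\mathcal E)^{\le 0}$, respectively $\mathbf A(\mathcal E)^{\ge 0}$, consists of the objects isomorphic in $\mathbf A(\mathcal E)$ to an acyclic complex $E^*$ with $E^i=0$ for all $i>0$, respectively with $E^i=0$ for all $i<-2$. Let $\mathbf A(\mathcal E)^\heartsuit$ be its heart, an abelian category contained in $\mathbf A^b(\mathcal E)$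 up to isomorphism. Call *realization functor* any triangulated functor $F:\mathbf D^b\big[\mathbf A(\mathcal E)^\heartsuit\big]\to\mathbf A^b(\mathcal E)$ whose restriction to $\mathbf A(\mathcal E)^\heartsuit$ (viewed as complexes concentrated in degree $0$) is naturally isomorphic to the inclusion of the heart. Then a realization functor exists, and for every realization functor $F$ the following holds: $F$ is an equivalence of categories if and only if $\mathcal E$ is hereditary, meaning that $\operatorname{Hom}_{\mathbf D^b(\mathcal E)}(X,\Sigma^nY)=0$ for all objects $X,Y$ of $\mathcal E$ and all $n\ge 2$. -/

import Mathlib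

open CategoryTheory CategoryTheory.Limits CategoryTheory.Pretriangulated ZeroObject
open CategoryTheory.Triangulated

universe v u

namespace Exact

section Additive

variable {C : Type u} [Category.{v} C] [Preadditive C]

/-- A cochain complex is bounded if it vanishes in all degrees outside a finite interval. -/
def IsBounded (K : CochainComplex C ℤ) : Prop := ∃ m n : ℤ, K.IsStrictlyGE m ∧ K.IsStrictlyLE n

variable (C)

/-- The full subcategory `K^b(C)` of the homotopy category `K(C)` whose objects are the bounded
complexes. -/
def boundedComplexes : ObjectProperty (HomotopyCategory C (ComplexShape.up ℤ)) :=
  fun K ↦ IsBounded K.as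

variable {C}

lemma bounded_shift {K : CochainComplex C ℤ} (r : ℤ) (hK : IsBounded K) : IsBounded (K⟦r⟧) := by
  obtain ⟨a, b, ha, hb⟩ := hK
  exact ⟨a - r, b - r, K.isStrictlyGE_shift a r _ (by lia), K.isStrictlyLE_shift b r _ (by lia)⟩

variable [HasBinaryBiproducts C]

lemma lift_map_desc {T X Y X' Y' W : C} (f : T ⟶ X) (g : T ⟶ Y) (h : X ⟶ X') (k : Y ⟶ Y')
    (l : X' ⟶ W) (m : Y' ⟶ W) :
    biprod.lift f g ≫ biprod.map h k ≫ biprod.desc l m = f ≫ h ≫ l + g ≫ k ≫ m := by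
  have : biprod.map h k ≫ biprod.desc l m = biprod.desc (h ≫ l) (k ≫ m) := by ext <;> simp
  rw [this, biprod.lift_desc]

lemma bounded_mappingCone {K L : CochainComplex C ℤ} (f : K ⟶ L)
    (hK : IsBounded K) (hL : IsBounded L) :
    IsBounded (CochainComplex.mappingCone f) := by
  obtain ⟨a, b, ha, hb⟩ := hK
  obtain ⟨a', b', ha', hb'⟩ := hL
  refine ⟨min (a - 1) a', max b b', ?_, ?_⟩
  · rw [CochainComplex.isStrictlyGE_iff]
    intro i hi
    rw [CochainComplex.mappingCone.isZero_X_iff]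
    exact ⟨K.isZero_of_isStrictlyGE a _, L.isZero_of_isStrictlyGE a' _⟩
  · rw [CochainComplex.isStrictlyLE_iff]
    intro i hi
    rw [CochainComplex.mappingCone.isZero_X_iff]
    exact ⟨K.isZero_of_isStrictlyLE b _, L.isZero_of_isStrictlyLE b' _⟩

variable [HasZeroObject C]

lemma isTriangulated_of_complexes (P : ObjectProperty (HomotopyCategory C (ComplexShape.up ℤ)))
    (h₀ : P ((HomotopyCategory.quotient _ _).obj 0))
    (h₁ : ∀ (K : CochainComplex C ℤ) (n : ℤ), P ((HomotopyCategory.quotient _ _).obj K) →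
      P ((HomotopyCategory.quotient _ _).obj (K⟦n⟧)))
    (h₂ : ∀ (K L : CochainComplex C ℤ) (f : K ⟶ L), P ((HomotopyCategory.quotient _ _).obj K) →
      P ((HomotopyCategory.quotient _ _).obj L) →
      P ((HomotopyCategory.quotient _ _).obj (CochainComplex.mappingCone f))) :
    P.IsTriangulated := by
  have : P.ContainsZero := ⟨_, Functor.map_isZero _ (isZero_zero _), h₀⟩
  have : P.IsStableUnderShift ℤ :=
    ⟨fun n ↦ ⟨fun K hK ↦ by
      obtain ⟨K, rfl⟩ := K.quotient_obj_surjective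
      rw [ObjectProperty.prop_shift_iff, HomotopyCategory.shift_quotient_obj]
      exact h₁ K n hK⟩⟩
  have : P.IsTriangulatedClosed₃ :=
    { ext₃' T hT h h' := by
        obtain ⟨f : T.obj₁.as ⟶ T.obj₂.as, hf⟩ :=
          (HomotopyCategory.quotient _ _).map_surjective T.mor₁
        exact ⟨_, h₂ _ _ f h h', ⟨Triangle.π₃.mapIso (isoTriangleOfIso₁₂ T _ hT
          (HomotopyCategory.mappingCone_triangleh_distinguished f)
          (Iso.refl _) (Iso.refl _)
          ((Category.comp_id _).trans (hf.symm.trans (Category.id_comp _).symm)))⟩⟩ }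
  exact { toIsTriangulatedClosed₂ := .of_isTriangulatedClosed₃ }

/-- A version of the previous lemma for the objects satisfying `Q` of the full subcategory
defined by `P`. -/
lemma isTriangulated_of_complexes' (P Q : ObjectProperty (HomotopyCategory C (ComplexShape.up ℤ)))
    [P.IsTriangulated]
    (h₀ : P ((HomotopyCategory.quotient _ _).obj 0))
    (h₀' : Q ((HomotopyCategory.quotient _ _).obj 0))
    (h₁' : ∀ (K : CochainComplex C ℤ) (n : ℤ), Q ((HomotopyCategory.quotient _ _).obj K) →
      Q ((HomotopyCategory.quotient _ _).obj (K⟦n⟧)))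
    (h₂ : ∀ (K L : CochainComplex C ℤ) (f : K ⟶ L), P ((HomotopyCategory.quotient _ _).obj K) →
      P ((HomotopyCategory.quotient _ _).obj L) →
      P ((HomotopyCategory.quotient _ _).obj (CochainComplex.mappingCone f)))
    (h₂' : ∀ (K L : CochainComplex C ℤ) (f : K ⟶ L), Q ((HomotopyCategory.quotient _ _).obj K) →
      Q ((HomotopyCategory.quotient _ _).obj L) →
      Q ((HomotopyCategory.quotient _ _).obj (CochainComplex.mappingCone f))) :
    (Q.inverseImage P.ι).IsTriangulated := by
  have : (Q.inverseImage P.ι).ContainsZero := by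
    refine ⟨⟨(HomotopyCategory.quotient _ _).obj 0, h₀⟩, ?_, h₀'⟩
    rw [IsZero.iff_id_eq_zero]
    ext
    exact (Functor.map_isZero (HomotopyCategory.quotient C _) (isZero_zero _)).eq_of_src _ _
  have : (Q.inverseImage P.ι).IsStableUnderShift ℤ :=
    ⟨fun n ↦ ⟨fun K hK ↦ by
      have hK' := h₁' K.obj.as n hK
      have e : (K⟦n⟧).obj = K.obj⟦n⟧ := by with_unfolding_all rfl
      change Q (K⟦n⟧).obj
      rw [e]
      with_unfolding_all exact hK'⟩⟩
  have : (Q.inverseImage P.ι).IsTriangulatedClosed₃ :=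
    { ext₃' T hT h h' := by
        obtain ⟨f : T.obj₁.obj.as ⟶ T.obj₂.obj.as, hf⟩ :=
          (HomotopyCategory.quotient _ _).map_surjective T.mor₁.hom
        let Y : P.FullSubcategory :=
          ⟨(HomotopyCategory.quotient _ _).obj (CochainComplex.mappingCone f),
            h₂ _ _ f T.obj₁.property T.obj₂.property⟩
        have e : T.obj₃.obj ≅ Y.obj := Triangle.π₃.mapIso (isoTriangleOfIso₁₂ _ _
          (P.ι.map_distinguished T hT)
          (HomotopyCategory.mappingCone_triangleh_distinguished f)
          (Iso.refl _) (Iso.refl _)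
          ((Category.comp_id _).trans (hf.symm.trans (Category.id_comp _).symm)))
        exact ⟨Y, h₂' _ _ f h h', ⟨P.fullyFaithfulι.preimageIso e⟩⟩ }
  exact { toIsTriangulatedClosed₂ := .of_isTriangulatedClosed₃ }

lemma isBounded_zero : IsBounded (0 : CochainComplex C ℤ) :=
  ⟨0, 0, inferInstance, inferInstance⟩

instance : (boundedComplexes C).IsTriangulated := isTriangulated_of_complexes _ isBounded_zero
  (fun _ n hK ↦ bounded_shift n hK) (fun _ _ f hK hL ↦ bounded_mappingCone f hK hL)

open CochainComplex CochainComplex.mappingCone CochainComplex.HomComplex in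
/-- A criterion which allows to identify the mapping cone of a morphism `φ : A ⟶ K` to a complex
`B` up to homotopy equivalence. -/
lemma nonempty_homotopyEquiv_mappingCone {A K B : CochainComplex C ℤ} (φ : A ⟶ K) (π : K ⟶ B)
    (r : ∀ i, K.X i ⟶ A.X i) (u : ∀ i, B.X i ⟶ K.X i)
    (s : ∀ i j, i + 1 = j → (A.X j ⟶ B.X i)) (t : ∀ i j, i + 1 = j → (B.X i ⟶ A.X j))
    (h₁ : ∀ i j h, φ.f j ≫ r j + s i j h ≫ t i j h = 𝟙 _)
    (h₂ : ∀ i, r i ≫ φ.f i + π.f i ≫ u i = 𝟙 _)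
    (h₃ : ∀ i j h, t i j h ≫ s i j h + u i ≫ π.f i = 𝟙 _)
    (h₄ : ∀ i j h, s i j h ≫ u i = 0)
    (h₅ : ∀ i j h, r i ≫ A.d i j = K.d i j ≫ r j + π.f i ≫ t i j h)
    (h₆ : ∀ i j h, u i ≫ K.d i j + t i j h ≫ φ.f j = B.d i j ≫ u j)
    (h₇ : ∀ i j h k h', t i j h ≫ A.d j k + B.d i j ≫ t j k h' = 0)
    (h₈ : ∀ i j h k h', s i j h ≫ B.d i j + A.d j k ≫ s j k h' = φ.f j ≫ π.f j) :
    Nonempty (HomotopyEquiv (mappingCone φ) B) := by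
  let s' : Cochain A B (-1) := Cochain.mk (fun p q h ↦ s q p (by omega))
  let t' : Cochain B A 1 := Cochain.mk (fun p q h ↦ t p q h)
  let r' : Cochain K A 0 := Cochain.ofHoms r
  let u' : Cochain B K 0 := Cochain.ofHoms u
  have hs (p q h) : s'.v p q h = s q p (by omega) := rfl
  have ht (p q h) : t'.v p q h = t p q h := rfl
  have hr (p) : r'.v p p (add_zero p) = r p := by simp [r']
  have hu (p) : u'.v p p (add_zero p) = u p := by simp [u']
  have e₁ : δ (-1) 0 s' = Cochain.ofHom (φ ≫ π) := by
    ext p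
    rw [δ_v (-1) 0 (neg_add_cancel 1) s' p p (add_zero p) (p - 1) (p + 1) rfl rfl]
    simp [hs, h₈]
  have e₂ : δ 1 2 t' = 0 := by
    ext p q hpq
    rw [δ_v 1 2 one_add_one_eq_two t' p q hpq (p + 1) (p + 1) (by omega) rfl]
    simpa [ht, Int.negOnePow_even 2 even_two] using h₇ p (p + 1) rfl q (by omega)
  have e₃ : δ 0 1 u' + t'.comp (Cochain.ofHom φ) (add_zero 1) = 0 := by
    ext p q hpq
    rw [Cochain.add_v, δ_v 0 1 (zero_add 1) u' p q hpq p q (by omega) hpq]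
    simp [ht, hu, ← h₆ p q hpq]
  let ψ := desc φ s' π e₁
  let σ := lift φ (Cocycle.mk t' 2 (by omega) e₂) u' e₃
  have hσ₁ (p q h) : σ.f p ≫ (fst φ).1.v p q h = t p q h := lift_f_fst_v φ _ _ e₃ _ _ _
  have hσ₂ (p) : σ.f p ≫ (snd φ).v p p (add_zero p) = u p :=
    (lift_f_snd_v φ _ _ e₃ _ _ _).trans (hu p)
  have hψ₁ (p q h) : (inl φ).v p q h ≫ ψ.f q = s q p (by omega) := inl_v_desc_f φ _ _ e₁ _ _ _
  have hψ₂ (p) : (inr φ).f p ≫ ψ.f p = π.f p := inr_f_desc_f φ _ _ e₁ _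
  clear_value ψ σ
  refine ⟨⟨ψ, σ, (descHomotopy _ _ _ 0 (r'.comp (inl φ) (zero_add _)) ?_ ?_).symm, .ofEq ?_⟩⟩
  · ext p q hpq
    simp only [Cochain.add_v, ext_to_iff φ _ _ (show q + 1 = p by omega)]
    simp [Cochain.comp_v _ _ (add_zero (-1)) p q q hpq (by omega), reassoc_of% hψ₁, hσ₁, hσ₂, hr,
      h₁, h₄]
  · ext p
    simp only [Cochain.add_v, ext_to_iff φ _ _ (show p + 1 = p + 1 by omega)]
    rw [δ_v (-1) 0 (neg_add_cancel 1) _ p p (add_zero p) (p - 1) (p + 1) rfl rfl]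
    simp [reassoc_of% hψ₂, hσ₁, hσ₂, hr, h₂, h₅ p (p + 1) rfl]
  · ext p
    have := id_X φ p (p + 1) rfl
    dsimp
    rw [← Category.id_comp (ψ.f p), ← this, Preadditive.add_comp, Preadditive.comp_add,
      Category.assoc, Category.assoc, hψ₁, hψ₂, reassoc_of% hσ₁, reassoc_of% hσ₂, h₃]
variable (C)

/-- The bounded homotopy category `K^b(C)`. -/
abbrev Kb := (boundedComplexes C).FullSubcategory

end Additive

section ExactCategory

variable {C : Type u} [Category.{v} C] [Preadditive C]

/-- A morphism `i` is an admissible monomorphism (inflation) for the class `E` of short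
complexes if it is the first morphism of a member of `E`. -/
def IsInflation (E : ObjectProperty (ShortComplex C)) {X Y : C} (i : X ⟶ Y) : Prop :=
  ∃ (Z : C) (p : Y ⟶ Z) (w : i ≫ p = 0), E (ShortComplex.mk i p w)

/-- A morphism `p` is an admissible epimorphism (deflation) for the class `E` of short
complexes if it is the second morphism of a member of `E`. -/
def IsDeflation (E : ObjectProperty (ShortComplex C)) {Y Z : C} (p : Y ⟶ Z) : Prop :=
  ∃ (X : C) (i : X ⟶ Y) (w : i ≫ p = 0), E (ShortComplex.mk i p w)

end ExactCategory

/-- An exact structure (in the sense of Quillen) on an additive category `C`: a class of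
kernel-cokernel pairs, called admissible short exact sequences, closed under isomorphisms, such
that identities are admissible monomorphisms and admissible epimorphisms, each of these two
classes of morphisms is closed under composition, admissible monomorphisms are stable under
pushouts along arbitrary morphisms (which exist), and admissible epimorphisms are stable under
pullbacks along arbitrary morphisms (which exist). -/
class ExactCategory (C : Type u) [Category.{v} C] [Preadditive C] [HasZeroObject C]
    [HasBinaryBiproducts C] where
  /-- The class of admissible short exact sequences. -/
  admissible : ObjectProperty (ShortComplex C)
  of_iso : ∀ {S T : ShortComplex C}, (S ≅ T) → admissible S → admissible T
  isKernel : ∀ S : ShortComplex C, admissible S →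
    Nonempty (IsLimit (KernelFork.ofι S.f S.zero))
  isCokernel : ∀ S : ShortComplex C, admissible S →
    Nonempty (IsColimit (CokernelCofork.ofπ S.g S.zero))
  inflation_id : ∀ X : C, IsInflation admissible (𝟙 X)
  deflation_id : ∀ X : C, IsDeflation admissible (𝟙 X)
  inflation_comp : ∀ {X Y Z : C} (i : X ⟶ Y) (j : Y ⟶ Z),
    IsInflation admissible i → IsInflation admissible j → IsInflation admissible (i ≫ j)
  deflation_comp : ∀ {X Y Z : C} (p : X ⟶ Y) (q : Y ⟶ Z),
    IsDeflation admissible p → IsDeflation admissible q → IsDeflation admissible (p ≫ q)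
  inflation_pushout : ∀ {X Y X' : C} (i : X ⟶ Y) (f : X ⟶ X'), IsInflation admissible i →
    ∃ (Y' : C) (f' : Y ⟶ Y') (i' : X' ⟶ Y'), IsPushout i f f' i' ∧ IsInflation admissible i'
  deflation_pullback : ∀ {Y Z Z' : C} (p : Y ⟶ Z) (f : Z' ⟶ Z), IsDeflation admissible p →
    ∃ (Y' : C) (f' : Y' ⟶ Y) (p' : Y' ⟶ Z'), IsPullback f' p' p f ∧ IsDeflation admissible p'

variable {C : Type u} [Category.{v} C] [Preadditive C] [HasZeroObject C] [HasBinaryBiproducts C]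
  [ExactCategory C]

/-- A cochain complex `K` in an exact category is acyclic if there are admissible short exact
sequences `0 ⟶ Z i ⟶ K.X i ⟶ Z (i + 1) ⟶ 0` such that the differentials of `K` are the
composites `K.X i ⟶ Z (i + 1) ⟶ K.X (i + 1)`. -/
def IsAcyclic (K : CochainComplex C ℤ) : Prop :=
  ∃ (Z : ℤ → C) (a : ∀ i, Z i ⟶ K.X i) (b : ∀ i, K.X i ⟶ Z (i + 1)) (w : ∀ i, a i ≫ b i = 0),
    (∀ i, ExactCategory.admissible (ShortComplex.mk (a i) (b i) (w i))) ∧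
      ∀ i, K.d i (i + 1) = b i ≫ a (i + 1)

section Lemmas

variable {X Y Z : C} {i : X ⟶ Y} {p : Y ⟶ Z} {w : i ≫ p = 0}

lemma admissible_of_isos {X' Y' Z' : C} {i' : X' ⟶ Y'} {p' : Y' ⟶ Z'}
    (h : ExactCategory.admissible (ShortComplex.mk i p w)) (w' : i' ≫ p' = 0)
    (eX : X ≅ X') (eY : Y ≅ Y') (eZ : Z ≅ Z') (h₁ : eX.hom ≫ i' = i ≫ eY.hom)
    (h₂ : eY.hom ≫ p' = p ≫ eZ.hom) :
    ExactCategory.admissible (ShortComplex.mk i' p' w') :=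
  ExactCategory.of_iso (S := ShortComplex.mk i p w) (T := ShortComplex.mk i' p' w')
    (ShortComplex.isoMk eX eY eZ h₁ h₂) h

lemma mono_of_admissible (h : ExactCategory.admissible (ShortComplex.mk i p w)) : Mono i := by
  obtain ⟨hl⟩ := ExactCategory.isKernel _ h
  exact mono_of_isLimit_fork hl

lemma epi_of_admissible (h : ExactCategory.admissible (ShortComplex.mk i p w)) : Epi p := by
  obtain ⟨hl⟩ := ExactCategory.isCokernel _ h
  exact epi_of_isColimit_cofork hl

lemma lift_of_admissible (h : ExactCategory.admissible (ShortComplex.mk i p w)) {T : C}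
    (f : T ⟶ Y) (hf : f ≫ p = 0) : ∃ l : T ⟶ X, l ≫ i = f := by
  obtain ⟨hl⟩ := ExactCategory.isKernel _ h
  obtain ⟨l, hl⟩ := KernelFork.IsLimit.lift' hl f hf
  exact ⟨l, hl⟩

lemma desc_of_admissible (h : ExactCategory.admissible (ShortComplex.mk i p w)) {T : C}
    (f : Y ⟶ T) (hf : i ≫ f = 0) : ∃ l : Z ⟶ T, p ≫ l = f := by
  obtain ⟨hl⟩ := ExactCategory.isCokernel _ h
  obtain ⟨l, hl⟩ := CokernelCofork.IsColimit.desc' hl f hf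
  exact ⟨l, hl⟩

lemma admissible_of_deflation (hp : IsDeflation ExactCategory.admissible p) (w : i ≫ p = 0)
    [Mono i] (hi : ∀ {T : C} (f : T ⟶ Y), f ≫ p = 0 → ∃ l : T ⟶ X, l ≫ i = f) :
    ExactCategory.admissible (ShortComplex.mk i p w) := by
  obtain ⟨X', i', w', h⟩ := hp
  have := mono_of_admissible h
  obtain ⟨l, hl⟩ := hi i' w'
  obtain ⟨l', hl'⟩ := lift_of_admissible h i w
  refine admissible_of_isos h w ⟨l, l', ?_, ?_⟩ (Iso.refl _) (Iso.refl _) ?_ ?_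
  · rw [← cancel_mono i', Category.assoc, hl', hl, Category.id_comp]
  · rw [← cancel_mono i, Category.assoc, hl, hl', Category.id_comp]
  · simp [hl]
  · simp

lemma deflation_of_isPullback {Y Z Y' Z' : C} {p : Y ⟶ Z} {f : Z' ⟶ Z} {f' : Y' ⟶ Y}
    {p' : Y' ⟶ Z'} (h : IsPullback f' p' p f) (hp : IsDeflation ExactCategory.admissible p) :
    IsDeflation ExactCategory.admissible p' := by
  obtain ⟨Y'', f'', p'', h', X, i, w, hi⟩ := ExactCategory.deflation_pullback p f hp
  let e := h'.isoIsPullback _ _ h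
  have he : e.hom ≫ p' = p'' := by simp [e]
  refine ⟨X, i ≫ e.hom, by rw [Category.assoc, he, w], ?_⟩
  exact admissible_of_isos hi _ (Iso.refl _) e (Iso.refl _) (by simp) (by simp [he])

lemma isAcyclic_of (K : CochainComplex C ℤ) (Z : ℤ → C) (a : ∀ i, Z i ⟶ K.X i)
    (b : ∀ i j, i + 1 = j → (K.X i ⟶ Z j)) (w : ∀ i j h, a i ≫ b i j h = 0)
    (h₁ : ∀ i j h, ExactCategory.admissible (ShortComplex.mk (a i) (b i j h) (w i j h)))
    (h₂ : ∀ i j h, K.d i j = b i j h ≫ a j) : IsAcyclic K :=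
  ⟨Z, a, fun i ↦ b i _ rfl, fun i ↦ w i _ rfl, fun i ↦ h₁ i _ rfl, fun i ↦ h₂ i _ rfl⟩

lemma IsAcyclic.exists_data {K : CochainComplex C ℤ} (hK : IsAcyclic K) :
    ∃ (Z : ℤ → C) (a : ∀ i, Z i ⟶ K.X i) (b : ∀ i j, i + 1 = j → (K.X i ⟶ Z j))
      (w : ∀ i j h, a i ≫ b i j h = 0),
      (∀ i j h, ExactCategory.admissible (ShortComplex.mk (a i) (b i j h) (w i j h))) ∧
      (∀ i j h, K.d i j = b i j h ≫ a j) := by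
  obtain ⟨Z, a, b, w, h₁, h₂⟩ := hK
  refine ⟨Z, a, fun i j h ↦ b i ≫ eqToHom (by rw [h]), ?_, ?_, ?_⟩
  · rintro i _ rfl; simp [w]
  · rintro i _ rfl; simpa using h₁ i
  · rintro i _ rfl; simp [h₂]

lemma admissible_iso_zero (i : X ⟶ Y) [IsIso i] (hZ : IsZero Z) (p : Y ⟶ Z) (w : i ≫ p = 0) :
    ExactCategory.admissible (ShortComplex.mk i p w) := by
  obtain ⟨Z', p', w', h⟩ := ExactCategory.inflation_id Y
  have := epi_of_admissible h
  have hZ' : IsZero Z' := by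
    rw [IsZero.iff_id_eq_zero, ← cancel_epi p']
    simpa using w'
  exact admissible_of_isos h w (asIso i).symm (Iso.refl _) (hZ'.iso hZ)
    (by simp) (hZ.eq_of_tgt _ _)

lemma admissible_zero_iso (i : X ⟶ Y) (hX : IsZero X) (p : Y ⟶ Z) [IsIso p] (w : i ≫ p = 0) :
    ExactCategory.admissible (ShortComplex.mk i p w) := by
  obtain ⟨X', i', w', h⟩ := ExactCategory.deflation_id Y
  have := mono_of_admissible h
  have hX' : IsZero X' := by
    rw [IsZero.iff_id_eq_zero, ← cancel_mono i']
    simpa using w'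
  exact admissible_of_isos h w (hX'.iso hX) (Iso.refl _) (asIso p)
    (hX'.eq_of_src _ _) (by simp)

/-- The biproduct of a deflation and an identity morphism is a deflation. -/
lemma deflation_biprod_map_id (hp : IsDeflation ExactCategory.admissible p) (T : C) :
    IsDeflation ExactCategory.admissible (biprod.map p (𝟙 T)) :=
  deflation_of_isPullback (f' := biprod.fst) (f := biprod.fst) (p := p)
    (IsPullback.of_isLimit' ⟨by simp⟩ (PullbackCone.IsLimit.mk _
      (fun s ↦ biprod.lift s.fst (s.snd ≫ biprod.snd)) (by simp)
      (fun s ↦ by ext <;> simp [s.condition])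
      (fun s m h₁ h₂ ↦ by
        ext
        · simpa using h₁
        · simpa using h₂ =≫ biprod.snd))) hp

/-- If `q : W ⟶ Z` is a deflation with kernel `j : K ⟶ W`, and `s : A ⟶ W` is such that `s ≫ q`
is a deflation, then the induced morphism `K ⊞ A ⟶ W` is a deflation. -/
lemma deflation_desc {K W Z A : C} {j : K ⟶ W} {q : W ⟶ Z} {w : j ≫ q = 0}
    (h : ExactCategory.admissible (ShortComplex.mk j q w)) (s : A ⟶ W)
    (hs : IsDeflation ExactCategory.admissible (s ≫ q)) :
    IsDeflation ExactCategory.admissible (biprod.desc j s) := by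
  have := mono_of_admissible h
  have hl := fun {T : C} (f : T ⟶ W) (hf : f ≫ q = 0) ↦ lift_of_admissible h f hf
  refine deflation_of_isPullback (p := s ≫ q) (f := q) (f' := biprod.snd)
    (IsPullback.of_isLimit' ⟨by ext <;> simp [w]⟩ ?_) hs
  have hc (c : PullbackCone (s ≫ q) q) : ∃ l : c.pt ⟶ K, l ≫ j = c.snd - c.fst ≫ s :=
    hl _ (by simp [← c.condition])
  refine PullbackCone.IsLimit.mk _ (fun c ↦ biprod.lift (hc c).choose c.fst) (by simp)
    (fun c ↦ by simp [biprod.lift_desc, (hc c).choose_spec]) (fun c m h₁ h₂ ↦ ?_)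
  ext
  · rw [← cancel_mono j, biprod.lift_fst, (hc c).choose_spec, ← h₁, ← h₂]
    simp [biprod.desc_eq]
  · simpa using h₁

lemma isDeflation_of_isIso (p : Y ⟶ Z) [IsIso p] : IsDeflation ExactCategory.admissible p :=
  ⟨0, 0, zero_comp, admissible_zero_iso _ (isZero_zero C) _ _⟩

end Lemmas

open CochainComplex CochainComplex.mappingCone in
/-- The mapping cone of a morphism between acyclic complexes is acyclic. -/
lemma isAcyclic_mappingCone {K L : CochainComplex C ℤ} (φ : K ⟶ L) (hK : IsAcyclic K)
    (hL : IsAcyclic L) : IsAcyclic (CochainComplex.mappingCone φ) := by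
  obtain ⟨Z, a, b, w, hZ, hd⟩ := hK.exists_data
  obtain ⟨Z', a', b', w', hZ', hd'⟩ := hL.exists_data
  have := fun i ↦ mono_of_admissible (hZ i _ rfl)
  have := fun i ↦ mono_of_admissible (hZ' i _ rfl)
  have hbe := fun i j h ↦ epi_of_admissible (hZ i j h)
  have ex_g (i : ℤ) : ∃ g : Z i ⟶ Z' i, g ≫ a' i = a i ≫ φ.f i := by
    refine lift_of_admissible (hZ' i _ rfl) _ ?_
    rw [← cancel_mono (a' (i + 1)), Category.assoc, Category.assoc, ← hd', φ.comm, hd i _ rfl,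
      Category.assoc, reassoc_of% (w i _ rfl), zero_comp, zero_comp]
  choose g hg using ex_g
  have hgb (i j h) : b i j h ≫ g j = φ.f i ≫ b' i j h := by
    rw [← cancel_mono (a' j), Category.assoc, hg, Category.assoc, ← hd', φ.comm, hd i _ h,
      Category.assoc]
  -- `W i` is the pullback of `L.X i ⟶ Z' (i + 1)` and `Z (i + 1) ⟶ Z' (i + 1)`
  have ex_W (i : ℤ) := ExactCategory.deflation_pullback (b' i _ rfl) (g (i + 1))
    ⟨_, _, _, hZ' i _ rfl⟩
  choose W f q hW hq using ex_W
  have := fun i ↦ mono_of_admissible (hZ i _ rfl)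
  have hfac (i : ℤ) : f i ≫ b' i _ rfl = q i ≫ g (i + 1) := (hW i).w
  have hdb (i j k : ℤ) (h : i + 1 = j) (h' : j + 1 = k) : L.d i j ≫ b' j k h' = 0 := by
    rw [hd' i j h, Category.assoc, w', comp_zero]
  have hdb' (i j k : ℤ) (h : i + 1 = j) (h' : j + 1 = k) : K.d i j ≫ b j k h' = 0 := by
    rw [hd i j h, Category.assoc, w, comp_zero]
  let α (i : ℤ) : W i ⟶ (mappingCone φ).X i :=
    f i ≫ (inr φ).f i - (q i ≫ a (i + 1)) ≫ (inl φ).v (i + 1) i (by lia)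
  have hβ (i : ℤ) : ((fst φ).1.v i (i + 1) rfl ≫ φ.f (i + 1) +
      (snd φ).v i i (add_zero i) ≫ L.d i (i + 1)) ≫ b' (i + 1) _ rfl =
      ((fst φ).1.v i (i + 1) rfl ≫ b (i + 1) _ rfl) ≫ g (i + 1 + 1) := by
    simp [hdb, hgb]
  let β (i : ℤ) : (mappingCone φ).X i ⟶ W (i + 1) := (hW (i + 1)).lift _ _ (hβ i)
  have hβf (i : ℤ) : β i ≫ f (i + 1) = (fst φ).1.v i (i + 1) rfl ≫ φ.f (i + 1) +
      (snd φ).v i i (add_zero i) ≫ L.d i (i + 1) := (hW (i + 1)).lift_fst _ _ _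
  have hβq (i : ℤ) : β i ≫ q (i + 1) = (fst φ).1.v i (i + 1) rfl ≫ b (i + 1) _ rfl :=
    (hW (i + 1)).lift_snd _ _ _
  have hαfst (i : ℤ) : α i ≫ (fst φ).1.v i (i + 1) rfl = - q i ≫ a (i + 1) := by simp [α]
  have hαsnd (i : ℤ) : α i ≫ (snd φ).v i i (add_zero i) = f i := by simp [α]
  have hαβ (i : ℤ) : α i ≫ β i = 0 := by
    apply (hW (i + 1)).hom_ext
    · simp only [Category.assoc, hβf, Preadditive.comp_add, reassoc_of% hαfst,
        reassoc_of% hαsnd, zero_comp, Preadditive.neg_comp]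
      rw [← hg, hd' i _ rfl, ← reassoc_of% (hfac i)]
      simp
    · simp only [Category.assoc, hβq, reassoc_of% hαfst, zero_comp, Preadditive.neg_comp, w,
        comp_zero, neg_zero]
  have hβα (i : ℤ) : (mappingCone φ).d i (i + 1) = β i ≫ α (i + 1) := by
    apply ext_to φ _ _ rfl
    · rw [d_fst_v φ _ _ _ rfl rfl, Category.assoc, hαfst, Preadditive.comp_neg,
        reassoc_of% hβq, ← hd]
    · rw [d_snd_v φ _ _ rfl, Category.assoc, hαsnd, hβf]
  refine ⟨W, α, β, hαβ, fun i ↦ ?_, hβα⟩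
  have : Mono (α i) := by
    rw [Preadditive.mono_iff_cancel_zero]
    intro T x hx
    apply (hW i).hom_ext
    · rw [← hαsnd, reassoc_of% hx, zero_comp, zero_comp]
    · rw [← cancel_mono (a (i + 1)), ← neg_inj, Category.assoc, ← Preadditive.comp_neg, ← hαfst,
        reassoc_of% hx]
      simp
  refine admissible_of_deflation ?_ _ ?_
  · let jj : Z' (i + 1) ⟶ W (i + 1) := (hW (i + 1)).lift (a' (i + 1)) 0 (by simp [w'])
    have hjf : jj ≫ f (i + 1) = a' (i + 1) := (hW (i + 1)).lift_fst _ _ _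
    have hjq : jj ≫ q (i + 1) = 0 := (hW (i + 1)).lift_snd _ _ _
    let s : K.X (i + 1) ⟶ W (i + 1) := (hW (i + 1)).lift (φ.f (i + 1)) (b (i + 1) _ rfl)
      (by rw [hgb])
    have hsf : s ≫ f (i + 1) = φ.f (i + 1) := (hW (i + 1)).lift_fst _ _ _
    have hsq : s ≫ q (i + 1) = b (i + 1) _ rfl := (hW (i + 1)).lift_snd _ _ _
    have : Mono jj := mono_of_mono_fac hjf
    have hj : ExactCategory.admissible (ShortComplex.mk jj (q (i + 1)) hjq) := by
      refine admissible_of_deflation (hq _) _ (fun {T} x hx ↦ ?_)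
      obtain ⟨l, hl⟩ := lift_of_admissible (hZ' (i + 1) _ rfl) (x ≫ f (i + 1))
        (by rw [Category.assoc, hfac, reassoc_of% hx, zero_comp])
      refine ⟨l, (hW (i + 1)).hom_ext ?_ ?_⟩
      · rw [Category.assoc, hjf, hl]
      · rw [Category.assoc, hjq, hx, comp_zero]
    let e : (mappingCone φ).X i ≅ L.X i ⊞ K.X (i + 1) :=
      { hom := biprod.lift ((snd φ).v i i (add_zero i)) ((fst φ).1.v i (i + 1) rfl)
        inv := biprod.desc ((inr φ).f i) ((inl φ).v (i + 1) i (by lia))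
        hom_inv_id := by
          rw [biprod.lift_desc, add_comm]
          exact id_X φ i (i + 1) rfl
        inv_hom_id := by ext <;> simp }
    have : IsIso e.hom := e.isIso_hom
    have hβe : β i = e.hom ≫ biprod.map (b' i _ rfl) (𝟙 _) ≫ biprod.desc jj s := by
      refine Eq.trans ((hW (i + 1)).hom_ext ?_ ?_) (lift_map_desc _ _ _ _ _ _).symm
      · rw [hβf, Preadditive.add_comp, Category.assoc, Category.assoc, Category.assoc,
          Category.assoc, hjf, hsf, ← hd', Category.id_comp]
        exact add_comm _ _
      · rw [hβq, Preadditive.add_comp, Category.assoc, Category.assoc, Category.assoc,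
          Category.assoc, hjq, hsq, comp_zero, comp_zero, zero_add, Category.id_comp]
    rw [hβe]
    refine ExactCategory.deflation_comp _ _ (isDeflation_of_isIso _)
      (ExactCategory.deflation_comp _ _ (deflation_biprod_map_id ⟨_, _, _, hZ' i _ rfl⟩ _)
        (deflation_desc hj s ?_))
    rw [hsq]
    exact ⟨_, _, _, hZ (i + 1) _ rfl⟩
  · intro T x hx
    have h₁ := hx =≫ f (i + 1)
    have h₂ := hx =≫ q (i + 1)
    rw [Category.assoc, hβf, zero_comp, Preadditive.comp_add] at h₁
    rw [Category.assoc, hβq, zero_comp] at h₂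
    obtain ⟨l, hl⟩ := lift_of_admissible (hZ (i + 1) _ rfl) (x ≫ (fst φ).1.v i (i + 1) rfl)
      (by rw [Category.assoc, h₂])
    have h₃ : (x ≫ (snd φ).v i i (add_zero i)) ≫ b' i _ rfl = (- l) ≫ g (i + 1) := by
      rw [← cancel_mono (a' (i + 1)), Category.assoc, Category.assoc, ← hd', Category.assoc, hg,
        Preadditive.neg_comp, reassoc_of% hl]
      exact eq_neg_of_add_eq_zero_right h₁
    refine ⟨(hW i).lift _ _ h₃, ext_to φ _ _ rfl ?_ ?_⟩
    · rw [Category.assoc, hαfst, Preadditive.comp_neg, (hW i).lift_snd_assoc,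
        Preadditive.neg_comp, neg_neg, hl]
    · rw [Category.assoc, hαsnd, (hW i).lift_fst]


lemma isAcyclic_of_isZero (K : CochainComplex C ℤ) (hK : ∀ i, IsZero (K.X i)) : IsAcyclic K :=
  isAcyclic_of K K.X (fun _ ↦ 𝟙 _) (fun _ _ _ ↦ 0) (by simp)
    (fun i j h ↦ admissible_iso_zero _ (hK _) _ _) (fun i j h ↦ (hK i).eq_of_src _ _)

open CochainComplex in
lemma isAcyclic_shift (K : CochainComplex C ℤ) (hK : IsAcyclic K) (n : ℤ) : IsAcyclic (K⟦n⟧) := by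
  obtain ⟨Z, a, b, w, hZ, hd⟩ := hK.exists_data
  refine isAcyclic_of _ (fun i ↦ Z (i + n)) (fun i ↦ a (i + n))
    (fun i j h ↦ n.negOnePow • b (i + n) (j + n) (by lia)) ?_ ?_ ?_
  · intro i j h
    dsimp
    rw [Linear.comp_units_smul, w, smul_zero]
  · intro i j h
    exact admissible_of_isos (hZ (i + n) (j + n) (by lia)) _ (Iso.refl _) (Iso.refl _)
      (n.negOnePow • Iso.refl _) (by simp) (by simp)
  · intro i j h
    rw [shiftFunctor_obj_d', hd (i + n) (j + n) (by lia)]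
    exact (Linear.units_smul_comp _ _ _).symm

variable (C)

/-- The full subcategory `A(C)` of the homotopy category `K(C)` whose objects are the acyclic
complexes. -/
def acyclic : ObjectProperty (HomotopyCategory C (ComplexShape.up ℤ)) := fun K ↦ IsAcyclic K.as

variable {C}

lemma isAcyclic_zero : IsAcyclic (0 : CochainComplex C ℤ) :=
  isAcyclic_of_isZero _ (fun i ↦ (HomologicalComplex.eval _ _ i).map_isZero (isZero_zero _))

instance : (acyclic C).IsTriangulated := isTriangulated_of_complexes _ isAcyclic_zero
  (fun K n hK ↦ isAcyclic_shift K hK n) (fun _ _ f hK hL ↦ isAcyclic_mappingCone f hK hL)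

variable (C)

/-- The full subcategory of `K^b(C)` whose objects are the bounded acyclic complexes. -/
def acyclicBounded : ObjectProperty (Kb C) := (acyclic C).inverseImage (boundedComplexes C).ι

/-- The full subcategory of `A(C)` whose objects are the bounded acyclic complexes. -/
def boundedAcyclic : ObjectProperty (acyclic C).FullSubcategory :=
  (boundedComplexes C).inverseImage (acyclic C).ι

variable {C}

instance : (acyclicBounded C).IsTriangulated :=
  isTriangulated_of_complexes' _ _ isBounded_zero isAcyclic_zero
    (fun K n hK ↦ isAcyclic_shift K hK n)
    (fun _ _ f hK hL ↦ bounded_mappingCone f hK hL)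
    (fun _ _ f hK hL ↦ isAcyclic_mappingCone f hK hL)

instance : (boundedAcyclic C).IsTriangulated :=
  isTriangulated_of_complexes' _ _ isAcyclic_zero isBounded_zero
    (fun _ n hK ↦ bounded_shift n hK)
    (fun _ _ f hK hL ↦ isAcyclic_mappingCone f hK hL)
    (fun _ _ f hK hL ↦ bounded_mappingCone f hK hL)

variable (C)

/-- The bounded derived category `D^b(C) = K^b(C)/A^b(C)` of an exact category `C`: the Verdier
quotient, i.e. the localization of `K^b(C)` with respect to the morphisms whose cone belongs
to `A^b(C)`. -/
abbrev Db := (acyclicBounded C).trW.Localization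

/-- The functor `C ⥤ D^b(C)` which sends an object to the corresponding complex concentrated
in degree `0`. -/
noncomputable def toDb : C ⥤ Db C :=
  (boundedComplexes C).lift (HomotopyCategory.singleFunctor C 0)
    (fun X ↦ ⟨0, 0,
      inferInstanceAs (((CochainComplex.singleFunctor C 0).obj X).IsStrictlyGE 0),
      inferInstanceAs (((CochainComplex.singleFunctor C 0).obj X).IsStrictlyLE 0)⟩) ⋙
    (acyclicBounded C).trW.Q

/-- An exact category `C` is hereditary if all the morphisms `X ⟶ Y⟦n⟧` in `D^b(C)` vanish
whenever `X` and `Y` are objects of `C` and `n ≥ 2`. -/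
def IsHereditary : Prop :=
  ∀ (X Y : C) (n : ℤ), 2 ≤ n → ∀ f : (toDb C).obj X ⟶ ((toDb C).obj Y)⟦n⟧, f = 0

variable {C}

lemma IsAcyclic.exists_data' {K : CochainComplex C ℤ} (hK : IsAcyclic K) :
    ∃ (Z : ℤ → C) (a : ∀ i, Z i ⟶ K.X i) (b : ∀ i j, K.X i ⟶ Z j) (w : ∀ i j, a i ≫ b i j = 0),
      (∀ i j, i + 1 = j → ExactCategory.admissible (ShortComplex.mk (a i) (b i j) (w i j))) ∧
      (∀ i j, K.d i j = b i j ≫ a j) ∧ ∀ i j, ¬ i + 1 = j → b i j = 0 := by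
  obtain ⟨Z, a, b, w, hZ, hd⟩ := hK.exists_data
  refine ⟨Z, a, fun i j ↦ if h : i + 1 = j then b i j h else 0, fun i j ↦ ?_, fun i j h ↦ ?_,
    fun i j ↦ ?_, fun i j h ↦ dif_neg h⟩
  · by_cases h : i + 1 = j
    · simp [h, w]
    · simp [h]
  · simpa only [dif_pos h] using hZ i j h
  · by_cases h : i + 1 = j
    · simp [h, hd]
    · simp [h]

/-- A morphism of complexes from a complex in degrees `≤ 0` to a complex in degrees `≥ -1` is
homotopic to zero when both complexes are acyclic. -/
lemma nonempty_homotopy_zero {K L : CochainComplex C ℤ} (φ : K ⟶ L) (hK : K.IsStrictlyLE 0)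
    (hL : IsAcyclic L) (hL' : L.IsStrictlyGE (-1)) : Nonempty (Homotopy φ 0) := by
  obtain ⟨Z, a, b, w, hZ, hd, -⟩ := hL.exists_data'
  have := fun i ↦ mono_of_admissible (hZ i _ rfl)
  have hZ₁ : IsZero (Z (-1)) := by
    have := epi_of_admissible (hZ (-2) (-1) (by omega))
    rw [IsZero.iff_id_eq_zero, ← cancel_epi (b (-2) (-1))]
    exact (L.isZero_of_isStrictlyGE (-1) (-2)).eq_of_src _ _
  obtain ⟨β, hβ⟩ : ∃ β : Z 0 ⟶ L.X (-1), β ≫ b (-1) 0 = 𝟙 _ := by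
    obtain ⟨l, hl⟩ := desc_of_admissible (hZ (-1) 0 (by omega)) (𝟙 _) (hZ₁.eq_of_src _ _)
    have := epi_of_admissible (hZ (-1) 0 (by omega))
    exact ⟨l, by rw [← cancel_epi (b (-1) 0), reassoc_of% hl, Category.comp_id]⟩
  have hmono : Mono (L.d (-1) 0) := by
    have : Mono (b (-1) 0) := by
      rw [Preadditive.mono_iff_cancel_zero]
      intro T x hx
      obtain ⟨l, rfl⟩ := lift_of_admissible (hZ (-1) 0 (by omega)) x hx
      rw [hZ₁.eq_of_tgt l 0, zero_comp]
    rw [hd]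
    infer_instance
  obtain ⟨l, hl⟩ := lift_of_admissible (hZ 0 1 (by omega)) (φ.f 0) (by
    rw [← cancel_mono (a 1), Category.assoc, ← hd, φ.comm,
      (K.isZero_of_isStrictlyLE 0 1).eq_of_src (φ.f 1) 0, comp_zero, zero_comp])
  have hθ : (l ≫ β) ≫ L.d (-1) 0 = φ.f 0 := by
    rw [hd, Category.assoc, reassoc_of% hβ, hl]
  obtain ⟨θ, hθ, hθ'⟩ : ∃ θ : ∀ i j, K.X i ⟶ L.X j, θ 0 (-1) ≫ L.d (-1) 0 = φ.f 0 ∧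
      ∀ i j, i ≠ 0 → θ i j = 0 := by
    refine ⟨fun i j ↦ if h : i = 0 ∧ j = -1 then (K.XIsoOfEq h.1).hom ≫ (l ≫ β) ≫
      (L.XIsoOfEq h.2).inv else 0, ?_, ?_⟩
    · simpa using hθ
    · intro i j h
      simp [h]
  have e : φ = Homotopy.nullHomotopicMap' (fun i j _ ↦ θ i j) := by
    ext i
    rw [Homotopy.nullHomotopicMap'_f (k₂ := i - 1) (k₁ := i) (k₀ := i + 1) (by simp) (by simp)]
    obtain h | h | h | h : 0 < i ∨ i = 0 ∨ i = -1 ∨ i < -1 := by omega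
    · exact (K.isZero_of_isStrictlyLE 0 i).eq_of_src _ _
    · subst h
      rw [hθ' (0 + 1) 0 (by omega), comp_zero, zero_add]
      exact hθ.symm
    · subst h
      rw [hθ' (-1) _ (by omega), zero_comp, add_zero]
      change φ.f (-1) = K.d (-1) 0 ≫ θ 0 (-1)
      rw [← cancel_mono (L.d (-1) 0), Category.assoc, hθ, φ.comm]
    · exact (L.isZero_of_isStrictlyGE (-1) i).eq_of_tgt _ _
  rw [e]
  exact ⟨Homotopy.nullHomotopy' _⟩

lemma exists_truncation {K : CochainComplex C ℤ} (hK : IsAcyclic K) :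
    ∃ (A B : CochainComplex C ℤ) (φ : A ⟶ K), IsAcyclic A ∧ A.IsStrictlyLE 0 ∧
      IsAcyclic B ∧ B.IsStrictlyGE (-1) ∧
      Nonempty (HomotopyEquiv (CochainComplex.mappingCone φ) B) := by
  obtain ⟨Z, a, b, w, hZ, hd, hb⟩ := hK.exists_data'
  have exA (i : ℤ) : ∃ (A : C) (φ : A ⟶ K.X i) (r : K.X i ⟶ A) (c : Z i ⟶ A) (e : A ⟶ Z i),
      (0 < i → IsZero A) ∧
      (i = 0 → φ = e ≫ a i ∧ c ≫ e = 𝟙 _ ∧ e ≫ c = 𝟙 _ ∧ r = 0) ∧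
      (i < 0 → φ ≫ r = 𝟙 _ ∧ r ≫ φ = 𝟙 _ ∧ c ≫ φ = a i) := by
    obtain h | h | h : 0 < i ∨ i = 0 ∨ i < 0 := by omega
    · exact ⟨0, 0, 0, 0, 0, fun _ ↦ isZero_zero _, by omega, by omega⟩
    · exact ⟨Z i, a i, 0, 𝟙 _, 𝟙 _, by omega, by simp, by omega⟩
    · exact ⟨K.X i, 𝟙 _, 𝟙 _, a i, 0, by omega, by omega, by simp⟩
  choose A φ r c e hA₁ hA₂ hA₃ using exA
  have exB (i : ℤ) : ∃ (B : C) (π : K.X i ⟶ B) (u : B ⟶ K.X i) (g : ∀ j, B ⟶ Z j)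
      (g' : ∀ j, Z j ⟶ B), (i < -1 → IsZero B) ∧
      (i = -1 → g 0 ≫ g' 0 = 𝟙 _ ∧ g' 0 ≫ g 0 = 𝟙 _ ∧ (∀ j, π ≫ g j = b i j) ∧ u = 0) ∧
      (0 ≤ i → π ≫ u = 𝟙 _ ∧ u ≫ π = 𝟙 _ ∧ ∀ j, π ≫ g j = b i j) := by
    obtain h | h | h : i < -1 ∨ i = -1 ∨ 0 ≤ i := by omega
    · exact ⟨0, 0, 0, 0, 0, fun _ ↦ isZero_zero _, by omega, by omega⟩
    · refine ⟨Z 0, b i 0, 0, fun j ↦ if h : j = 0 then eqToHom (by rw [h]) else 0,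
        fun j ↦ if h : j = 0 then eqToHom (by rw [h]) else 0, by omega,
        fun _ ↦ ⟨by simp, by simp, fun j ↦ ?_, rfl⟩, by omega⟩
      by_cases h' : j = 0
      · subst h'; simp
      · simp [h', hb i j (by omega)]
    · exact ⟨K.X i, 𝟙 _, 𝟙 _, fun j ↦ b i j, 0, by omega, by omega, by simp⟩
  choose B π u g g' hB₁ hB₂ hB₃ using exB
  have hc (i) (h : i ≤ 0) : c i ≫ φ i = a i := by
    obtain h | h := h.lt_or_eq
    · exact (hA₃ i h).2.2
    · rw [(hA₂ i h).1, ← Category.assoc, (hA₂ i h).2.1, Category.id_comp]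
  have hg (i j) (h : -1 ≤ i) : π i ≫ g i j = b i j := by
    obtain h | h := h.lt_or_eq
    · exact (hB₃ i (by omega)).2.2 j
    · exact (hB₂ i h.symm).2.2.1 j
  have hπ (i) : Epi (π i) := by
    obtain h | h | h : i < -1 ∨ i = -1 ∨ 0 ≤ i := by omega
    · exact ⟨fun _ _ _ ↦ (hB₁ i h).eq_of_src _ _⟩
    · subst h
      have := epi_of_admissible (hZ (-1) 0 (by omega))
      rw [← hg _ _ (by omega)] at this
      have h₁ : IsIso (g (-1) 0) := ⟨g' (-1) 0, (hB₂ _ rfl).1, (hB₂ _ rfl).2.1⟩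
      have : π (-1) = (π (-1) ≫ g (-1) 0) ≫ inv (g (-1) 0) := by simp
      rw [this]
      infer_instance
    · have := (hB₃ i h)
      exact (IsSplitEpi.mk' ⟨u i, this.2.1⟩ : IsSplitEpi (π i)).epi
  let A' : CochainComplex C ℤ :=
    { X := A
      d i j := φ i ≫ b i j ≫ c j
      shape i j h := by rw [hb i j h, zero_comp, comp_zero]
      d_comp_d' i j k _ _ := by
        obtain h | h := le_or_gt j 0
        · rw [Category.assoc, Category.assoc, reassoc_of% (hc j h), reassoc_of% (w j k)]
          simp
        · rw [(hA₁ j h).eq_of_tgt (φ i ≫ _) 0, zero_comp] }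
  let B' : CochainComplex C ℤ :=
    { X := B
      d i j := g i j ≫ a j ≫ π j
      shape i j h := by
        obtain h' | h' := lt_or_ge i (-1)
        · exact (hB₁ i h').eq_of_src _ _
        · rw [← cancel_epi (π i), reassoc_of% (hg i j h'), hb i j h, zero_comp, comp_zero]
      d_comp_d' i j k _ _ := by
        obtain h | h := lt_or_ge j (-1)
        · rw [(hB₁ j h).eq_of_tgt (g i j ≫ _) 0, zero_comp]
        · rw [Category.assoc, Category.assoc, reassoc_of% (hg j k h), reassoc_of% (w j k)]
          simp }
  have hAd (i j) : A'.d i j = φ i ≫ b i j ≫ c j := rfl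
  have hBd (i j) : B'.d i j = g i j ≫ a j ≫ π j := rfl
  have hφb (i j) (h : 0 ≤ i) : φ i ≫ b i j = 0 := by
    obtain h | h := h.lt_or_eq
    · exact (hA₁ i h).eq_of_src _ _
    · rw [(hA₂ i h.symm).1, Category.assoc, w, comp_zero]
  have haπ (j) (h : j < 0) : a j ≫ π j = 0 := by
    obtain h | h : j < -1 ∨ j = -1 := by omega
    · exact (hB₁ j h).eq_of_tgt _ _
    · subst h
      have h₁ : IsIso (g (-1) 0) := ⟨g' (-1) 0, (hB₂ _ rfl).1, (hB₂ _ rfl).2.1⟩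
      rw [← cancel_mono (g (-1) 0), Category.assoc, hg _ _ (by omega), w, zero_comp]
  let φ' : A' ⟶ K :=
    { f := φ
      comm' i j hij := by
        obtain rfl : i + 1 = j := hij
        rw [hd, hAd, Category.assoc, Category.assoc]
        obtain h | h := lt_or_ge i 0
        · rw [hc (i + 1) (by omega)]
        · rw [reassoc_of% (hφb i (i + 1) h), reassoc_of% (hφb i (i + 1) h)]
          simp }
  let π' : K ⟶ B' :=
    { f := π
      comm' i j hij := by
        obtain rfl : i + 1 = j := hij
        rw [hd, hBd, Category.assoc]
        obtain h | h := lt_or_ge i (-1)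
        · rw [haπ _ (by omega)]; simp
        · rw [reassoc_of% (hg i (i + 1) h)] }
  refine ⟨A', B', φ', ?_, ?_, ?_, ?_, ?_⟩
  · have exZ (i : ℤ) : ∃ (Z' : C) (z : Z' ⟶ Z i) (z' : Z i ⟶ Z'), (0 < i → IsZero Z') ∧
        (i ≤ 0 → z ≫ z' = 𝟙 _ ∧ z' ≫ z = 𝟙 _) := by
      obtain h | h := lt_or_ge 0 i
      · exact ⟨0, 0, 0, fun _ ↦ isZero_zero _, by omega⟩
      · exact ⟨Z i, 𝟙 _, 𝟙 _, by omega, by simp⟩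
    choose Z' z z' h₁ h₂ using exZ
    have w' (i j) : (z i ≫ c i) ≫ φ i ≫ b i j ≫ z' j = 0 := by
      obtain h | h := lt_or_ge 0 i
      · exact (h₁ i h).eq_of_src _ _
      · rw [Category.assoc, reassoc_of% (hc i h), reassoc_of% (w i j)]; simp
    refine isAcyclic_of _ Z' (fun i ↦ z i ≫ c i) (fun i j h ↦ φ i ≫ b i j ≫ z' j)
      (fun i j _ ↦ w' i j) ?_ ?_
    · intro i j h
      obtain h' | h' := lt_or_ge i 0
      · exact admissible_of_isos (hZ i j h) (w' i j)
          ⟨z' i, z i, (h₂ i (by omega)).2, (h₂ i (by omega)).1⟩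
          ⟨r i, φ i, (hA₃ i h').2.1, (hA₃ i h').1⟩
          ⟨z' j, z j, (h₂ j (by omega)).2, (h₂ j (by omega)).1⟩ (by
            dsimp
            rw [reassoc_of% (h₂ i (by omega)).2, ← hc i (by omega), Category.assoc,
              (hA₃ i h').1, Category.comp_id]) (by
            dsimp
            rw [reassoc_of% (hA₃ i h').2.1])
      · have : IsIso (z i ≫ c i) := by
          obtain h' | h' := h'.lt_or_eq
          · exact ⟨0, (h₁ i h').eq_of_src _ _, (hA₁ i h').eq_of_src _ _⟩
          · have : IsIso (z i) := ⟨z' i, h₂ i (by omega)⟩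
            have : IsIso (c i) := ⟨e i, (hA₂ i h'.symm).2.1, (hA₂ i h'.symm).2.2.1⟩
            infer_instance
        exact admissible_iso_zero (z i ≫ c i) (h₁ j (by omega)) _ (w' i j)
    · intro i j h
      obtain h' | h' := lt_or_ge 0 j
      · exact (hA₁ j h').eq_of_tgt _ _
      · rw [hAd, Category.assoc, Category.assoc, reassoc_of% (h₂ j h').2]
  · rw [CochainComplex.isStrictlyLE_iff]
    exact hA₁
  · have exZ (i : ℤ) : ∃ (Z' : C) (z : Z' ⟶ Z i) (z' : Z i ⟶ Z'), (i < 0 → IsZero Z') ∧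
        (0 ≤ i → z ≫ z' = 𝟙 _ ∧ z' ≫ z = 𝟙 _) := by
      obtain h | h := lt_or_ge i 0
      · exact ⟨0, 0, 0, fun _ ↦ isZero_zero _, by omega⟩
      · exact ⟨Z i, 𝟙 _, 𝟙 _, by omega, by simp⟩
    choose Z' z z' h₁ h₂ using exZ
    have w' (i j) : (z i ≫ a i ≫ π i) ≫ g i j ≫ z' j = 0 := by
      obtain h | h := lt_or_ge i 0
      · exact (h₁ i h).eq_of_src _ _
      · rw [Category.assoc, Category.assoc, reassoc_of% (hg i j (by omega)),
          reassoc_of% (w i j)]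
        simp
    refine isAcyclic_of _ Z' (fun i ↦ z i ≫ a i ≫ π i) (fun i j h ↦ g i j ≫ z' j)
      (fun i j _ ↦ w' i j) ?_ ?_
    · intro i j h
      obtain h' | h' := lt_or_ge i 0
      · have : IsIso (g i j ≫ z' j) := by
          obtain h' | h' : i < -1 ∨ i = -1 := by omega
          · exact ⟨0, (hB₁ i h').eq_of_src _ _, (h₁ j (by omega)).eq_of_src _ _⟩
          · obtain rfl : j = 0 := by omega
            have : IsIso (z' 0) := ⟨z 0, (h₂ 0 le_rfl).symm⟩
            have : IsIso (g i 0) := ⟨g' i 0, (hB₂ i h').1, (hB₂ i h').2.1⟩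
            infer_instance
        exact admissible_zero_iso (z i ≫ a i ≫ π i) (h₁ i h') (g i j ≫ z' j) (w' i j)
      · exact admissible_of_isos (hZ i j h) (w' i j)
          ⟨z' i, z i, (h₂ i (by omega)).2, (h₂ i (by omega)).1⟩
          ⟨π i, u i, (hB₃ i h').1, (hB₃ i h').2.1⟩
          ⟨z' j, z j, (h₂ j (by omega)).2, (h₂ j (by omega)).1⟩ (by
            dsimp
            rw [reassoc_of% (h₂ i (by omega)).2]) (by
            dsimp
            rw [reassoc_of% (hg i j (by omega))])
    · intro i j h
      obtain h' | h' := lt_or_ge i (-1)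
      · exact (hB₁ i h').eq_of_src _ _
      · rw [hBd, Category.assoc, reassoc_of% (h₂ j (by omega)).2]
  · rw [CochainComplex.isStrictlyGE_iff]
    exact hB₁
  · refine nonempty_homotopyEquiv_mappingCone φ' π' r u (fun i j _ ↦ e j ≫ g' i j)
      (fun i j _ ↦ g i j ≫ c j) ?_ ?_ ?_ ?_ ?_ ?_ ?_ ?_
    all_goals intro i
    · rintro j h
      obtain h' | h' | h' : 0 < j ∨ j = 0 ∨ j < 0 := by omega
      · exact (hA₁ j h').eq_of_src _ _
      · subst h'
        obtain rfl : i = -1 := by omega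
        rw [(hA₂ 0 rfl).2.2.2, comp_zero, zero_add, Category.assoc,
          reassoc_of% (hB₂ (-1) rfl).2.1, (hA₂ 0 rfl).2.2.1]
      · rw [(hB₁ i (by omega)).eq_of_tgt (e j ≫ g' i j) 0, zero_comp, add_zero]
        exact (hA₃ j h').1
    · obtain h | h | h : i < -1 ∨ i = -1 ∨ 0 ≤ i := by omega
      · rw [(hB₁ i h).eq_of_src (u i) 0, comp_zero, add_zero]
        exact (hA₃ i (by omega)).2.1
      · rw [(hB₂ i h).2.2.2, comp_zero, add_zero]
        exact (hA₃ i (by omega)).2.1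
      · have : r i = 0 := by
          obtain h | h := h.lt_or_eq
          · exact (hA₁ i h).eq_of_tgt _ _
          · exact (hA₂ i h.symm).2.2.2
        rw [this, zero_comp, zero_add]
        exact (hB₃ i h).1
    · intro j hij
      obtain h | h | h : i < -1 ∨ i = -1 ∨ 0 ≤ i := by omega
      · exact (hB₁ i h).eq_of_src _ _
      · subst h
        obtain rfl : j = 0 := by omega
        rw [(hB₂ _ rfl).2.2.2, zero_comp, add_zero, Category.assoc,
          reassoc_of% (hA₂ 0 rfl).2.1, (hB₂ _ rfl).1]
      · rw [(hA₁ j (by omega)).eq_of_tgt (g i j ≫ c j) 0, zero_comp, zero_add]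
        exact (hB₃ i h).2.1
    · intro j hij
      obtain h | h | h : i < -1 ∨ i = -1 ∨ 0 ≤ i := by omega
      · rw [(hB₁ i h).eq_of_src (u i) 0, comp_zero]
      · rw [(hB₂ i h).2.2.2, comp_zero]
      · exact (hA₁ j (by omega)).eq_of_src _ _
    · intro j hij
      obtain h | h | h : i < -1 ∨ i = -1 ∨ 0 ≤ i := by omega
      · rw [(hB₁ i h).eq_of_src (g i j ≫ c j) 0, comp_zero, add_zero, hAd,
          reassoc_of% (hA₃ i (by omega)).2.1, hd, Category.assoc, ← hc j (by omega),
          Category.assoc, (hA₃ j (by omega)).1, Category.comp_id]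
      · subst h
        obtain rfl : j = 0 := by omega
        rw [(hA₂ 0 rfl).2.2.2, comp_zero, zero_add, hAd, reassoc_of% (hA₃ (-1) (by omega)).2.1]
        rw [← hg (-1) 0 (by omega), Category.assoc]
      · exact (hA₁ j (by omega)).eq_of_tgt _ _
    · intro j hij
      obtain h | h | h : i < -1 ∨ i = -1 ∨ 0 ≤ i := by omega
      · exact (hB₁ i h).eq_of_src _ _
      · subst h
        obtain rfl : j = 0 := by omega
        rw [(hB₂ _ rfl).2.2.2, zero_comp, zero_add, Category.assoc, hBd, Category.assoc,
          Category.assoc, (hB₃ 0 le_rfl).1, Category.comp_id]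
        exact congrArg (g (-1) 0 ≫ ·) (hc 0 le_rfl)
      · rw [(hA₁ j (by omega)).eq_of_tgt (g i j ≫ c j) 0, zero_comp, add_zero, hBd,
          Category.assoc, Category.assoc, (hB₃ j (by omega)).1, Category.comp_id,
          ← cancel_epi (π i), reassoc_of% (hB₃ i h).1, reassoc_of% (hg i j (by omega)), hd]
    · intro j hij k hjk
      obtain h | h := lt_or_ge i (-1)
      · exact (hB₁ i h).eq_of_src _ _
      · exact (hA₁ k (by omega)).eq_of_tgt _ _
    · intro j hij k hjk
      obtain h | h | h | h : 0 < j ∨ j = 0 ∨ j = -1 ∨ j < -1 := by omega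
      · exact (hA₁ j h).eq_of_src _ _
      · subst h
        obtain rfl : i = -1 := by omega
        rw [(hA₁ k (by omega)).eq_of_tgt (A'.d 0 k) 0, zero_comp, add_zero, hBd, Category.assoc,
          reassoc_of% (hB₂ (-1) rfl).2.1]
        refine Eq.trans ?_ (congrArg (· ≫ π 0) (hA₂ 0 rfl).1.symm)
        rw [Category.assoc]
      · subst h
        obtain rfl : k = 0 := by omega
        rw [(hB₁ i (by omega)).eq_of_tgt (e (-1) ≫ g' i (-1)) 0, zero_comp, zero_add, hAd,
          Category.assoc, Category.assoc, reassoc_of% (hA₂ 0 rfl).2.1, ← hg _ _ (by omega),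
          Category.assoc, (hB₂ _ rfl).1, Category.comp_id]
      · exact (hB₁ j h).eq_of_tgt _ _

variable (C)

/-- The triangulated category `A(C)` of acyclic complexes up to homotopy. -/
abbrev Ac := (acyclic C).FullSubcategory

variable {C}

/-- The underlying complex of an object of `A(C)`. -/
abbrev Ac.complex (K : Ac C) : CochainComplex C ℤ := K.obj.as

/-- The objects of `A(C)` which are isomorphic to an acyclic complex that vanishes in all
degrees `> n`. -/
def acyclicLE (n : ℤ) : ObjectProperty (Ac C) :=
  ObjectProperty.isoClosure (fun K ↦ K.complex.IsStrictlyLE n)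

/-- The objects of `A(C)` which are isomorphic to an acyclic complex that vanishes in all
degrees `< n - 2`. -/
def acyclicGE (n : ℤ) : ObjectProperty (Ac C) :=
  ObjectProperty.isoClosure (fun K ↦ K.complex.IsStrictlyGE (n - 2))

instance (n : ℤ) : (acyclicLE (C := C) n).IsClosedUnderIsomorphisms := by
  unfold acyclicLE; infer_instance

instance (n : ℤ) : (acyclicGE (C := C) n).IsClosedUnderIsomorphisms := by
  unfold acyclicGE; infer_instance

/-- The shift of an object of `A(C)` is computed by the shift of complexes. -/
noncomputable def shiftIso (K : Ac C) (a : ℤ) :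
    K⟦a⟧ ≅ ⟨(HomotopyCategory.quotient _ _).obj (K.obj.as⟦a⟧), isAcyclic_shift _ K.property a⟩ :=
  (acyclic C).fullyFaithfulι.preimageIso (((acyclic C).ι.commShiftIso a).app K ≪≫
    ((HomotopyCategory.quotient C (ComplexShape.up ℤ)).commShiftIso a).symm.app K.obj.as)

variable (C)

/-- The t-structure on `A(C)` such that `A(C)^{≤ 0}` consists of the acyclic complexes which
vanish in degrees `> 0` and `A(C)^{≥ 0}` consists of the acyclic complexes which vanish in
degrees `< -2` (up to isomorphism in `A(C)`). -/
noncomputable def tStructure : TStructure (Ac C) where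
  le := acyclicLE
  ge := acyclicGE
  le_shift n a n' h X := by
    rintro ⟨Y, hY, ⟨e⟩⟩
    exact ⟨_, Y.complex.isStrictlyLE_shift n a n' h,
      ⟨(shiftFunctor _ a).mapIso e ≪≫ shiftIso Y a⟩⟩
  ge_shift n a n' h X := by
    rintro ⟨Y, hY, ⟨e⟩⟩
    exact ⟨_, Y.complex.isStrictlyGE_shift (n - 2) a (n' - 2) (by lia),
      ⟨(shiftFunctor _ a).mapIso e ≪≫ shiftIso Y a⟩⟩
  zero' X Y f := by
    rintro ⟨K, hK, ⟨e⟩⟩ ⟨L, hL, ⟨e'⟩⟩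
    suffices h : ∀ g : K ⟶ L, g = 0 by
      rw [← cancel_epi e.inv, ← cancel_mono e'.hom, h ((e.inv ≫ f) ≫ e'.hom), comp_zero,
        zero_comp]
    intro g
    obtain ⟨φ : K.obj.as ⟶ L.obj.as, hφ⟩ :=
      (HomotopyCategory.quotient _ _).map_surjective g.hom
    obtain ⟨h⟩ := nonempty_homotopy_zero φ hK L.property hL
    apply (acyclic C).ι.map_injective
    have := HomotopyCategory.eq_of_homotopy _ _ h
    rw [hφ] at this
    exact this.trans (Functor.map_zero _ _ _)
  le_zero_le := by
    rintro X ⟨Y, hY, ⟨e⟩⟩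
    have : Y.complex.IsStrictlyLE 0 := hY
    exact ⟨Y, Y.complex.isStrictlyLE_of_le 0 1 (by lia), ⟨e⟩⟩
  ge_one_le := by
    rintro X ⟨Y, hY, ⟨e⟩⟩
    have : Y.complex.IsStrictlyGE (1 - 2) := hY
    exact ⟨Y, Y.complex.isStrictlyGE_of_ge (0 - 2) (1 - 2) (by lia), ⟨e⟩⟩
  exists_triangle_zero_one K := by
    obtain ⟨A, B, φ, hA, hA', hB, hB', ⟨e⟩⟩ := exists_truncation K.property
    let A' : Ac C := ⟨(HomotopyCategory.quotient _ _).obj A, hA⟩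
    let B' : Ac C := ⟨(HomotopyCategory.quotient _ _).obj B, hB⟩
    let φ' : A' ⟶ K := (acyclic C).ι.preimage ((HomotopyCategory.quotient _ _).map φ)
    obtain ⟨X, g, h, hT⟩ := distinguished_cocone_triangle φ'
    have i := Triangle.π₃.mapIso (isoTriangleOfIso₁₂ _ _ ((acyclic C).ι.map_distinguished _ hT)
          (HomotopyCategory.mappingCone_triangleh_distinguished φ)
          (Iso.refl _) (Iso.refl _) ((Category.comp_id _).trans
            (((acyclic C).ι.map_preimage _).trans (Category.id_comp _).symm)))
    let i' : X ≅ B' := (acyclic C).fullyFaithfulι.preimageIso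
      (i ≪≫ HomotopyCategory.isoOfHomotopyEquiv e)
    exact ⟨A', X, ⟨A', hA', ⟨Iso.refl _⟩⟩, ⟨B', hB', ⟨i'⟩⟩, φ', g, h, hT⟩

section Heart

variable {T : Type u} [Category.{v} T] [Preadditive T] [HasZeroObject T] [HasShift T ℤ]
  [∀ n : ℤ, (shiftFunctor T n).Additive] [Pretriangulated T] (t : TStructure T)

lemma heart_isClosedUnderBinaryProducts : t.heart.IsClosedUnderBinaryProducts where
  limitsOfShape_le := by
    rintro X ⟨p⟩
    have h₁ := (t.mem_heart_iff _).1 (p.prop_diag_obj (.mk .left))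
    have h₂ := (t.mem_heart_iff _).1 (p.prop_diag_obj (.mk .right))
    refine t.heart.prop_of_iso (X := p.diag.obj (.mk .left) ⨯ p.diag.obj (.mk .right)) ?_
      ((t.mem_heart_iff _).2 ⟨t.isLE₂ _ (binaryProductTriangle_distinguished _ _) 0 h₁.1 h₂.1,
        t.isGE₂ _ (binaryProductTriangle_distinguished _ _) 0 h₁.2 h₂.2⟩)
    exact IsLimit.conePointUniqueUpToIso (prodIsProd _ _)
      ((IsLimit.postcomposeHomEquiv (diagramIsoPair p.diag) _).2 p.isLimit)

instance : t.heart.ContainsZero :=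
  ⟨0, isZero_zero T, (t.mem_heart_iff _).2 ⟨inferInstance, inferInstance⟩⟩

instance : t.heart.IsClosedUnderFiniteProducts := by
  have := heart_isClosedUnderBinaryProducts t
  exact .mk'

variable {t}

lemma heart_hom_eq_zero ⦃X Y : t.heart.FullSubcategory⦄ ⦃n : ℤ⦄
    (f : t.heart.ι.obj X ⟶ (t.heart.ι.obj Y)⟦n⟧) (hn : n < 0) : f = 0 := by
  have h₁ := ((t.mem_heart_iff _).1 X.property).1
  have h₂ := ((t.mem_heart_iff _).1 Y.property).2
  have h₃ := t.isGE_shift Y.obj 0 n (-n) (by lia)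
  exact t.zero_of_isLE_of_isGE f 0 (-n) (by lia) h₁ h₃

lemma heart_admissible :
    AbelianSubcategory.admissibleMorphism t.heart.ι = ⊤ := by
  ext X₁ X₂ f₁
  simp only [MorphismProperty.top_apply, iff_true]
  intro X₃ f₂ f₃ hT
  have h₁ := (t.mem_heart_iff _).1 X₁.property
  have h₂ := (t.mem_heart_iff _).1 X₂.property
  have := h₁.1
  have := h₁.2
  have := h₂.1
  have := h₂.2
  have hX₁ : t.IsLE (X₁.obj⟦(1 : ℤ)⟧) (-1) := t.isLE_shift X₁.obj 0 1 (-1) (by lia)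
  have h₃ : t.IsLE X₃ 0 := t.isLE₂ _ (rot_of_distTriang _ hT) 0 h₂.1
    (t.isLE_of_le (X₁.obj⟦(1 : ℤ)⟧) (-1) 0)
  have h₃' : t.IsGE X₃ (-1) := t.isGE₂ _ (rot_of_distTriang _ hT) (-1)
    (t.isGE_of_ge X₂.obj (-1) 0) (t.isGE_shift X₁.obj 0 1 (-1) (by lia))
  obtain ⟨K, Q, hK, hQ, α, β, γ, hT'⟩ := t.exists_triangle X₃ (-1) 0 (by lia)
  rw [t.le_iff_isLE] at hK
  rw [t.ge_iff_isGE] at hQ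
  have hQ' : t.IsLE Q 0 := by
    have : t.IsLE (K⟦(1 : ℤ)⟧) (-2) := t.isLE_shift K (-1) 1 (-2) (by lia)
    exact t.isLE₂ _ (rot_of_distTriang _ hT') 0 h₃ (t.isLE_of_le (K⟦(1 : ℤ)⟧) (-2) 0)
  have hK' : t.IsGE K (-1) := by
    have : t.IsGE (Q⟦(-1 : ℤ)⟧) 1 := t.isGE_shift Q 0 (-1) 1 (by lia)
    exact t.isGE₂ _ (inv_rot_of_distTriang _ hT') (-1)
      (t.isGE_of_ge (Q⟦(-1 : ℤ)⟧) (-1) 1) h₃'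
  let e : K⟦(-1 : ℤ)⟧⟦(1 : ℤ)⟧ ≅ K := (shiftEquiv T (1 : ℤ)).counitIso.app K
  refine ⟨⟨K⟦(-1 : ℤ)⟧, (t.mem_heart_iff _).2 ⟨t.isLE_shift K (-1) (-1) 0 (by lia),
    t.isGE_shift K (-1) (-1) 0 (by lia)⟩⟩, ⟨Q, (t.mem_heart_iff _).2 ⟨hQ', hQ⟩⟩,
    e.hom ≫ α, β, γ ≫ e.inv⟦(1 : ℤ)⟧', ?_⟩
  refine isomorphic_distinguished _ hT' _ (Triangle.isoMk _ _ e (Iso.refl _) (Iso.refl _) ?_ ?_ ?_)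
  · dsimp
    exact Category.comp_id _
  · dsimp
    exact (Category.comp_id _).trans (Category.id_comp _).symm
  · have : (γ ≫ e.inv⟦(1 : ℤ)⟧') ≫ e.hom⟦(1 : ℤ)⟧' = 𝟙 _ ≫ γ := by simp [← Functor.map_comp]
    exact this

/-- The heart of a t-structure is an abelian category. -/
noncomputable abbrev heartAbelian [IsTriangulated T] (t : TStructure T) :
    Abelian t.heart.FullSubcategory :=
  AbelianSubcategory.abelian t.heart.ι heart_hom_eq_zero heart_admissible

end Heart

/-- The heart `A(C)^♥` of the t-structure on `A(C)`. -/
abbrev Heart := (tStructure C).heart.FullSubcategory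

noncomputable instance : Abelian (Heart C) := heartAbelian _

noncomputable instance : HasDerivedCategory (Heart C) := HasDerivedCategory.standard _

/-- The triangulated category `A^b(C)` of bounded acyclic complexes up to homotopy, as a full
subcategory of `A(C)`. -/
abbrev Acb := (boundedAcyclic C).FullSubcategory

/-- The functor `A(C)^♥ ⥤ D^b(A(C)^♥)` which sends an object to the corresponding complex
concentrated in degree `0`. -/
noncomputable def heartToDerived : Heart C ⥤ DerivedCategory.Bounded (Heart C) :=
  ObjectProperty.lift _ (DerivedCategory.singleFunctor (Heart C) 0)
    (fun _ ↦ ⟨⟨0, inferInstance⟩, ⟨0, inferInstance⟩⟩)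

/-- A realization functor: a triangulated functor `F : D^b(A(C)^♥) ⥤ A^b(C)` such that the
composition `A(C)^♥ ⥤ D^b(A(C)^♥) ⥤ A^b(C)` is (isomorphic to) the inclusion of the heart. -/
structure RealizationFunctor where
  /-- The underlying functor `F`. -/
  functor : DerivedCategory.Bounded (Heart C) ⥤ Acb C
  /-- The isomorphisms expressing the compatibility of `F` with the shifts. -/
  [commShift : functor.CommShift ℤ]
  [isTriangulated : functor.IsTriangulated]
  /-- The factorization of the inclusion of the heart in `A(C)`. -/
  iso : heartToDerived C ⋙ functor ⋙ (boundedAcyclic C).ι ≅ (tStructure C).heart.ι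

end Exact

/-! The equivalence reduces to a condition on the t-structure alone, so the choice of `F` plays no
role. Bounded acyclic complexes are bounded for the t-structure, hence iterated extensions of shifts
of heart objects. So a fully faithful `F` is automatically essentially surjective, and full
faithfulness need only be tested on morphisms `M ⟶ N⟦n⟧` with `M`, `N` in the heart. For `n < 0`
both sides vanish, and for `n = 0` the hypothesis on `F` settles the matter. In positive degrees,
morphisms in the derived category of an abelian category are effaceable: each is killed by an
epimorphism `M' ⟶ M`. Dimension shifting shows conversely that `F` is fully faithful as soon as the
same effaceability holds in `A(C)` (`bijectiveOn_of_effaceable`, `bijectiveOn_iff_effaceable`).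

Heart objects are represented by acyclic complexes in degrees -2, -1, 0 (`exists_iso_of_heart`).
Thus `M ⟶ N⟦n⟧` vanishes for `n ≥ 3`. For `n = 1` such a morphism is the class of an extension
inside the heart, hence effaceable. Only `n = 2` has content, and `isHereditary_iff_effaceable`
compares it with heredity. On the other side, vanishing of morphisms in the Verdier quotient becomes
a factorization property of pairs `W ⟶ A ⟶ Y⟦1⟧` with zero composite and `A` acyclic
(`exists_factorization_of_hom_Q_eq_zero`, `hom_Q_eq_zero`). The bridge between the two consists of
the end terms of a three-term acyclic complex: a map out of it is detected on its last component and
a map into it on its first. Truncating the acyclic objects of the factorization property then turns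
them into heart objects, and conversely.

For existence, embed `C` in additive presheaves by Yoneda. Representables are projective, so bounded
acyclic complexes embed fully faithfully in the derived category of presheaves
(`bijectiveOn_yonedaDerived`). The embedding is compatible with t-structures because the first
differential of an acyclic complex bounded below is a kernel of the second
(`isGE_yonedaDerived_obj`). It therefore induces an exact functor from the heart to presheaves. The
functor this induces on derived categories sends bounded objects into the image of the bounded
acyclic complexes, by dévissage; lifting it through the embedding gives a realization functor. -/

namespace CategoryTheory

/-! ### Dévissage along a t-structure -/

namespace Triangulated.TStructure

variable {T : Type*} [Category* T] [Preadditive T] [HasZeroObject T] [HasShift T ℤ]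
  [∀ n : ℤ, (shiftFunctor T n).Additive] [Pretriangulated T] [IsTriangulated T]
  (t : TStructure T)

/-- Dévissage: a property of objects which is closed under extensions holds for all the objects
in the interval `[a, b]` as soon as it holds for the suitable shifts of the objects
of the heart. -/
lemma prop_of_heart_shift (P : ObjectProperty T) [P.IsClosedUnderIsomorphisms]
    [P.IsTriangulatedClosed₂] [P.ContainsZero] {a b : ℤ}
    (hP : ∀ (X : T) (n : ℤ), t.heart X → a ≤ -n → -n ≤ b → P (X⟦n⟧)) (X : T)
    (hX : t.IsLE X b) (hX' : t.IsGE X a) : P X := by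
  -- The number `k` bounds the length of the interval `[a, b]`; the induction splits off the lowest
  -- degree.
  obtain ⟨k, hk⟩ : ∃ k : ℕ, b + 1 ≤ a + k := ⟨(b + 1 - a).toNat, by lia⟩
  induction k generalizing X a with
  | zero => exact P.prop_of_isZero (t.isZero X b a (by lia))
  | succ k h =>
    by_cases hab : b < a
    · exact P.prop_of_isZero (t.isZero X b a (by lia))
    refine P.ext_of_isTriangulatedClosed₂ _ (t.triangleLEGE_distinguished a (a + 1) rfl X) ?_ ?_
    · have h₁ : t.IsLE ((t.truncLE a).obj X) a := inferInstance
      have h₂ : t.IsGE ((t.truncLE a).obj X) a := inferInstance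
      refine P.prop_of_iso ((shiftEquiv T a).unitIso.symm.app ((t.truncLE a).obj X))
        (hP _ (-a) ?_ (by lia) (by lia))
      exact (t.mem_heart_iff _).2 ⟨t.isLE_shift _ a a 0 (by lia), t.isGE_shift _ a a 0 (by lia)⟩
    · have h₁ : t.IsLE ((t.truncGE (a + 1)).obj X) b := inferInstance
      have h₂ : t.IsGE ((t.truncGE (a + 1)).obj X) (a + 1) := inferInstance
      exact h (a := a + 1) (fun X n hX h₁ h₂ ↦ hP X n hX (by lia) h₂) _ h₁ h₂ (by lia)

/-- Stability under shifts makes the interval irrelevant in the dévissage. This form serves three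
times: for full faithfulness, for essential surjectivity and for the construction of a realization
functor. -/
lemma bounded_le_of_heart_le (P : ObjectProperty T) [P.IsClosedUnderIsomorphisms]
    [P.IsTriangulated] (hP : t.heart ≤ P) : t.bounded ≤ P := by
  rintro X ⟨⟨a, ha⟩, ⟨b, hb⟩⟩
  exact t.prop_of_heart_shift P (a := a) (b := b) (fun X n hX _ _ ↦ P.le_shift n _ (hP _ hX))
    X hb ha

end Triangulated.TStructure

/-! ### Exactness properties of distinguished triangles -/

section

variable {T : Type*} [Category* T] [Preadditive T] [HasZeroObject T] [HasShift T ℤ]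
  [∀ n : ℤ, (shiftFunctor T n).Additive] [Pretriangulated T]
  {X Y Z W : T} {f : X ⟶ Y} {g : Y ⟶ Z} {h : Z ⟶ X⟦(1 : ℤ)⟧}

lemma comp_eq_zero_of_distTriang (hT : Triangle.mk f g h ∈ distTriang T) : f ≫ g = 0 :=
  comp_distTriang_mor_zero₁₂ _ hT

lemma exists_lift_of_distTriang (hT : Triangle.mk f g h ∈ distTriang T) (x : W ⟶ Y)
    (hx : x ≫ g = 0) : ∃ y : W ⟶ X, x = y ≫ f :=
  Triangle.coyoneda_exact₂ _ hT x hx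

lemma exists_desc_of_distTriang (hT : Triangle.mk f g h ∈ distTriang T) (x : Y ⟶ W)
    (hx : f ≫ x = 0) : ∃ y : Z ⟶ W, x = g ≫ y :=
  Triangle.yoneda_exact₂ _ hT x hx

lemma rotate_mk_distinguished (hT : Triangle.mk f g h ∈ distTriang T) :
    Triangle.mk g h (-f⟦(1 : ℤ)⟧') ∈ distTriang T :=
  rot_of_distTriang _ hT

lemma exists_invRotate_of_distTriang (hT : Triangle.mk f g h ∈ distTriang T) :
    ∃ (i : Z⟦(-1 : ℤ)⟧ ⟶ X) (l : Y ⟶ Z⟦(-1 : ℤ)⟧⟦(1 : ℤ)⟧), Triangle.mk i f l ∈ distTriang T :=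
  ⟨_, _, inv_rot_of_distTriang _ hT⟩

lemma map_mk_distinguished {T' : Type*} [Category* T'] [Preadditive T'] [HasZeroObject T']
    [HasShift T' ℤ] [∀ n : ℤ, (shiftFunctor T' n).Additive] [Pretriangulated T'] (F : T ⥤ T')
    [F.CommShift ℤ] [F.IsTriangulated] (hT : Triangle.mk f g h ∈ distTriang T) :
    Triangle.mk (F.map f) (F.map g) (F.map h ≫ (F.commShiftIso (1 : ℤ)).hom.app X) ∈
      distTriang T' :=
  F.map_distinguished _ hT

end

/-! ### Full faithfulness of triangulated functors by dévissage -/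

namespace Functor

variable {D T : Type*} [Category* D] [Category* T]

/-- The condition that a functor induces a bijection on the morphisms between two objects. -/
def BijectiveOn (F : D ⥤ T) (X Y : D) : Prop :=
  Function.Bijective (F.map : (X ⟶ Y) → _)

namespace BijectiveOn

variable {F : D ⥤ T} {X Y X' Y' : D}

lemma of_iso (h : F.BijectiveOn X Y) (e : X ≅ X') (e' : Y ≅ Y') : F.BijectiveOn X' Y' := by
  refine ⟨fun f g hfg ↦ ?_, fun g ↦ ?_⟩
  · have := h.1 (a₁ := e.hom ≫ f ≫ e'.inv) (a₂ := e.hom ≫ g ≫ e'.inv) (by simp [hfg])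
    simpa using this
  · obtain ⟨f, hf⟩ := h.2 (F.map e.hom ≫ g ≫ F.map e'.inv)
    exact ⟨e.inv ≫ f ≫ e'.hom, by rw [F.map_comp, F.map_comp, hf]; simp⟩

variable [HasShift D ℤ] [HasShift T ℤ] [F.CommShift ℤ]

lemma shift (h : F.BijectiveOn X Y) (n : ℤ) : F.BijectiveOn (X⟦n⟧) (Y⟦n⟧) := by
  have h₁ : ∀ f : X ⟶ Y, F.map (f⟦n⟧') = (F.commShiftIso n).hom.app X ≫ (F.map f)⟦n⟧' ≫
      (F.commShiftIso n).inv.app Y := fun f ↦ by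
    rw [← F.commShiftIso_hom_naturality_assoc]
    exact ((congrArg (F.map (f⟦n⟧') ≫ ·) ((F.commShiftIso n).hom_inv_id_app Y)).trans
      (Category.comp_id _)).symm
  refine ⟨fun f g hfg ↦ ?_, fun g ↦ ?_⟩
  · obtain ⟨f, rfl⟩ := (shiftFunctor D n).map_surjective f
    obtain ⟨g, rfl⟩ := (shiftFunctor D n).map_surjective g
    rw [h₁, h₁, cancel_epi, cancel_mono] at hfg
    rw [h.1 ((shiftFunctor T n).map_injective hfg)]
  · obtain ⟨g', hg'⟩ := (shiftFunctor T n).map_surjective ((F.commShiftIso n).inv.app X ≫ g ≫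
      (F.commShiftIso n).hom.app Y)
    obtain ⟨f, rfl⟩ := h.2 g'
    refine ⟨f⟦n⟧', ?_⟩
    rw [h₁, hg']
    simp

variable [Preadditive D] [HasZeroObject D] [∀ n : ℤ, (shiftFunctor D n).Additive]
  [Pretriangulated D] [Preadditive T] [HasZeroObject T] [∀ n : ℤ, (shiftFunctor T n).Additive]
  [Pretriangulated T] [F.IsTriangulated]

/-- This is the five lemma for the long exact sequences obtained from `Hom(X, -)`, written as a
chase; the terms that intervene are `A₃⟦-1⟧`, `A₁`, `A₃` and `A₁⟦1⟧`. -/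
lemma ext_right {A₁ A₂ A₃ : D} {f : A₁ ⟶ A₂} {g : A₂ ⟶ A₃} {k : A₃ ⟶ A₁⟦(1 : ℤ)⟧}
    (hA : Triangle.mk f g k ∈ distTriang D)
    (h₁ : ∀ n : ℤ, F.BijectiveOn X (A₁⟦n⟧)) (h₃ : ∀ n : ℤ, F.BijectiveOn X (A₃⟦n⟧)) :
    F.BijectiveOn X A₂ := by
  have e₁ : F.BijectiveOn X A₁ := (h₁ 0).of_iso (Iso.refl _) ((shiftFunctorZero D ℤ).app _)
  have e₃ : F.BijectiveOn X A₃ := (h₃ 0).of_iso (Iso.refl _) ((shiftFunctorZero D ℤ).app _)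
  refine ⟨(injective_iff_map_eq_zero F.mapAddHom).2 fun x hx ↦ ?_, fun u ↦ ?_⟩
  · change F.map x = 0 at hx
    obtain ⟨y, rfl⟩ := exists_lift_of_distTriang hA x (e₃.1 (by
      rw [F.map_comp, hx, zero_comp, F.map_zero]))
    obtain ⟨i, l, hA'⟩ := exists_invRotate_of_distTriang hA
    obtain ⟨z, hz⟩ := exists_lift_of_distTriang (map_mk_distinguished F hA')
      (F.map y) (by rw [← F.map_comp, hx])
    obtain ⟨z, rfl⟩ := (h₃ (-1)).2 z
    obtain rfl : y = z ≫ i := e₁.1 (by rw [F.map_comp, hz])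
    rw [Category.assoc, comp_eq_zero_of_distTriang hA', comp_zero]
  · obtain ⟨v, hv⟩ := e₃.2 (u ≫ F.map g)
    obtain ⟨x, rfl⟩ := exists_lift_of_distTriang (rotate_mk_distinguished hA) v ((h₁ 1).1 (by
      rw [F.map_comp, hv, Category.assoc, ← F.map_comp,
        comp_eq_zero_of_distTriang (rotate_mk_distinguished hA), F.map_zero, comp_zero,
        F.map_zero]))
    obtain ⟨y, hy⟩ := exists_lift_of_distTriang (map_mk_distinguished F hA) (u - F.map x) (by
      rw [Preadditive.sub_comp, sub_eq_zero, ← hv, F.map_comp])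
    obtain ⟨y, rfl⟩ := e₁.2 y
    exact ⟨x + y ≫ f, by rw [F.map_add, F.map_comp, ← hy, add_sub_cancel]⟩

/-- The dual five lemma, for the contravariant long exact sequences; the terms that intervene are
`A₁⟦1⟧`, `A₃`, `A₁` and `A₃⟦-1⟧`. -/
lemma ext_left {A₁ A₂ A₃ : D} {f : A₁ ⟶ A₂} {g : A₂ ⟶ A₃} {k : A₃ ⟶ A₁⟦(1 : ℤ)⟧}
    (hA : Triangle.mk f g k ∈ distTriang D)
    (h₁ : ∀ n : ℤ, F.BijectiveOn (A₁⟦n⟧) Y) (h₃ : ∀ n : ℤ, F.BijectiveOn (A₃⟦n⟧) Y) :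
    F.BijectiveOn A₂ Y := by
  have e₁ : F.BijectiveOn A₁ Y := (h₁ 0).of_iso ((shiftFunctorZero D ℤ).app _) (Iso.refl _)
  have e₃ : F.BijectiveOn A₃ Y := (h₃ 0).of_iso ((shiftFunctorZero D ℤ).app _) (Iso.refl _)
  refine ⟨(injective_iff_map_eq_zero F.mapAddHom).2 fun x hx ↦ ?_, fun u ↦ ?_⟩
  · change F.map x = 0 at hx
    obtain ⟨y, rfl⟩ := exists_desc_of_distTriang hA x (e₁.1 (by
      rw [F.map_comp, hx, comp_zero, F.map_zero]))
    have hA' := rotate_mk_distinguished hA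
    obtain ⟨z, hz⟩ := exists_desc_of_distTriang (map_mk_distinguished F hA')
      (F.map y) (by rw [← F.map_comp, hx])
    obtain ⟨z, rfl⟩ := (h₁ 1).2 z
    obtain rfl : y = k ≫ z := e₃.1 (by rw [F.map_comp, hz])
    rw [← Category.assoc, comp_eq_zero_of_distTriang hA', zero_comp]
  · obtain ⟨v, hv⟩ := e₁.2 (F.map f ≫ u)
    obtain ⟨i, l, hA'⟩ := exists_invRotate_of_distTriang hA
    obtain ⟨x, rfl⟩ := exists_desc_of_distTriang hA' v ((h₃ (-1)).1 (by
      rw [F.map_comp, hv, ← Category.assoc, ← F.map_comp, comp_eq_zero_of_distTriang hA',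
        F.map_zero, zero_comp, F.map_zero]))
    obtain ⟨y, hy⟩ := exists_desc_of_distTriang (map_mk_distinguished F hA) (u - F.map x) (by
      rw [Preadditive.comp_sub, sub_eq_zero, ← hv, F.map_comp])
    obtain ⟨y, rfl⟩ := e₃.2 y
    exact ⟨x + g ≫ y, by rw [F.map_add, F.map_comp, ← hy, add_sub_cancel]⟩

end BijectiveOn

variable [HasShift D ℤ] [HasShift T ℤ] (F : D ⥤ T) [F.CommShift ℤ]
  [Preadditive D] [HasZeroObject D] [∀ n : ℤ, (shiftFunctor D n).Additive]
  [Pretriangulated D] [Preadditive T] [HasZeroObject T] [∀ n : ℤ, (shiftFunctor T n).Additive]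
  [Pretriangulated T] [F.IsTriangulated]

/-- The objects `Y` such that `F` is bijective on morphisms from `X` to all the shifts of `Y`. -/
def bijectiveOnShifts (X : D) : ObjectProperty D :=
  fun Y ↦ ∀ n : ℤ, F.BijectiveOn X (Y⟦n⟧)

instance (X : D) : (F.bijectiveOnShifts X).IsClosedUnderIsomorphisms where
  of_iso e h n := (h n).of_iso (Iso.refl _) ((shiftFunctor D n).mapIso e)

instance (X : D) : (F.bijectiveOnShifts X).IsTriangulated where
  exists_zero := ⟨0, isZero_zero D, fun n ↦ by
    have h : IsZero ((0 : D)⟦n⟧) := (shiftFunctor D n).map_isZero (isZero_zero D)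
    exact ⟨fun _ _ _ ↦ h.eq_of_tgt _ _, fun _ ↦ ⟨0, (F.map_isZero h).eq_of_tgt _ _⟩⟩⟩
  isStableUnderShiftBy a := ⟨fun Y hY n ↦
    (hY (a + n)).of_iso (Iso.refl _) ((shiftFunctorAdd D a n).app Y)⟩
  toIsTriangulatedClosed₂ := .mk' fun A hA h₁ h₃ n ↦
    BijectiveOn.ext_right (Triangle.shift_distinguished _ hA n)
      (fun m ↦ (h₁ (n + m)).of_iso (Iso.refl _) ((shiftFunctorAdd D n m).app _))
      (fun m ↦ (h₃ (n + m)).of_iso (Iso.refl _) ((shiftFunctorAdd D n m).app _))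

/-- The objects `X` such that `F` is bijective on all the morphisms from `X`. -/
def bijectiveFrom : ObjectProperty D := fun X ↦ ∀ Y, F.BijectiveOn X Y

variable {F} in
lemma bijectiveFrom.shift {X : D} (h : F.bijectiveFrom X) (n : ℤ) :
    F.bijectiveFrom (X⟦n⟧) := fun Y ↦
  ((h (Y⟦-n⟧)).shift n).of_iso (Iso.refl _) ((shiftEquiv D n).counitIso.app Y)

instance : F.bijectiveFrom.IsClosedUnderIsomorphisms where
  of_iso e h Y := (h Y).of_iso e (Iso.refl _)

instance : F.bijectiveFrom.IsTriangulated where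
  exists_zero := ⟨0, isZero_zero D, fun n ↦
    ⟨fun _ _ _ ↦ (isZero_zero D).eq_of_src _ _,
      fun _ ↦ ⟨0, (F.map_isZero (isZero_zero D)).eq_of_src _ _⟩⟩⟩
  isStableUnderShiftBy a := ⟨fun _ hX ↦ hX.shift a⟩
  toIsTriangulatedClosed₂ := .mk' fun A hA h₁ h₃ Y ↦
    BijectiveOn.ext_left hA (fun m ↦ h₁.shift m Y) (fun m ↦ h₃.shift m Y)

/-- A triangulated functor from a triangulated category all of whose objects are bounded for a
t-structure is fully faithful if it is bijective on the morphisms between objects of the heart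
and shifts of objects of the heart. -/
lemma bijectiveOn_of_heart [CategoryTheory.IsTriangulated D] (t : TStructure D) (ht : t.bounded = ⊤)
    (h : ∀ (X Y : D) (n : ℤ), t.heart X → t.heart Y → F.BijectiveOn X (Y⟦n⟧)) (X Y : D) :
    F.BijectiveOn X Y := by
  -- Dévissage in the target with the source fixed in the heart, followed by dévissage in the
  -- source.
  have h₁ : ∀ X, t.heart X → F.bijectiveFrom X := fun X hX Y ↦
    (t.bounded_le_of_heart_le (F.bijectiveOnShifts X) (fun Y hY n ↦ h X Y n hX hY) Y
      (by rw [ht]; trivial) 0).of_iso (Iso.refl _) ((shiftFunctorZero D ℤ).app _)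
  exact t.bounded_le_of_heart_le _ h₁ X (by rw [ht]; trivial) Y

end Functor

end CategoryTheory

/-! ### Effaceability in the bounded derived category of an abelian category -/

namespace DerivedCategory

open CategoryTheory.DerivedCategory

variable {H : Type*} [Category* H] [Abelian H] [HasDerivedCategory H]

/-- Any morphism `M ⟶ N⟦n⟧` in the derived category with `n ≠ 0` vanishes after
the composition with a suitable epimorphism `M' ⟶ M`. -/
lemma exists_epi_single_map_comp_eq_zero {M N : H} {n : ℤ} (hn : n ≠ 0)
    (x : (singleFunctor H 0).obj M ⟶ ((singleFunctor H 0).obj N)⟦n⟧) :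
    ∃ (M' : H) (p : M' ⟶ M), Epi p ∧ (singleFunctor H 0).map p ≫ x = 0 := by
  let sM : CochainComplex H ℤ := (HomologicalComplex.single H (ComplexShape.up ℤ) 0).obj M
  let sN : CochainComplex H ℤ := (HomologicalComplex.single H (ComplexShape.up ℤ) 0).obj N
  obtain ⟨x', hx'⟩ : ∃ x' : Q.obj sM ⟶ Q.obj (sN⟦n⟧),
      x = x' ≫ (Q.commShiftIso n).hom.app sN :=
    ⟨x ≫ (Q.commShiftIso n).inv.app sN,
      ((Category.assoc _ _ _).trans ((congrArg (x ≫ ·)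
        ((Q.commShiftIso n).inv_hom_id_app sN)).trans (Category.comp_id _))).symm⟩
  -- Represent the morphism by a roof with quasi-isomorphism `s : K ⟶ M` and numerator `g : K ⟶
  -- N⟦n⟧`. The degree 0 cocycles of `K`, placed in degree 0, map to `K` by `z`, surjectively on
  -- homology in degree 0; the composite with `s` is then the desired epimorphism onto `M`.
  obtain ⟨K, s, hs, g, fac⟩ := right_fac x'
  let z : (HomologicalComplex.single H (ComplexShape.up ℤ) 0).obj (K.cycles 0) ⟶ K :=
    HomologicalComplex.mkHomFromSingle (K.iCycles 0) (fun k _ ↦ by simp)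
  obtain ⟨p, hp⟩ := (HomologicalComplex.single H (ComplexShape.up ℤ) 0).map_surjective (z ≫ s)
  have hz : Epi (HomologicalComplex.homologyMap z 0) := by
    have h₁ : HomologicalComplex.cyclesMap z 0 =
        (HomologicalComplex.singleObjCyclesSelfIso (ComplexShape.up ℤ) 0 (K.cycles 0)).hom := by
      rw [← cancel_mono (K.iCycles 0), HomologicalComplex.cyclesMap_i,
        HomologicalComplex.mkHomFromSingle_f, HomologicalComplex.singleObjCyclesSelfIso_hom,
        Category.assoc]
    have h₂ : Epi (HomologicalComplex.homologyπ _ 0 ≫ HomologicalComplex.homologyMap z 0) := by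
      rw [HomologicalComplex.homologyπ_naturality, h₁]
      infer_instance
    exact epi_of_epi (HomologicalComplex.homologyπ _ 0) _
  have hs' : IsIso (HomologicalComplex.homologyMap s 0) := by
    rw [isIso_Q_map_iff_quasiIso] at hs
    infer_instance
  have hp' : Epi ((HomologicalComplex.single H (ComplexShape.up ℤ) 0 ⋙
      HomologicalComplex.homologyFunctor H (ComplexShape.up ℤ) 0).map p) := by
    have : Epi (HomologicalComplex.homologyMap (z ≫ s) 0) := by
      rw [HomologicalComplex.homologyMap_comp]
      infer_instance
    rw [← hp] at this
    exact this
  refine ⟨K.cycles 0, p, ?_, ?_⟩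
  · have := NatIso.naturality_2 (HomologicalComplex.homologyFunctorSingleIso H
      (ComplexShape.up ℤ) 0).symm p
    exact ((MorphismProperty.epimorphisms H).arrow_mk_iso_iff
      ((Functor.mapArrowFunctor _ _).mapIso (HomologicalComplex.homologyFunctorSingleIso H
      (ComplexShape.up ℤ) 0) |>.app (Arrow.mk p))).1 hp'
  -- A map from a complex concentrated in degree 0 is determined by its component there, and `N⟦n⟧`
  -- vanishes in degree 0 since `n ≠ 0`.
  · have hg : z ≫ g = 0 := HomologicalComplex.from_single_hom_ext (by
      refine (HomologicalComplex.isZero_single_obj_X (ComplexShape.up ℤ) 0 N (0 + n)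
        (by lia)).eq_of_tgt _ _)
    have h : (singleFunctor H 0).map p = Q.map z ≫ Q.map s := by
      rw [← Q.map_comp, ← hp]; rfl
    have h' : Q.map s ≫ x' = Q.map g := by
      rw [fac]
      exact IsIso.hom_inv_id_assoc _ _
    rw [h, hx']
    refine (Category.assoc _ _ _).trans ?_
    have h'' : Q.map s ≫ x' ≫ (Q.commShiftIso n).hom.app sN =
        Q.map g ≫ (Q.commShiftIso n).hom.app sN := by
      rw [← Category.assoc, h']
    refine (congrArg (Q.map z ≫ ·) h'').trans ?_
    rw [← Category.assoc, ← Q.map_comp, hg, Q.map_zero, zero_comp]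
    rfl

variable (H) in
/-- The functor which sends an object of an abelian category to the corresponding object
concentrated in degree `0` in the bounded derived category. -/
noncomputable def toBounded : H ⥤ DerivedCategory.Bounded H :=
  ObjectProperty.lift _ (singleFunctor H 0) (fun _ ↦ ⟨⟨0, inferInstance⟩, ⟨0, inferInstance⟩⟩)

lemma exists_epi_toBounded_map_comp_eq_zero {M N : H} {n : ℤ} (hn : n ≠ 0)
    (x : (toBounded H).obj M ⟶ ((toBounded H).obj N)⟦n⟧) :
    ∃ (M' : H) (p : M' ⟶ M), Epi p ∧ (toBounded H).map p ≫ x = 0 := by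
  obtain ⟨M', p, hp, h⟩ := exists_epi_single_map_comp_eq_zero hn
    (Bounded.ι.map x ≫ (Bounded.ι.commShiftIso n).hom.app ((toBounded H).obj N))
  refine ⟨M', p, hp, Bounded.ι.map_injective ?_⟩
  rw [← cancel_mono ((Bounded.ι.commShiftIso n).hom.app ((toBounded H).obj N)),
    Functor.map_comp, Category.assoc, Functor.map_zero, zero_comp]
  exact h

lemma exists_toBounded_distTriang {M' M : H} (p : M' ⟶ M) [Epi p] :
    ∃ (K : H) (i : K ⟶ M') (δ : (toBounded H).obj M ⟶ ((toBounded H).obj K)⟦(1 : ℤ)⟧),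
      Triangle.mk ((toBounded H).map i) ((toBounded H).map p) δ ∈
        distTriang (DerivedCategory.Bounded H) := by
  let S := ShortComplex.mk (kernel.ι p) p (kernel.condition p)
  have hS : S.ShortExact := { exact := S.exact_of_f_is_kernel (kernelIsKernel p) }
  have := hS.singleTriangle_distinguished
  let d : Bounded.ι.obj ((toBounded H).obj M) ⟶
    (Bounded.ι.obj ((toBounded H).obj (kernel p)))⟦(1 : ℤ)⟧ := hS.singleδ
  refine ⟨kernel p, kernel.ι p, Bounded.ι.preimage (d ≫
    (Bounded.ι.commShiftIso (1 : ℤ)).inv.app ((toBounded H).obj (kernel p))), ?_⟩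
  rw [← Bounded.ι.map_distinguished_iff]
  refine isomorphic_distinguished _ this _ (Triangle.isoMk _ _ (Iso.refl _) (Iso.refl _)
    (Iso.refl _) ?_ ?_ ?_)
  · exact (Category.comp_id _).trans (Category.id_comp _).symm
  · exact (Category.comp_id _).trans (Category.id_comp _).symm
  · have h := Bounded.ι.map_preimage (d ≫
      (Bounded.ι.commShiftIso (1 : ℤ)).inv.app ((toBounded H).obj (kernel p)))
    have h' : (d ≫ (Bounded.ι.commShiftIso (1 : ℤ)).inv.app
        ((toBounded H).obj (kernel p))) ≫ (Bounded.ι.commShiftIso (1 : ℤ)).hom.app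
        ((toBounded H).obj (kernel p)) = d :=
      (Category.assoc _ _ _).trans ((congrArg (d ≫ ·)
        ((Bounded.ι.commShiftIso (1 : ℤ)).inv_hom_id_app _)).trans (Category.comp_id _))
    refine Eq.trans ?_ (Category.id_comp _).symm
    refine (congrArg (_ ≫ ·) (CategoryTheory.Functor.map_id _ _)).trans ((Category.comp_id _).trans ?_)
    exact (congrArg (· ≫ (Bounded.ι.commShiftIso (1 : ℤ)).hom.app
        ((toBounded H).obj (kernel p))) h).trans h'

lemma exists_iso_toBounded_obj (X : DerivedCategory.Bounded H)
    (hX : (TStructure.t (C := H)).onBounded.heart X) :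
    ∃ M : H, Nonempty (X ≅ (toBounded H).obj M) := by
  obtain ⟨h₁, h₂⟩ := (CategoryTheory.Triangulated.TStructure.mem_heart_iff _ _).1 hX
  have h₁ : X.obj.IsLE 0 := ⟨h₁.1⟩
  have h₂ : X.obj.IsGE 0 := ⟨h₂.1⟩
  obtain ⟨M, ⟨e⟩⟩ := exists_iso_singleFunctor_obj_of_isGE_of_isLE X.obj 0
  exact ⟨M, ⟨ObjectProperty.fullyFaithfulι _ |>.preimageIso e⟩⟩

lemma onBounded_bounded : (TStructure.t (C := H)).onBounded.bounded = ⊤ := by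
  ext X
  simp only [Pi.top_apply, Prop.top_eq_true, iff_true]
  obtain ⟨⟨a, ha⟩, ⟨b, hb⟩⟩ := X.property
  exact ⟨⟨a, ⟨ha.1⟩⟩, ⟨b, ⟨hb.1⟩⟩⟩

variable {T : Type*} [Category* T] [Preadditive T] [HasZeroObject T] [HasShift T ℤ]
  [∀ n : ℤ, (shiftFunctor T n).Additive] [Pretriangulated T]
  (G : DerivedCategory.Bounded H ⥤ T) [G.CommShift ℤ] [G.IsTriangulated]

/-- A triangulated functor from the bounded derived category of `H` is fully faithful as soon as
it is bijective on morphisms `M ⟶ N⟦n⟧` for `n ≤ 0` and any morphism from the image of `M` to the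
image of `N⟦n⟧` with `n > 0` is killed by an epimorphism `M' ⟶ M` in `H`. -/
lemma bijectiveOn_of_effaceable
    (h₀ : ∀ (M N : H) (n : ℤ), n ≤ 0 →
      G.BijectiveOn ((toBounded H).obj M) (((toBounded H).obj N)⟦n⟧))
    (h₁ : ∀ (M N : H) (n : ℤ), 1 ≤ n →
      ∀ u : G.obj ((toBounded H).obj M) ⟶ G.obj (((toBounded H).obj N)⟦n⟧),
        ∃ (M' : H) (p : M' ⟶ M), Epi p ∧ G.map ((toBounded H).map p) ≫ u = 0)
    (X Y : DerivedCategory.Bounded H) : G.BijectiveOn X Y := by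
  have key : ∀ (n : ℕ) (M N : H),
      G.BijectiveOn ((toBounded H).obj M) (((toBounded H).obj N)⟦(n : ℤ)⟧) := by
    intro n
    induction n with
    | zero => exact fun M N ↦ h₀ M N _ le_rfl
    | succ n h =>
      intro M N
      -- Dimension shifting: morphisms `K⟦1⟧ ⟶ N⟦n + 1⟧` are covered by the induction hypothesis in
      -- degree `n`. Each morphism `M ⟶ N⟦n + 1⟧` below is expressed through such a morphism along
      -- the connecting map `δ : M ⟶ K⟦1⟧` of an epimorphism that kills it.
      have h' : ∀ K : H, G.BijectiveOn (((toBounded H).obj K)⟦(1 : ℤ)⟧)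
          (((toBounded H).obj N)⟦((n + 1 : ℕ) : ℤ)⟧) := fun K ↦
        ((h K N).shift 1).of_iso (Iso.refl _)
          ((shiftFunctorAdd' (DerivedCategory.Bounded H) (n : ℤ) 1 _ (by lia)).symm.app _)
      refine ⟨(injective_iff_map_eq_zero G.mapAddHom).2 fun x hx ↦ ?_, fun u ↦ ?_⟩
      · change G.map x = 0 at hx
        obtain ⟨M', p, hp, hpx⟩ := exists_epi_toBounded_map_comp_eq_zero (by lia) x
        obtain ⟨K, i, δ, hT⟩ := exists_toBounded_distTriang p
        obtain ⟨y, rfl⟩ := exists_desc_of_distTriang (rotate_mk_distinguished hT) x hpx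
        obtain ⟨z, hz⟩ := exists_desc_of_distTriang (map_mk_distinguished G
          (rotate_mk_distinguished (rotate_mk_distinguished hT))) (G.map y)
          -- Here `x = δ ≫ y` and `G` kills `x`, so `G.map y` extends along the image of `i⟦1⟧`, up
          -- to sign. The extension lifts to `z` by induction, and then `y` factors through the
          -- morphism following `δ` in the triangle.
          (by rw [← G.map_comp, hx])
        obtain ⟨z, rfl⟩ := (h' M').2 z
        have hy : y = (-((toBounded H).map i)⟦(1 : ℤ)⟧') ≫ z := (h' K).1 (by
          rw [hz, ← G.map_comp])
        rw [hy, ← Category.assoc, comp_eq_zero_of_distTriang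
          (rotate_mk_distinguished (rotate_mk_distinguished hT)), zero_comp]
      · obtain ⟨M', p, hp, hpx⟩ := h₁ M N _ (by lia) u
        obtain ⟨K, i, δ, hT⟩ := exists_toBounded_distTriang p
        obtain ⟨y, rfl⟩ := exists_desc_of_distTriang (map_mk_distinguished G
          (rotate_mk_distinguished hT)) u hpx
        obtain ⟨y, rfl⟩ := (h' K).2 y
        exact ⟨δ ≫ y, G.map_comp _ _⟩
  refine G.bijectiveOn_of_heart _ onBounded_bounded (fun X Y n hX hY ↦ ?_) X Y
  obtain ⟨M, ⟨e⟩⟩ := exists_iso_toBounded_obj X hX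
  obtain ⟨N, ⟨e'⟩⟩ := exists_iso_toBounded_obj Y hY
  suffices G.BijectiveOn ((toBounded H).obj M) (((toBounded H).obj N)⟦n⟧) from
    this.of_iso e.symm ((shiftFunctor _ n).mapIso e'.symm)
  obtain hn | hn := le_or_gt n 0
  · exact h₀ _ _ _ hn
  · obtain ⟨n, rfl⟩ := Int.eq_ofNat_of_zero_le hn.le
    exact key n M N

end DerivedCategory

/-! ### Effaceable objects for a t-structure -/

namespace CategoryTheory

section

variable {T : Type*} [Category* T] [Preadditive T] [HasZeroObject T] [HasShift T ℤ]
  [∀ n : ℤ, (shiftFunctor T n).Additive] [Pretriangulated T]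
  {X Y Z X' Y' Z' : T} {f : X ⟶ Y} {g : Y ⟶ Z} {h : Z ⟶ X⟦(1 : ℤ)⟧}
  {f' : X' ⟶ Y'} {g' : Y' ⟶ Z'} {h' : Z' ⟶ X'⟦(1 : ℤ)⟧}

lemma exists_hom₃_of_distTriang (hT : Triangle.mk f g h ∈ distTriang T)
    (hT' : Triangle.mk f' g' h' ∈ distTriang T) (a : X ⟶ X') (b : Y ⟶ Y')
    (hab : f ≫ b = a ≫ f') :
    ∃ c : Z ⟶ Z', g ≫ c = b ≫ g' ∧ h ≫ a⟦(1 : ℤ)⟧' = c ≫ h' :=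
  complete_distinguished_triangle_morphism _ _ hT hT' a b hab

lemma exists_hom₁_of_distTriang (hT : Triangle.mk f g h ∈ distTriang T)
    (hT' : Triangle.mk f' g' h' ∈ distTriang T) (b : Y ⟶ Y') (c : Z ⟶ Z')
    (hbc : g ≫ c = b ≫ g') :
    ∃ a : X ⟶ X', f ≫ b = a ≫ f' ∧ h ≫ a⟦(1 : ℤ)⟧' = c ≫ h' :=
  complete_distinguished_triangle_morphism₁ _ _ hT hT' b c hbc

end

namespace Triangulated.TStructure

variable {T : Type u} [Category.{v} T] [Preadditive T] [HasZeroObject T] [HasShift T ℤ]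
  [∀ n : ℤ, (shiftFunctor T n).Additive] [Pretriangulated T] (t : TStructure T)

lemma exists_distTriang_truncLE_truncGE (X : T) (a b : ℤ) (h : a + 1 = b) :
    ∃ (i : (t.truncLE a).obj X ⟶ X) (p : X ⟶ (t.truncGE b).obj X)
      (δ : (t.truncGE b).obj X ⟶ ((t.truncLE a).obj X)⟦(1 : ℤ)⟧),
      Triangle.mk i p δ ∈ distTriang T :=
  ⟨_, _, _, t.triangleLEGE_distinguished a b h X⟩

variable {t}

lemma heart_isLE {X : T} (hX : t.heart X) : t.IsLE X 0 := ((t.mem_heart_iff _).1 hX).1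

lemma heart_isGE {X : T} (hX : t.heart X) : t.IsGE X 0 := ((t.mem_heart_iff _).1 hX).2

/-- A morphism to a heart object which is killed by `p` factors through `K⟦1⟧`, and this object lies
in degrees `≤ -1`. The fibre `K` itself need not be in the heart. -/
lemma epi_of_distTriang {M' M : t.heart.FullSubcategory} {p : M' ⟶ M} {K : T} {i : K ⟶ M'.obj}
    {δ : M.obj ⟶ K⟦(1 : ℤ)⟧} (hT : Triangle.mk i p.hom δ ∈ distTriang T) (hK : t.IsLE K 0) :
    Epi p := by
  rw [Preadditive.epi_iff_cancel_zero]
  intro R r hr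
  apply t.heart.ι.map_injective
  obtain ⟨y, hy⟩ := exists_desc_of_distTriang (rotate_mk_distinguished hT) r.hom
    (congrArg t.heart.ι.map hr)
  have : y = 0 := t.zero_of_isLE_of_isGE y (-1) 0 (by lia) (t.isLE_shift K 0 1 (-1) (by lia))
    (heart_isGE R.property)
  rw [this, comp_zero] at hy
  exact hy

lemma exists_distTriang_of_epi {M' M : t.heart.FullSubcategory} (p : M' ⟶ M) [Epi p] :
    ∃ (K : T) (i : K ⟶ M'.obj) (δ : M.obj ⟶ K⟦(1 : ℤ)⟧), t.heart K ∧
      Triangle.mk i p.hom δ ∈ distTriang T := by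
  obtain ⟨K, i, δ, hT⟩ := AbelianSubcategory.exists_distinguished_triangle_of_epi
    (ι := t.heart.ι) Exact.heart_hom_eq_zero Exact.heart_admissible p
  exact ⟨K.obj, i.hom, δ, K.property, hT⟩

variable (t)

/-- The objects `Y` such that any morphism from an object `M` of the heart to `Y` vanishes after
the composition with an epimorphism `M' ⟶ M` in the heart. -/
def effaceable : ObjectProperty T := fun Y ↦
  ∀ (M : t.heart.FullSubcategory) (u : M.obj ⟶ Y),
    ∃ (M' : t.heart.FullSubcategory) (p : M' ⟶ M), Epi p ∧ p.hom ≫ u = 0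

instance : t.effaceable.IsClosedUnderIsomorphisms where
  of_iso {Y Y'} e hY M u := by
    obtain ⟨M', p, hp, h⟩ := hY M (u ≫ e.inv)
    exact ⟨M', p, hp, by rwa [← cancel_mono e.inv, Category.assoc, zero_comp]⟩

instance : t.effaceable.ContainsZero where
  exists_zero := ⟨0, isZero_zero T, fun M u ↦
    ⟨M, 𝟙 M, inferInstance, (isZero_zero T).eq_of_tgt _ _⟩⟩

/-- Two epimorphisms are composed: the first kills the image in the third term, the second kills the
resulting lift to the first term. -/
instance : t.effaceable.IsTriangulatedClosed₂ := .mk' (fun S hS h₁ h₃ M u ↦ by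
  obtain ⟨M', p, hp, hpu⟩ := h₃ M (u ≫ S.mor₂)
  obtain ⟨v, hv⟩ := Triangle.coyoneda_exact₂ S hS (p.hom ≫ u) (by rw [Category.assoc, hpu])
  obtain ⟨M'', q, hq, hqv⟩ := h₁ M' v
  refine ⟨M'', q ≫ p, epi_comp _ _, ?_⟩
  change (q.hom ≫ p.hom) ≫ u = 0
  rw [Category.assoc, hv, reassoc_of% hqv, zero_comp])

lemma effaceable_of_hom_eq_zero (Y : T)
    (hY : ∀ (M : t.heart.FullSubcategory) (u : M.obj ⟶ Y), u = 0) : t.effaceable Y :=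
  fun M u ↦ ⟨M, 𝟙 M, inferInstance, by rw [hY M u, comp_zero]⟩

/-- A morphism `M ⟶ N⟦1⟧` is the class of an extension of `M` by `N`. The middle term stays in the
heart, and its projection to `M` is an epimorphism killing the class. -/
lemma effaceable_shift_one {N : T} (hN : t.heart N) : t.effaceable (N⟦(1 : ℤ)⟧) := by
  intro M u
  obtain ⟨M', f, g, hT⟩ := distinguished_cocone_triangle₂ u
  have hM' : t.heart M' := (t.mem_heart_iff _).2
    ⟨t.isLE₂ _ hT 0 (heart_isLE hN) (heart_isLE M.property),
      t.isGE₂ _ hT 0 (heart_isGE hN) (heart_isGE M.property)⟩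
  exact ⟨⟨M', hM'⟩, ObjectProperty.homMk g, epi_of_distTriang hT (heart_isLE hN),
    comp_eq_zero_of_distTriang (rotate_mk_distinguished hT)⟩

/-- An object in degrees `[a, -1]` is an iterated extension of objects `N⟦n⟧` with `N` in the heart
and `n ≥ 1`, and effaceability passes to extensions. -/
lemma effaceable_of_isLE [IsTriangulated T]
    (h : ∀ (N : T) (n : ℤ), t.heart N → 1 ≤ n → t.effaceable (N⟦n⟧))
    (Y : T) (a : ℤ) (hY : t.IsLE Y (-1)) (hY' : t.IsGE Y a) : t.effaceable Y :=
  t.prop_of_heart_shift t.effaceable (fun X n hX _ hn ↦ h X n hX (by lia)) Y hY hY'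

end Triangulated.TStructure

/-! ### Vanishing of morphisms in a Verdier quotient -/

namespace ObjectProperty

variable {T : Type*} [Category* T] [Preadditive T] [HasZeroObject T] [HasShift T ℤ]
  [∀ n : ℤ, (shiftFunctor T n).Additive] [Pretriangulated T] [IsTriangulated T]
  (P : ObjectProperty T) [P.IsTriangulated]

/-- The fibre `K₀ ⟶ W` of `w` becomes invertible in the quotient, and `g` comes from a morphism `φ :
K₀ ⟶ Y`. The resulting fraction `W ⟶ Y` is zero, so `φ` is killed by some `K₁ ⟶ K₀` with cone in
`P`; the cone of the composite `K₁ ⟶ W` is the required `A'`. -/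
lemma exists_factorization_of_hom_Q_eq_zero {W Y A : T}
    (h : ∀ f : P.trW.Q.obj W ⟶ P.trW.Q.obj Y, f = 0)
    (hA : P A) (w : W ⟶ A) (g : A ⟶ Y⟦(1 : ℤ)⟧) (hwg : w ≫ g = 0) :
    ∃ (A' : T) (w' : W ⟶ A') (a : A' ⟶ A), P A' ∧ w' ≫ a = w ∧ a ≫ g = 0 := by
  obtain ⟨K₀, s, d, hT⟩ := distinguished_cocone_triangle₁ w
  have hs : P.trW s := trW.mk (T := Triangle.mk s w d) P hT hA
  obtain ⟨φ, rfl⟩ := exists_desc_of_distTriang (rotate_mk_distinguished hT) g hwg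
  obtain ⟨φ, rfl⟩ := (shiftFunctor T (1 : ℤ)).map_surjective φ
  have hφ : P.trW.Q.map φ = P.trW.Q.map 0 := by
    have := Localization.inverts P.trW.Q P.trW s hs
    rw [← IsIso.hom_inv_id_assoc (P.trW.Q.map s) (P.trW.Q.map φ),
      h (inv (P.trW.Q.map s) ≫ P.trW.Q.map φ), comp_zero, P.trW.Q.map_zero]
  obtain ⟨K₁, t, ht, htφ⟩ := (MorphismProperty.map_eq_iff_precomp P.trW.Q P.trW _ _).1 hφ
  rw [comp_zero] at htφ
  obtain ⟨A', w', d', hT', hA'⟩ := P.trW.comp_mem _ _ ht hs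
  obtain ⟨a, ha₁, ha₂⟩ := exists_hom₃_of_distTriang hT' hT t (𝟙 W) (Category.comp_id _)
  refine ⟨A', w', a, hA', ha₁.trans (Category.id_comp _), ?_⟩
  rw [← Category.assoc, ← ha₂, Category.assoc, ← Functor.map_comp, htφ, Functor.map_zero,
    comp_zero]

/-- A converse to the previous lemma. The cone `A` of the denominator of a fraction, with the
morphism to `Y⟦1⟧` given by the numerator, is a pair to which `h` applies. The fibre of `W ⟶ A'`
refines the denominator; on it the numerator extends to a morphism `W ⟶ Y`, which is zero by `h₀`.
-/
lemma hom_Q_eq_zero {W Y : T} (h₀ : ∀ f : W ⟶ Y, f = 0)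
    (h : ∀ (A : T) (_ : P A) (w : W ⟶ A) (g : A ⟶ Y⟦(1 : ℤ)⟧), w ≫ g = 0 →
      ∃ (A' : T) (w' : W ⟶ A') (a : A' ⟶ A), P A' ∧ w' ≫ a = w ∧ a ≫ g = 0)
    (f : P.trW.Q.obj W ⟶ P.trW.Q.obj Y) : f = 0 := by
  obtain ⟨φ, rfl⟩ := Localization.exists_rightFraction P.trW.Q P.trW f
  obtain ⟨A, w, d, hT, hA⟩ := φ.hs
  obtain ⟨A', w', a, hA', rfl, hag⟩ := h A hA w (d ≫ φ.f⟦(1 : ℤ)⟧') (by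
    rw [← Category.assoc, comp_eq_zero_of_distTriang (rotate_mk_distinguished hT), zero_comp])
  obtain ⟨K, t, d', hT'⟩ := distinguished_cocone_triangle₁ w'
  have ht : P.trW t := trW.mk (T := Triangle.mk t w' d') P hT' hA'
  obtain ⟨j, hj₁, hj₂⟩ := exists_hom₁_of_distTriang hT' hT (𝟙 W) a (Category.id_comp _).symm
  rw [Category.comp_id] at hj₁
  have hj : j ≫ φ.f = 0 := by
    apply (shiftFunctor T (1 : ℤ)).map_injective
    obtain ⟨y, hy⟩ := exists_desc_of_distTriang
      (rotate_mk_distinguished (rotate_mk_distinguished hT')) ((j ≫ φ.f)⟦(1 : ℤ)⟧') (by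
        rw [Functor.map_comp, ← Category.assoc, hj₂, Category.assoc, hag])
    obtain ⟨y, rfl⟩ := (shiftFunctor T (1 : ℤ)).map_surjective y
    rw [hy, h₀ y, Functor.map_zero, Functor.map_zero, comp_zero]
  have := Localization.inverts P.trW.Q P.trW _ φ.hs
  have := Localization.inverts P.trW.Q P.trW _ ht
  rw [← cancel_epi (P.trW.Q.map t), comp_zero, hj₁, Functor.map_comp, Category.assoc,
    φ.map_s_comp_map, ← Functor.map_comp, hj, Functor.map_zero]

end ObjectProperty

end CategoryTheory

/-! ### Homotopies of complexes concentrated in three degrees, and the objects of the heart -/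

namespace Exact

section Homotopies

variable {C : Type u} [Category.{v} C] [Preadditive C] {K L : CochainComplex C ℤ} {n₀ n₁ n₂ : ℤ}

lemma nonempty_homotopy_zero_of_eq (φ : K ⟶ L) (h₀₁ : n₀ + 1 = n₁) (h₁₂ : n₁ + 1 = n₂)
    (h₁ : K.X n₁ ⟶ L.X n₀) (h₂ : K.X n₂ ⟶ L.X n₁) (e₀ : φ.f n₀ = K.d n₀ n₁ ≫ h₁)
    (e₁ : φ.f n₁ = K.d n₁ n₂ ≫ h₂ + h₁ ≫ L.d n₀ n₁) (e₂ : φ.f n₂ = h₂ ≫ L.d n₁ n₂)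
    (e : ∀ i, i < n₀ ∨ n₂ < i → φ.f i = 0) : Nonempty (Homotopy φ 0) := by
  obtain ⟨θ, hθ₁, hθ₂, hθ⟩ : ∃ θ : ∀ i j, K.X i ⟶ L.X j, θ n₁ n₀ = h₁ ∧ θ n₂ n₁ = h₂ ∧
      ∀ i j, i ≠ n₁ → i ≠ n₂ → θ i j = 0 := by
    refine ⟨fun i j ↦ if h : i = n₁ ∧ j = n₀ then
      (K.XIsoOfEq h.1).hom ≫ h₁ ≫ (L.XIsoOfEq h.2).inv else
        if h : i = n₂ ∧ j = n₁ then (K.XIsoOfEq h.1).hom ≫ h₂ ≫ (L.XIsoOfEq h.2).inv else 0,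
      ?_, ?_, ?_⟩
    · simp
    · simp [show n₂ ≠ n₁ by omega]
    · intro i j hi hi'
      simp [hi, hi']
  have : φ = Homotopy.nullHomotopicMap' (fun i j _ ↦ θ i j) := by
    ext i
    rw [Homotopy.nullHomotopicMap'_f (k₂ := i - 1) (k₁ := i) (k₀ := i + 1) (by simp) (by simp)]
    obtain h | h | h | h : (i < n₀ ∨ n₂ < i) ∨ i = n₀ ∨ i = n₁ ∨ i = n₂ := by omega
    · rw [e i h, hθ i _ (by omega) (by omega), zero_comp, add_zero]
      rw [hθ (i + 1) i (by omega) (by omega), comp_zero]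
    · subst h
      obtain rfl := h₀₁
      rw [hθ i _ (by omega) (by omega), zero_comp, add_zero, hθ₁, e₀]
    · subst h
      obtain rfl : n₀ = i - 1 := by omega
      obtain rfl := h₁₂
      rw [hθ₁, hθ₂, e₁]
    · subst h
      obtain rfl : n₁ = i - 1 := by omega
      rw [hθ (i + 1) i (by omega) (by omega), comp_zero, zero_add, hθ₂, e₂]
  rw [this]
  exact ⟨Homotopy.nullHomotopy' _⟩

lemma homotopy_zero_f {φ : K ⟶ L} (h : Homotopy φ 0) {i j k : ℤ} (hij : i + 1 = j)
    (hjk : j + 1 = k) : φ.f j = K.d j k ≫ h.hom k j + h.hom j i ≫ L.d i j := by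
  rw [h.comm, HomologicalComplex.zero_f, add_zero, dNext_eq h.hom (i' := k) hjk,
    prevD_eq h.hom (j' := i) hij]

variable [HasZeroObject C]

/-- The projection of a complex vanishing in degrees `< n` onto its component of degree `n`. -/
noncomputable def toSingle (K : CochainComplex C ℤ) (n : ℤ) (hK : K.IsStrictlyGE n) :
    K ⟶ (HomologicalComplex.single C (ComplexShape.up ℤ) n).obj (K.X n) :=
  HomologicalComplex.mkHomToSingle (𝟙 _) (fun i hi ↦ by
    change i + 1 = n at hi
    exact (K.isZero_of_isStrictlyGE n i (by omega)).eq_of_src _ _)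

/-- The inclusion in a complex vanishing in degrees `> n` of its component of degree `n`. -/
noncomputable def fromSingle (K : CochainComplex C ℤ) (n : ℤ) (hK : K.IsStrictlyLE n) :
    (HomologicalComplex.single C (ComplexShape.up ℤ) n).obj (K.X n) ⟶ K :=
  HomologicalComplex.mkHomFromSingle (𝟙 _) (fun i hi ↦ by
    change n + 1 = i at hi
    exact (K.isZero_of_isStrictlyLE n i (by omega)).eq_of_tgt _ _)

lemma quotient_map_eq_zero_iff (φ : K ⟶ L) :
    (HomotopyCategory.quotient C (ComplexShape.up ℤ)).map φ = 0 ↔ Nonempty (Homotopy φ 0) := by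
  refine ⟨fun h ↦ ⟨HomotopyCategory.homotopyOfEq _ _ (by rw [h, Functor.map_zero])⟩, ?_⟩
  rintro ⟨h⟩
  rw [HomotopyCategory.eq_of_homotopy _ _ h, Functor.map_zero]

lemma exists_f_eq_of_comp_toSingle_eq_zero (φ : K ⟶ L) (h₀₁ : n₀ + 1 = n₁)
    (hL : L.IsStrictlyGE n₀)
    (hφ : (HomotopyCategory.quotient _ _).map (φ ≫ toSingle L n₀ hL) = 0) :
    ∃ h : K.X n₁ ⟶ L.X n₀, φ.f n₀ = K.d n₀ n₁ ≫ h := by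
  obtain ⟨h⟩ := (quotient_map_eq_zero_iff _).1 hφ
  have := homotopy_zero_f h (show (n₀ - 1) + 1 = n₀ by omega) h₀₁
  refine ⟨h.hom n₁ n₀ ≫
    (HomologicalComplex.singleObjXSelf (ComplexShape.up ℤ) n₀ (L.X n₀)).hom, ?_⟩
  rw [HomologicalComplex.single_obj_d, comp_zero, add_zero] at this
  rw [← Category.assoc, ← this]
  simp [toSingle]

lemma exists_f_eq_of_fromSingle_comp_eq_zero (φ : K ⟶ L) (h₁₂ : n₁ + 1 = n₂)
    (hK : K.IsStrictlyLE n₂)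
    (hφ : (HomotopyCategory.quotient _ _).map (fromSingle K n₂ hK ≫ φ) = 0) :
    ∃ h : K.X n₂ ⟶ L.X n₁, φ.f n₂ = h ≫ L.d n₁ n₂ := by
  obtain ⟨h⟩ := (quotient_map_eq_zero_iff _).1 hφ
  have := homotopy_zero_f h h₁₂ rfl
  refine ⟨(HomologicalComplex.singleObjXSelf (ComplexShape.up ℤ) n₂ (K.X n₂)).inv ≫
    h.hom n₂ n₁, ?_⟩
  rw [HomologicalComplex.single_obj_d, zero_comp, zero_add] at this
  rw [Category.assoc, ← this]
  simp [fromSingle]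

end Homotopies

variable {C : Type u} [Category.{v} C] [Preadditive C] [HasZeroObject C] [HasBinaryBiproducts C]
  [ExactCategory C]

section

variable {K L : CochainComplex C ℤ} {n₀ n₁ n₂ : ℤ}

/-- At the right end of an acyclic complex the last cycle object is the last term. Together with
`epi_d`, this says that the last differential is a cokernel of the preceding one. -/
lemma exists_desc_d (hK : IsAcyclic K) (h₀₁ : n₀ + 1 = n₁) (h₁₂ : n₁ + 1 = n₂)
    (hK' : K.IsStrictlyLE n₂) {T : C} (x : K.X n₁ ⟶ T) (hx : K.d n₀ n₁ ≫ x = 0) :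
    ∃ y : K.X n₂ ⟶ T, K.d n₁ n₂ ≫ y = x := by
  obtain ⟨Z, a, b, w, hZ, hd, -⟩ := hK.exists_data'
  have := mono_of_admissible (hZ n₂ _ rfl)
  have := mono_of_admissible (hZ (n₂ + 1) _ rfl)
  have := epi_of_admissible (hZ _ _ h₀₁)
  have hb : b n₂ (n₂ + 1) = 0 := by
    rw [← cancel_mono (a (n₂ + 1))]
    exact (K.isZero_of_isStrictlyLE n₂ (n₂ + 1)).eq_of_tgt _ _
  obtain ⟨l, hl⟩ := lift_of_admissible (hZ n₂ _ rfl) (𝟙 _) (by rw [hb, comp_zero])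
  have hl' : a n₂ ≫ l = 𝟙 _ := by
    rw [← cancel_mono (a n₂), Category.assoc, hl, Category.comp_id, Category.id_comp]
  obtain ⟨y, hy⟩ := desc_of_admissible (hZ _ _ h₁₂) x (by
    rw [← cancel_epi (b n₀ n₁), ← Category.assoc, ← hd, hx, comp_zero])
  exact ⟨l ≫ y, by rw [hd, Category.assoc, reassoc_of% hl', hy]⟩

lemma epi_d (hK : IsAcyclic K) (h₁₂ : n₁ + 1 = n₂) (hK' : K.IsStrictlyLE n₂) :
    Epi (K.d n₁ n₂) := by
  obtain ⟨Z, a, b, w, hZ, hd, -⟩ := hK.exists_data'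
  have := mono_of_admissible (hZ (n₂ + 1) _ rfl)
  have := epi_of_admissible (hZ _ _ h₁₂)
  have hb : b n₂ (n₂ + 1) = 0 := by
    rw [← cancel_mono (a (n₂ + 1))]
    exact (K.isZero_of_isStrictlyLE n₂ (n₂ + 1)).eq_of_tgt _ _
  obtain ⟨l, hl⟩ := lift_of_admissible (hZ n₂ _ rfl) (𝟙 _) (by rw [hb, comp_zero])
  have : Epi (a n₂) := (IsSplitEpi.mk' ⟨l, hl⟩ : IsSplitEpi (a n₂)).epi
  rw [hd]
  infer_instance

/-- At the left end the first cycle object vanishes. Together with `mono_d`, this says that the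
first differential is a kernel of the next one. -/
lemma exists_lift_d (hL : IsAcyclic L) (h₀₁ : n₀ + 1 = n₁) (h₁₂ : n₁ + 1 = n₂)
    (hL' : L.IsStrictlyGE n₀) {T : C} (x : T ⟶ L.X n₁) (hx : x ≫ L.d n₁ n₂ = 0) :
    ∃ y : T ⟶ L.X n₀, y ≫ L.d n₀ n₁ = x := by
  obtain ⟨Z, a, b, w, hZ, hd, -⟩ := hL.exists_data'
  have := mono_of_admissible (hZ n₂ _ rfl)
  have := epi_of_admissible (hZ (n₀ - 1) n₀ (by omega))
  have := epi_of_admissible (hZ _ _ h₀₁)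
  have ha : a n₀ = 0 := by
    rw [← cancel_epi (b (n₀ - 1) n₀)]
    exact (L.isZero_of_isStrictlyGE n₀ (n₀ - 1)).eq_of_src _ _
  obtain ⟨l, hl⟩ := desc_of_admissible (hZ _ _ h₀₁) (𝟙 _) (by rw [ha, zero_comp])
  have hl' : l ≫ b n₀ n₁ = 𝟙 _ := by
    rw [← cancel_epi (b n₀ n₁), reassoc_of% hl, Category.comp_id]
  obtain ⟨y, hy⟩ := lift_of_admissible (hZ _ _ h₁₂) x (by
    rw [← cancel_mono (a n₂), Category.assoc, ← hd, hx, zero_comp])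
  exact ⟨y ≫ l, by rw [hd, Category.assoc, reassoc_of% hl', hy]⟩

lemma mono_d (hL : IsAcyclic L) (h₀₁ : n₀ + 1 = n₁) (hL' : L.IsStrictlyGE n₀) :
    Mono (L.d n₀ n₁) := by
  obtain ⟨Z, a, b, w, hZ, hd, -⟩ := hL.exists_data'
  have := epi_of_admissible (hZ (n₀ - 1) n₀ (by omega))
  have := mono_of_admissible (hZ n₁ _ rfl)
  have ha : a n₀ = 0 := by
    rw [← cancel_epi (b (n₀ - 1) n₀)]
    exact (L.isZero_of_isStrictlyGE n₀ (n₀ - 1)).eq_of_src _ _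
  obtain ⟨l, hl⟩ := desc_of_admissible (hZ _ _ h₀₁) (𝟙 _) (by rw [ha, zero_comp])
  have : Mono (b n₀ n₁) := (IsSplitMono.mk' ⟨l, hl⟩ : IsSplitMono (b n₀ n₁)).mono
  rw [hd]
  infer_instance

/-- A morphism in `K(C)` from an acyclic complex `K` vanishing in degrees `> n + 2` to a
complex `L` vanishing in degrees `< n` is zero if its composition with the projection on `L.X n`
is zero. -/
lemma eq_zero_of_comp_toSingle_eq_zero (h : n₀ + 2 = n₂)
    (hK : IsAcyclic K) (hK' : K.IsStrictlyLE n₂) (hL : L.IsStrictlyGE n₀)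
    (φ : (HomotopyCategory.quotient C (ComplexShape.up ℤ)).obj K ⟶
      (HomotopyCategory.quotient C (ComplexShape.up ℤ)).obj L)
    (hφ : φ ≫ (HomotopyCategory.quotient _ _).map (toSingle L n₀ hL) = 0) : φ = 0 := by
  obtain ⟨φ, rfl⟩ := (HomotopyCategory.quotient _ _).map_surjective φ
  rw [← Functor.map_comp] at hφ
  rw [quotient_map_eq_zero_iff]
  obtain ⟨n₁, rfl⟩ : ∃ n₁, n₀ = n₁ - 1 := ⟨n₀ + 1, by omega⟩
  obtain rfl : n₂ = n₁ + 1 := by omega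
  -- The hypothesis provides the component `h₁` of a null-homotopy. After subtracting `h₁ ≫ d`, the
  -- middle component of `φ` vanishes on the image of the preceding differential, and the cokernel
  -- property at the right end of `K` yields `h₂`. The identity in the top degree follows because
  -- the last differential is epi.
  obtain ⟨h₁, e₁⟩ := exists_f_eq_of_comp_toSingle_eq_zero φ (show n₁ - 1 + 1 = n₁ by omega) hL hφ
  obtain ⟨h₂, e₂⟩ := exists_desc_d hK (show n₁ - 1 + 1 = n₁ by omega) rfl hK'
    (φ.f n₁ - h₁ ≫ L.d _ _) (by
      rw [Preadditive.comp_sub, ← Category.assoc, ← e₁, ← φ.comm, sub_self])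
  have := epi_d hK (n₁ := n₁) rfl hK'
  refine nonempty_homotopy_zero_of_eq φ (by omega) rfl h₁ h₂ e₁ (by rw [e₂]; simp) ?_ ?_
  · rw [← cancel_epi (K.d n₁ (n₁ + 1)), ← φ.comm, reassoc_of% e₂]
    simp
  · rintro i (h | h)
    · exact (L.isZero_of_isStrictlyGE (n₁ - 1) i).eq_of_tgt _ _
    · exact (K.isZero_of_isStrictlyLE (n₁ + 1) i).eq_of_src _ _

/-- A morphism in `K(C)` from a complex `K` vanishing in degrees `> n + 2` to an acyclic
complex `L` vanishing in degrees `< n` is zero if its composition with the inclusion of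
`K.X (n + 2)` is zero. -/
lemma eq_zero_of_fromSingle_comp_eq_zero (h : n₀ + 2 = n₂)
    (hK : K.IsStrictlyLE n₂) (hL : IsAcyclic L) (hL' : L.IsStrictlyGE n₀)
    (φ : (HomotopyCategory.quotient C (ComplexShape.up ℤ)).obj K ⟶
      (HomotopyCategory.quotient C (ComplexShape.up ℤ)).obj L)
    (hφ : (HomotopyCategory.quotient _ _).map (fromSingle K n₂ hK) ≫ φ = 0) : φ = 0 := by
  obtain ⟨φ, rfl⟩ := (HomotopyCategory.quotient _ _).map_surjective φ
  rw [← Functor.map_comp] at hφ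
  rw [quotient_map_eq_zero_iff]
  obtain ⟨n₁, rfl⟩ : ∃ n₁, n₀ = n₁ - 1 := ⟨n₀ + 1, by omega⟩
  obtain rfl : n₂ = n₁ + 1 := by omega
  -- The dual argument: `h₂` comes from the hypothesis, `h₁` from the kernel property at the left
  -- end of `L`.
  obtain ⟨h₂, e₂⟩ := exists_f_eq_of_fromSingle_comp_eq_zero φ (show n₁ + 1 = n₁ + 1 by omega) hK hφ
  obtain ⟨h₁, e₁⟩ := exists_lift_d hL (show n₁ - 1 + 1 = n₁ by omega) rfl hL'
    (φ.f n₁ - K.d _ _ ≫ h₂) (by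
      rw [Preadditive.sub_comp, Category.assoc, ← e₂, ← φ.comm, sub_self])
  have := mono_d hL (show n₁ - 1 + 1 = n₁ by omega) hL'
  refine nonempty_homotopy_zero_of_eq φ (by omega) rfl h₁ h₂ ?_ (by rw [e₁]; simp) e₂ ?_
  · rw [← cancel_mono (L.d (n₁ - 1) n₁), φ.comm, Category.assoc, e₁]
    simp
  · rintro i (h | h)
    · exact (L.isZero_of_isStrictlyGE (n₁ - 1) i).eq_of_tgt _ _
    · exact (K.isZero_of_isStrictlyLE (n₁ + 1) i).eq_of_src _ _

end

/-- If a complex `K` is isomorphic in the homotopy category to a complex vanishing in degrees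
`< n`, then the morphism of `K.X n` to the cocycles in degree `n + 1` is a split epimorphism
when `K` is acyclic. -/
lemma exists_section {K L : CochainComplex C ℤ} {n₀ n₁ n₂ : ℤ} (h₀₁ : n₀ + 1 = n₁)
    (h₁₂ : n₁ + 1 = n₂) {Z : C} {a : Z ⟶ K.X n₂} {b : K.X n₁ ⟶ Z} [Mono a] [Epi b]
    (hd : K.d n₁ n₂ = b ≫ a) (f : K ⟶ L) (g : L ⟶ K) (h : Homotopy (𝟙 K - f ≫ g) 0)
    (f' : Z ⟶ L.X n₁) (hf' : b ≫ f' = f.f n₁) : ∃ s : Z ⟶ K.X n₁, s ≫ b = 𝟙 Z := by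
  have hdb : K.d n₀ n₁ ≫ b = 0 := by
    rw [← cancel_mono a, Category.assoc, ← hd, K.d_comp_d, zero_comp]
  have := homotopy_zero_f h h₀₁ h₁₂
  refine ⟨f' ≫ g.f n₁ + a ≫ h.hom n₂ n₁, ?_⟩
  -- The term `a ≫ h` in the section cancels the first half of the homotopy; the second half dies
  -- after composition with `b`.
  have e : f.f n₁ ≫ g.f n₁ = 𝟙 _ - (K.d n₁ n₂ ≫ h.hom n₂ n₁ + h.hom n₁ n₀ ≫ K.d n₀ n₁) := by
    rw [← this]; simp
  rw [← cancel_epi b, Preadditive.add_comp, Preadditive.comp_add, ← Category.assoc,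
    ← Category.assoc b, hf', e, hd]
  simp [hdb]

/-- An acyclic complex which is isomorphic in the homotopy category to a complex vanishing in
degrees `< -2` is isomorphic to its acyclic truncation in degrees `≥ -2`. -/
lemma exists_truncGE {K L : CochainComplex C ℤ} (hK : IsAcyclic K) (hL : L.IsStrictlyGE (-2))
    (e : (HomotopyCategory.quotient C (ComplexShape.up ℤ)).obj K ≅
      (HomotopyCategory.quotient C (ComplexShape.up ℤ)).obj L) :
    ∃ (B : CochainComplex C ℤ), IsAcyclic B ∧ B.IsStrictlyGE (-2) ∧
      (∀ i, -1 ≤ i → IsZero (K.X i) → IsZero (B.X i)) ∧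
      Nonempty ((HomotopyCategory.quotient C (ComplexShape.up ℤ)).obj K ≅
        (HomotopyCategory.quotient C (ComplexShape.up ℤ)).obj B) := by
  obtain ⟨Z, a, b, w, hZ, hd, hb⟩ := hK.exists_data'
  have := fun i ↦ mono_of_admissible (hZ i _ rfl)
  have := epi_of_admissible (hZ (-2) (-1) rfl)
  have := epi_of_admissible (hZ (-3) (-2) rfl)
  obtain ⟨f, hf⟩ := (HomotopyCategory.quotient _ _).map_surjective e.hom
  obtain ⟨g, hg⟩ := (HomotopyCategory.quotient _ _).map_surjective e.inv
  obtain ⟨h⟩ := (quotient_map_eq_zero_iff (𝟙 K - f ≫ g)).1 (by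
    rw [Functor.map_sub, Functor.map_comp, hf, hg, e.hom_inv_id, CategoryTheory.Functor.map_id,
      sub_self])
  obtain ⟨f', hf'⟩ := desc_of_admissible (hZ (-2) (-1) rfl) (f.f (-2)) (by
    rw [← cancel_epi (b (-3) (-2)), ← Category.assoc, ← hd, ← f.comm,
      (L.isZero_of_isStrictlyGE (-2) (-3)).eq_of_tgt (f.f (-3)) 0, zero_comp, comp_zero])
  -- Since `L` vanishes in degree -3, `f` in degree -2 descends to `Z (-1)`, so `K.X (-2) ⟶ Z (-1)`
  -- splits. The truncation keeps `K` in degrees `≥ -1` and has `Z (-1)` in degree -2; the splitting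
  -- makes the quotient map `π` have a section `s` of complexes.
  obtain ⟨σ, hσ⟩ := exists_section (show -3 + 1 = -2 by omega) (show -2 + 1 = -1 by omega)
    (hd _ _) f g h f' hf'
  have exB (i : ℤ) : ∃ (B W : C) (π : K.X i ⟶ B) (s : B ⟶ K.X i) (z : W ⟶ Z i) (z' : Z i ⟶ W),
      s ≫ π = 𝟙 _ ∧ z ≫ z' = 𝟙 _ ∧ (i < -2 → IsZero B) ∧ (i ≤ -2 → IsZero W) ∧
      (-1 ≤ i → π ≫ s = 𝟙 _ ∧ z' ≫ z = 𝟙 _) ∧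
      (i = -2 → π ≫ s ≫ b i (-1) = b i (-1) ∧ π ≫ s ≫ f.f i = f.f i ∧
        IsIso (s ≫ b i (-1)) ∧ ∀ j, K.d j i ≫ π = 0) := by
    obtain h | h | h : i < -2 ∨ i = -2 ∨ -1 ≤ i := by omega
    · exact ⟨0, 0, 0, 0, 0, 0, by simp, by simp, fun _ ↦ isZero_zero _, fun _ ↦ isZero_zero _,
        by omega, by omega⟩
    · subst h
      refine ⟨Z (-1), 0, b (-2) (-1), σ, 0, 0, hσ, by simp, by omega, fun _ ↦ isZero_zero _,
        by omega, fun _ ↦ ⟨?_, ?_, ?_, fun j ↦ ?_⟩⟩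
      · rw [hσ, Category.comp_id]
      · rw [← hf', reassoc_of% hσ]
      · rw [hσ]; infer_instance
      · rw [hd, Category.assoc, w, comp_zero]
    · exact ⟨K.X i, Z i, 𝟙 _, 𝟙 _, 𝟙 _, 𝟙 _, by simp, by simp, by omega, by omega, by simp,
        by omega⟩
  choose B W π s z z' hsπ hz hB hW h₁ h₂ using exB
  have hπd (i j) : π i ≫ s i ≫ K.d i j ≫ π j = K.d i j ≫ π j := by
    by_cases hij : i + 1 = j
    · subst hij
      obtain h | h | h | h : i + 1 < -2 ∨ i + 1 = -2 ∨ i = -2 ∨ -1 ≤ i := by omega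
      · exact (hB _ h).eq_of_tgt _ _
      · rw [(h₂ _ h).2.2.2]
        simp
      · subst h
        have h₃ := (h₂ _ rfl).1
        change π (-2) ≫ s (-2) ≫ K.d (-2) (-1) ≫ π (-1) = K.d (-2) (-1) ≫ π (-1)
        rw [hd, Category.assoc, reassoc_of% h₃]
      · rw [reassoc_of% (h₁ _ h).1]
    · rw [K.shape i j hij, zero_comp, comp_zero, comp_zero]
  let B' : CochainComplex C ℤ :=
    { X := B
      d i j := s i ≫ K.d i j ≫ π j
      shape i j h := by rw [K.shape i j h, zero_comp, comp_zero]
      d_comp_d' i j k _ _ := by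
        rw [Category.assoc, Category.assoc, hπd, K.d_comp_d_assoc, zero_comp, comp_zero] }
  have hBd (i j) : B'.d i j = s i ≫ K.d i j ≫ π j := rfl
  have hds (i j) : (s i ≫ K.d i j ≫ π j) ≫ s j = s i ≫ K.d i j := by
    by_cases hij : i + 1 = j
    · subst hij
      obtain h | h : i < -2 ∨ -1 ≤ i + 1 := by omega
      · exact (hB _ h).eq_of_src _ _
      · rw [Category.assoc, Category.assoc, (h₁ _ h).1, Category.comp_id]
    · rw [K.shape i j hij]
      simp
  let π' : K ⟶ B' := { f := π, comm' i j _ := hπd i j }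
  let s' : B' ⟶ K := { f := s, comm' i j _ := (hds i j).symm }
  have hsπ' : s' ≫ π' = 𝟙 _ := by ext i; exact hsπ i
  -- This strict identity shows that `π' ≫ s'` becomes the identity in the homotopy category, where
  -- `f` is invertible; no homotopy has to be written down.
  have hπs : π' ≫ s' ≫ f = f := by
    ext i
    change π i ≫ s i ≫ f.f i = f.f i
    obtain h | h | h : i < -2 ∨ i = -2 ∨ -1 ≤ i := by omega
    · exact (L.isZero_of_isStrictlyGE (-2) i).eq_of_tgt _ _
    · exact (h₂ _ h).2.1
    · rw [reassoc_of% (h₁ _ h).1]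
  refine ⟨B', isAcyclic_of B' W (fun i ↦ z i ≫ a i ≫ π i) (fun i j _ ↦ s i ≫ b i j ≫ z' j)
    (fun i j hij ↦ ?_) (fun i j hij ↦ ?_) (fun i j hij ↦ ?_), ?_, fun i hi hi' ↦ ?_,
    ⟨⟨(HomotopyCategory.quotient _ _).map π', (HomotopyCategory.quotient _ _).map s', ?_, ?_⟩⟩⟩
  · obtain h | h : i ≤ -2 ∨ -1 ≤ i := by omega
    · exact (hW _ h).eq_of_src _ _
    · rw [Category.assoc, Category.assoc, reassoc_of% (h₁ _ h).1, reassoc_of% (w i j)]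
      simp
  · obtain h | h | h : i < -2 ∨ i = -2 ∨ -1 ≤ i := by omega
    · have : IsIso (s i ≫ b i j ≫ z' j) :=
        ⟨0, (hB _ h).eq_of_src _ _, (hW j (by omega)).eq_of_src _ _⟩
      exact admissible_zero_iso (z i ≫ a i ≫ π i) (hW i (by omega)) (s i ≫ b i j ≫ z' j) _
    · obtain rfl : j = -1 := by omega
      have h₃ := (h₂ _ h).2.2.1
      have : IsIso (z' (-1)) := ⟨z (-1), (h₁ _ le_rfl).2, hz _⟩
      have : IsIso (s i ≫ b i (-1) ≫ z' (-1)) := by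
        rw [← Category.assoc]
        infer_instance
      exact admissible_zero_iso (z i ≫ a i ≫ π i) (hW i (by omega)) (s i ≫ b i (-1) ≫ z' (-1)) _
    · exact admissible_of_isos (hZ i j hij) _ ⟨z' i, z i, (h₁ _ h).2, hz i⟩
        ⟨π i, s i, (h₁ _ h).1, hsπ i⟩ ⟨z' j, z j, (h₁ j (by omega)).2, hz j⟩
        (by dsimp; rw [reassoc_of% (h₁ _ h).2]) (by dsimp; rw [reassoc_of% (h₁ _ h).1])
  · obtain h | h : i < -2 ∨ -1 ≤ j := by omega
    · exact (hB _ h).eq_of_src _ _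
    · rw [hBd, hd, Category.assoc, Category.assoc, Category.assoc, reassoc_of% (h₁ _ h).2]
  · rw [CochainComplex.isStrictlyGE_iff]
    exact hB
  · rw [IsZero.iff_id_eq_zero]
    change 𝟙 (B i) = 0
    rw [← hsπ i, hi'.eq_of_src (π i) 0, comp_zero]
  · rw [← cancel_mono e.hom, ← hf, ← Functor.map_comp, ← Functor.map_comp, Category.assoc, hπs,
      Category.id_comp]
  · rw [← Functor.map_comp, hsπ', CategoryTheory.Functor.map_id]

lemma tStructure_isLE_iff (X : Ac C) (n : ℤ) :
    (tStructure C).IsLE X n ↔ ∃ Y : Ac C, Y.complex.IsStrictlyLE n ∧ Nonempty (X ≅ Y) :=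
  ⟨fun h ↦ by
    obtain ⟨Y, hY, ⟨e⟩⟩ := h.1
    exact ⟨Y, hY, ⟨e⟩⟩, fun ⟨Y, hY, ⟨e⟩⟩ ↦ ⟨⟨Y, hY, ⟨e⟩⟩⟩⟩

lemma tStructure_isGE_iff (X : Ac C) (n : ℤ) :
    (tStructure C).IsGE X n ↔ ∃ Y : Ac C, Y.complex.IsStrictlyGE (n - 2) ∧ Nonempty (X ≅ Y) :=
  ⟨fun h ↦ by
    obtain ⟨Y, hY, ⟨e⟩⟩ := h.1
    exact ⟨Y, hY, ⟨e⟩⟩, fun ⟨Y, hY, ⟨e⟩⟩ ↦ ⟨⟨Y, hY, ⟨e⟩⟩⟩⟩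

/-- The objects of the heart are represented by the acyclic complexes vanishing outside of the
degrees `-2`, `-1` and `0`. -/
lemma exists_iso_of_heart (X : Ac C) (hX : (tStructure C).heart X) :
    ∃ Y : Ac C, Y.complex.IsStrictlyLE 0 ∧ Y.complex.IsStrictlyGE (-2) ∧ Nonempty (X ≅ Y) := by
  obtain ⟨K, hK, ⟨e₁⟩⟩ := (tStructure_isLE_iff _ _).1 (TStructure.heart_isLE hX)
  obtain ⟨L, hL, ⟨e₂⟩⟩ := (tStructure_isGE_iff _ _).1 (TStructure.heart_isGE hX)
  obtain ⟨B, hB, hB', hB'', ⟨e⟩⟩ := exists_truncGE K.property hL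
    ((acyclic C).ι.mapIso (e₁.symm ≪≫ e₂))
  refine ⟨⟨(HomotopyCategory.quotient _ _).obj B, hB⟩, ?_, hB',
    ⟨e₁ ≪≫ (acyclic C).fullyFaithfulι.preimageIso e⟩⟩
  rw [CochainComplex.isStrictlyLE_iff]
  intro i hi
  exact hB'' i (by omega) (K.complex.isZero_of_isStrictlyLE 0 i)

end Exact

/-! ### Heredity as a factorization property -/

namespace Exact

section

variable {C : Type u} [Category.{v} C] [Preadditive C] [HasZeroObject C] [HasBinaryBiproducts C]

/-- The object of `K^b(C)` given by an object of `C` in degree `n`. -/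
noncomputable def singleKb (n : ℤ) (X : C) : Kb C :=
  ⟨(HomotopyCategory.singleFunctor C n).obj X, n, n,
    inferInstanceAs (((CochainComplex.singleFunctor C n).obj X).IsStrictlyGE n),
    inferInstanceAs (((CochainComplex.singleFunctor C n).obj X).IsStrictlyLE n)⟩

lemma nonempty_singleKb_shift_iso (n m m' : ℤ) (h : n + m' = m) (X : C) :
    Nonempty ((singleKb m X)⟦n⟧ ≅ singleKb m' X) :=
  ⟨(boundedComplexes C).fullyFaithfulι.preimageIso
    (((boundedComplexes C).ι.commShiftIso n).app (singleKb m X) ≪≫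
      ((HomotopyCategory.singleFunctors C).shiftIso n m' m h).app X)⟩

lemma hom_single_eq_zero (n m : ℤ) (h : m < n) (X Y : C)
    (f : (HomotopyCategory.singleFunctor C n).obj X ⟶
      (HomotopyCategory.singleFunctor C m).obj Y) : f = 0 := by
  obtain ⟨f, rfl⟩ := (HomotopyCategory.quotient _ _).map_surjective f
  have : f = 0 := HomologicalComplex.from_single_hom_ext
    ((HomologicalComplex.isZero_single_obj_X (ComplexShape.up ℤ) m Y n (by omega)).eq_of_tgt _ _)
  rw [this]
  exact Functor.map_zero _ _ _

end

variable {C : Type u} [Category.{v} C] [Preadditive C] [HasZeroObject C] [HasBinaryBiproducts C]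
  [ExactCategory C]

lemma isHereditary_iff : IsHereditary C ↔ ∀ (X Y : C) (m : ℤ), m ≤ -2 →
    ∀ f : (acyclicBounded C).trW.Q.obj (singleKb 0 X) ⟶
      (acyclicBounded C).trW.Q.obj (singleKb m Y), f = 0 := by
  have e (Y : C) (n m : ℤ) (h : n + m = 0) : Nonempty (((toDb C).obj Y)⟦n⟧ ≅
      (acyclicBounded C).trW.Q.obj (singleKb m Y)) := by
    obtain ⟨e⟩ := nonempty_singleKb_shift_iso n 0 m h Y
    exact ⟨((acyclicBounded C).trW.Q.commShiftIso n).symm.app (singleKb 0 Y) ≪≫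
      (acyclicBounded C).trW.Q.mapIso e⟩
  refine ⟨fun h X Y m hm f ↦ ?_, fun h X Y n hn f ↦ ?_⟩
  · obtain ⟨e⟩ := e Y (-m) m (by omega)
    rw [← cancel_mono e.inv, zero_comp]
    exact h X Y (-m) (by omega) (f ≫ e.inv)
  · obtain ⟨e⟩ := e Y n (-n) (by omega)
    rw [← cancel_mono e.hom, zero_comp]
    exact h X Y (-n) (by omega) (f ≫ e.hom)

/-- The object `Y` in degree `m` is the shift by 1 of `Y` in degree `m + 1 ≤ -2`, so the Verdier
quotient criterion applies. Its condition `w ≫ g = 0` is automatic, because `X` sits in degree 0 and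
`m < 0`. -/
lemma IsHereditary.exists_factorization (hC : IsHereditary C) {X Y : C} {m : ℤ} (hm : m ≤ -3)
    {A : Ac C} (hA : (boundedAcyclic C).isoClosure A)
    (w : (HomotopyCategory.singleFunctor C 0).obj X ⟶ A.obj)
    (g : A.obj ⟶ (HomotopyCategory.singleFunctor C m).obj Y) :
    ∃ (A' : Ac C) (w' : (HomotopyCategory.singleFunctor C 0).obj X ⟶ A'.obj) (a : A' ⟶ A),
      w' ≫ a.hom = w ∧ a.hom ≫ g = 0 := by
  obtain ⟨A₀, hA₀, ⟨e⟩⟩ := hA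
  let B : Kb C := ⟨A₀.obj, hA₀⟩
  obtain ⟨i⟩ := nonempty_singleKb_shift_iso 1 (m + 1) m (by omega) Y
  let w₀ : singleKb 0 X ⟶ B := ObjectProperty.homMk (w ≫ e.hom.hom)
  let g₀ : B ⟶ singleKb m Y := ObjectProperty.homMk (e.inv.hom ≫ g)
  obtain ⟨B', w', b, hB', h₁, h₂⟩ := (acyclicBounded C).exists_factorization_of_hom_Q_eq_zero
    (isHereditary_iff.1 hC X Y (m + 1) (by omega)) (A := B) A₀.property w₀ (g₀ ≫ i.inv) (by
      rw [← Category.assoc, ← cancel_mono i.hom, Category.assoc, i.inv_hom_id, zero_comp]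
      refine (Category.comp_id _).trans ((boundedComplexes C).ι.map_injective ?_)
      exact hom_single_eq_zero _ _ (by omega) _ _ _)
  have h₂' : b ≫ g₀ = 0 := by
    rw [← cancel_mono i.inv, Category.assoc, h₂, zero_comp]
  refine ⟨⟨B'.obj, hB'⟩, w'.hom, ObjectProperty.homMk b.hom ≫ e.inv, ?_, ?_⟩
  · have := congrArg (boundedComplexes C).ι.map h₁
    change w'.hom ≫ b.hom = w ≫ e.hom.hom at this
    change w'.hom ≫ b.hom ≫ e.inv.hom = w
    have h₃ := congrArg (acyclic C).ι.map e.hom_inv_id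
    change e.hom.hom ≫ e.inv.hom = 𝟙 _ at h₃
    exact (Category.assoc _ _ _).symm.trans ((congrArg (· ≫ e.inv.hom) this).trans
      ((Category.assoc _ _ _).trans ((congrArg (w ≫ ·) h₃).trans (Category.comp_id _))))
  · have := congrArg (boundedComplexes C).ι.map h₂'
    exact (Category.assoc _ _ _).trans this

lemma isHereditary_of_exists_factorization
    (h : ∀ (X Y : C) (m : ℤ) (_ : m ≤ -3) (A : Ac C) (_ : boundedAcyclic C A)
      (w : (HomotopyCategory.singleFunctor C 0).obj X ⟶ A.obj)
      (g : A.obj ⟶ (HomotopyCategory.singleFunctor C m).obj Y),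
      ∃ (A' : Ac C) (_ : (boundedAcyclic C).isoClosure A')
        (w' : (HomotopyCategory.singleFunctor C 0).obj X ⟶ A'.obj)
        (a : A' ⟶ A), w' ≫ a.hom = w ∧ a.hom ≫ g = 0) : IsHereditary C := by
  rw [isHereditary_iff]
  intro X Y m hm f
  obtain ⟨i⟩ := nonempty_singleKb_shift_iso 1 m (m - 1) (by omega) Y
  refine (acyclicBounded C).hom_Q_eq_zero (fun f ↦ ?_) (fun A hA w g hwg ↦ ?_) f
  · exact (boundedComplexes C).ι.map_injective (hom_single_eq_zero _ _ (by omega) _ _ _)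
  · obtain ⟨A', ⟨A₀, hA₀, ⟨e⟩⟩, w', a, h₁, h₂⟩ := h X Y (m - 1) (by omega) ⟨A.obj, hA⟩ A.property
      w.hom (g ≫ i.hom).hom
    refine ⟨⟨A₀.obj, hA₀⟩, ObjectProperty.homMk (w' ≫ e.hom.hom),
      ObjectProperty.homMk (e.inv.hom ≫ a.hom), A₀.property, ?_, ?_⟩
    · apply (boundedComplexes C).ι.map_injective
      have h₃ := congrArg (acyclic C).ι.map e.hom_inv_id
      change e.hom.hom ≫ e.inv.hom = 𝟙 _ at h₃
      change (w' ≫ e.hom.hom) ≫ e.inv.hom ≫ a.hom = w.hom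
      rw [Category.assoc, reassoc_of% h₃, h₁]
    · rw [← cancel_mono i.hom, zero_comp, Category.assoc]
      apply (boundedComplexes C).ι.map_injective
      exact (Category.assoc _ _ _).trans ((congrArg (e.inv.hom ≫ ·) h₂).trans comp_zero)

end Exact

/-! ### Heredity as effaceability in the heart -/

namespace Exact

variable {C : Type u} [Category.{v} C] [Preadditive C] [HasZeroObject C] [HasBinaryBiproducts C]

lemma quotient_hom_eq_zero {K L : CochainComplex C ℤ}
    (φ : (HomotopyCategory.quotient C (ComplexShape.up ℤ)).obj K ⟶
      (HomotopyCategory.quotient C (ComplexShape.up ℤ)).obj L) (a b : ℤ)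
    (hK : K.IsStrictlyGE a) (hL : L.IsStrictlyLE b) (hab : b < a) : φ = 0 := by
  obtain ⟨φ, rfl⟩ := (HomotopyCategory.quotient _ _).map_surjective φ
  have : φ = 0 := by
    ext i
    obtain h | h := lt_or_ge i a
    · exact (K.isZero_of_isStrictlyGE a i).eq_of_src _ _
    · exact (L.isZero_of_isStrictlyLE b i).eq_of_tgt _ _
  rw [this, Functor.map_zero]

variable [ExactCategory C]

lemma eq_zero_of_iso_source {Y Z : Ac C} (e : Y ≅ Z) {T : HomotopyCategory C (ComplexShape.up ℤ)}
    (f : Y.obj ⟶ T) (h : e.inv.hom ≫ f = 0) : f = 0 :=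
  (cancel_epi ((acyclic C).ι.map e.inv)).1 (h.trans comp_zero.symm)

lemma eq_zero_of_iso_target {Y Z : Ac C} (e : Y ≅ Z) {T : HomotopyCategory C (ComplexShape.up ℤ)}
    (f : T ⟶ Y.obj) (h : f ≫ e.hom.hom = 0) : f = 0 :=
  (cancel_mono ((acyclic C).ι.map e.hom)).1 (h.trans zero_comp.symm)

lemma single_hom_eq_zero_of_isLE (X : C) (Z : Ac C) (hZ : (tStructure C).IsLE Z (-1))
    (f : (HomotopyCategory.singleFunctor C 0).obj X ⟶ Z.obj) : f = 0 := by
  obtain ⟨Y, hY, ⟨e⟩⟩ := (tStructure_isLE_iff _ _).1 hZ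
  exact eq_zero_of_iso_target e f
    (quotient_hom_eq_zero (K := (CochainComplex.singleFunctor C 0).obj X) (L := Y.complex)
      _ 0 (-1) inferInstance hY (by omega))

lemma single_hom_eq_zero_of_isGE (X : C) (Z : Ac C) (hZ : (tStructure C).IsGE Z 1)
    (f : (HomotopyCategory.singleFunctor C 0).obj X ⟶ Z.obj) : f = 0 := by
  obtain ⟨Y, hY, ⟨e⟩⟩ := (tStructure_isGE_iff _ _).1 hZ
  refine eq_zero_of_iso_target e f ?_
  obtain ⟨φ, hφ⟩ := (HomotopyCategory.quotient _ _).map_surjective (f ≫ e.hom.hom)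
  exact hφ.symm.trans ((quotient_map_eq_zero_iff (K := (CochainComplex.singleFunctor C 0).obj X)
    (L := Y.complex) φ).2 (nonempty_homotopy_zero φ inferInstance Y.property hY))

lemma hom_single_eq_zero_of_isGE (X : C) {m : ℤ} (hm : m ≤ -3) (Z : Ac C)
    (hZ : (tStructure C).IsGE Z 0) (f : Z.obj ⟶ (HomotopyCategory.singleFunctor C m).obj X) :
    f = 0 := by
  obtain ⟨Y, hY, ⟨e⟩⟩ := (tStructure_isGE_iff _ _).1 hZ
  exact eq_zero_of_iso_source e f
    (quotient_hom_eq_zero (L := (CochainComplex.singleFunctor C m).obj X) (K := Y.complex)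
      _ (0 - 2) m hY inferInstance (by omega))

lemma isoClosure_boundedAcyclic_of_heart {M : Ac C} (hM : (tStructure C).heart M) :
    (boundedAcyclic C).isoClosure M := by
  obtain ⟨Y, h₁, h₂, e⟩ := exists_iso_of_heart M hM
  exact ⟨Y, ⟨_, _, h₂, h₁⟩, e⟩

/-- If `C` is hereditary, any morphism `M ⟶ Y⟦1⟧` in `A(C)` with `M` and `Y⟦-1⟧` in the heart is
killed by an epimorphism in the heart. -/
lemma IsHereditary.exists_epi (hC : IsHereditary C) {M Y : Ac C}
    (hM : (tStructure C).heart M) (hM₀ : M.complex.IsStrictlyLE 0)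
    (hY : Y.complex.IsStrictlyGE (-3)) (hY' : Y.complex.IsStrictlyLE (-1)) (u : M ⟶ Y⟦(1 : ℤ)⟧) :
    ∃ (M' : Ac C) (p : M' ⟶ M), (tStructure C).heart M' ∧
      (∀ (R : Ac C) (_ : (tStructure C).heart R) (r : M ⟶ R), p ≫ r = 0 → r = 0) ∧
      p ≫ u = 0 := by
  have hY₁ : (tStructure C).IsLE Y (-1) := (tStructure_isLE_iff _ _).2 ⟨Y, hY', ⟨Iso.refl _⟩⟩
  have hM₁ := TStructure.heart_isGE hM
  obtain ⟨A, f, q, hT⟩ := distinguished_cocone_triangle₂ u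
  have hA : (boundedAcyclic C).isoClosure A :=
    (boundedAcyclic C).isoClosure.ext_of_isTriangulatedClosed₂ _ hT
      ⟨Y, ⟨_, _, hY, hY'⟩, ⟨Iso.refl _⟩⟩ (isoClosure_boundedAcyclic_of_heart hM)
  have hfq := comp_eq_zero_of_distTriang hT
  have hqu := comp_eq_zero_of_distTriang (rotate_mk_distinguished hT)
  let w₀ : (HomotopyCategory.singleFunctor C 0).obj (M.complex.X 0) ⟶ M.obj :=
    (HomotopyCategory.quotient _ _).map (fromSingle M.complex 0 hM₀)
  obtain ⟨w, hw⟩ : ∃ w : (HomotopyCategory.singleFunctor C 0).obj (M.complex.X 0) ⟶ A.obj,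
      w₀ = w ≫ q.hom := by
    refine exists_lift_of_distTriang (map_mk_distinguished (acyclic C).ι
      (rotate_mk_distinguished hT)) w₀ (single_hom_eq_zero_of_isLE _ (Y⟦(1 : ℤ)⟧) ?_ _)
    have := (tStructure C).isLE_shift Y (-1) 1 (-2) (by lia)
    exact (tStructure C).isLE_of_le _ (-2) (-1)
  let g₀ : Y.obj ⟶ (HomotopyCategory.singleFunctor C (-3)).obj (Y.complex.X (-3)) :=
    (HomotopyCategory.quotient _ _).map (toSingle Y.complex (-3) hY)
  obtain ⟨g, hg⟩ : ∃ g : A.obj ⟶ (HomotopyCategory.singleFunctor C (-3)).obj (Y.complex.X (-3)),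
      g₀ = f.hom ≫ g := by
    obtain ⟨i, l, hT'⟩ := exists_invRotate_of_distTriang hT
    refine exists_desc_of_distTriang (map_mk_distinguished (acyclic C).ι hT') g₀
      (hom_single_eq_zero_of_isGE _ le_rfl _ ?_ _)
    have := (tStructure C).isGE_shift M 0 (-1) 1 (by lia)
    exact (tStructure C).isGE_of_ge (M⟦(-1 : ℤ)⟧) 0 1
  obtain ⟨A', w', a, hw', ha⟩ := hC.exists_factorization le_rfl hA w g
  -- The object `A'` need not be in the heart; it is replaced by its degree 0 cohomology `M'`,
  -- through which the relevant maps are shown to factor.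
  obtain ⟨i₀, p₀, δ₀, hT₀⟩ := (tStructure C).exists_distTriang_truncLE_truncGE A' 0 1 rfl
  generalize hA₀ : ((tStructure C).truncLE 0).obj A' = A₀ at i₀ p₀ δ₀ hT₀
  have hA₀' : (tStructure C).IsLE A₀ 0 := by rw [← hA₀]; infer_instance
  obtain ⟨w'', hw''⟩ : ∃ w'' : (HomotopyCategory.singleFunctor C 0).obj (M.complex.X 0) ⟶ A₀.obj,
      w' = w'' ≫ i₀.hom :=
    exists_lift_of_distTriang (map_mk_distinguished (acyclic C).ι hT₀) w'
      (single_hom_eq_zero_of_isGE _ _ inferInstance _)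
  obtain ⟨i₁, π, δ₁, hT₁⟩ := (tStructure C).exists_distTriang_truncLE_truncGE A₀ (-1) 0 rfl
  have hM' : (tStructure C).heart (((tStructure C).truncGE 0).obj A₀) :=
    ((tStructure C).mem_heart_iff _).2 ⟨inferInstance, inferInstance⟩
  have hB : (tStructure C).IsLE (((tStructure C).truncLE (-1)).obj A₀) (-1) := inferInstance
  generalize ((tStructure C).truncGE 0).obj A₀ = M' at i₁ π δ₁ hT₁ hM'
  generalize ((tStructure C).truncLE (-1)).obj A₀ = B at i₁ π δ₁ hT₁ hB
  obtain ⟨y, hy⟩ := exists_lift_of_distTriang hT (i₁ ≫ i₀ ≫ a)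
    ((tStructure C).zero_of_isLE_of_isGE _ (-1) 0 (by lia) hB hM₁)
  -- The obstruction to descending `A₀ ⟶ A` to `M'` is a morphism `y : B ⟶ Y`. It is zero because
  -- its projection to the first term of `Y` is zero by the choice of `A'`, while `B` lives in
  -- degrees `≤ -1`.
  have hy₀ : y = 0 := by
    obtain ⟨B₀, hB₀, ⟨e⟩⟩ := (tStructure_isLE_iff _ _).1 hB
    apply (acyclic C).ι.map_injective
    refine eq_zero_of_iso_source e y.hom (eq_zero_of_comp_toSingle_eq_zero (n₀ := -3) (n₂ := -1)
      (by norm_num) B₀.property hB₀ hY _ ?_)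
    have h₁ : y.hom ≫ f.hom = i₁.hom ≫ i₀.hom ≫ a.hom := (congrArg (acyclic C).ι.map hy).symm
    have h₂ : y.hom ≫ g₀ = 0 := by
      rw [hg, ← Category.assoc, h₁, Category.assoc, Category.assoc, ha, comp_zero, comp_zero]
    exact (Category.assoc _ _ _).trans ((congrArg (e.inv.hom ≫ ·) h₂).trans comp_zero)
  rw [hy₀, zero_comp] at hy
  obtain ⟨m, hm⟩ := exists_desc_of_distTriang hT₁ (i₀ ≫ a) hy
  refine ⟨M', m ≫ q, hM', fun R hR r hr ↦ ?_, by rw [Category.assoc, hqu, comp_zero]⟩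
  obtain ⟨R₀, hR₀, ⟨e⟩⟩ := (tStructure_isGE_iff _ _).1 (TStructure.heart_isGE hR)
  -- The inclusion of the last term of `M` factors through `M' ⟶ M`, so `r` vanishes on it, and this
  -- suffices for a morphism to an object of the heart.
  have h₁ : w₀ ≫ r.hom = 0 := by
    have h₂ : i₀.hom ≫ a.hom = π.hom ≫ m.hom := congrArg (acyclic C).ι.map hm
    have h₃ : m.hom ≫ q.hom ≫ r.hom = 0 := by
      rw [← Category.assoc]
      exact congrArg (acyclic C).ι.map hr
    rw [hw, ← hw', hw'', Category.assoc, Category.assoc, Category.assoc, reassoc_of% h₂, h₃,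
      comp_zero, comp_zero]
  apply (acyclic C).ι.map_injective
  refine eq_zero_of_iso_target e r.hom (eq_zero_of_fromSingle_comp_eq_zero (n₀ := 0 - 2) (n₂ := 0)
    (by norm_num) hM₀ R₀.property hR₀ _ ?_)
  exact (Category.assoc _ _ _).symm.trans ((congrArg (· ≫ e.hom.hom) h₁).trans zero_comp)

/-- Heredity is needed only for `n = 2`. The case `n = 1` holds for any t-structure. For `n ≥ 3`
there is no nonzero morphism, because `N⟦n⟧` is represented in degrees `≤ -3` and `M` in degrees `≥
-2`. -/
lemma IsHereditary.effaceable (hC : IsHereditary C) (N : Ac C) (n : ℤ)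
    (hN : (tStructure C).heart N) (hn : 1 ≤ n) : (tStructure C).effaceable (N⟦n⟧) := by
  obtain rfl | rfl | hn : n = 1 ∨ n = 2 ∨ 3 ≤ n := by omega
  · exact (tStructure C).effaceable_shift_one hN
  · obtain ⟨N₀, h₁, h₂, ⟨e⟩⟩ := exists_iso_of_heart N hN
    let Y : Ac C := ⟨(HomotopyCategory.quotient _ _).obj (N₀.obj.as⟦(1 : ℤ)⟧),
      isAcyclic_shift _ N₀.property _⟩
    refine (tStructure C).effaceable.prop_of_iso (X := Y⟦(1 : ℤ)⟧)
      ((shiftFunctor _ (1 : ℤ)).mapIso ((shiftIso N₀ 1).symm ≪≫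
        (shiftFunctor _ (1 : ℤ)).mapIso e.symm) ≪≫
        ((shiftFunctorAdd' (Ac C) (1 : ℤ) 1 2 (by lia)).symm.app N)) ?_
    intro M u
    obtain ⟨M₀, h₃, h₄, ⟨e'⟩⟩ := exists_iso_of_heart M.obj M.property
    obtain ⟨M', p, hM', hp, hpu⟩ := hC.exists_epi ((tStructure C).heart.prop_of_iso e' M.property)
      h₃ (N₀.complex.isStrictlyGE_shift (-2) 1 (-3) (by lia))
      (N₀.complex.isStrictlyLE_shift 0 1 (-1) (by lia)) (Y := Y) (e'.inv ≫ u)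
    refine ⟨⟨M', hM'⟩, ObjectProperty.homMk (p ≫ e'.inv), ?_, (Category.assoc _ _ _).trans hpu⟩
    rw [Preadditive.epi_iff_cancel_zero]
    intro R r hr
    apply (tStructure C).heart.ι.map_injective
    refine (cancel_epi e'.inv).1 ((hp R.obj R.property (e'.inv ≫ r.hom) ?_).trans comp_zero.symm)
    rw [← Category.assoc]
    exact congrArg (tStructure C).heart.ι.map hr
  · refine (tStructure C).effaceable_of_hom_eq_zero _ (fun M u ↦ ?_)
    obtain ⟨M₀, -, h₁, ⟨e⟩⟩ := exists_iso_of_heart M.obj M.property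
    have h₂ : (tStructure C).IsLE (N⟦n⟧) (-3) := by
      have := TStructure.heart_isLE hN
      have := (tStructure C).isLE_shift N 0 n (-n) (by lia)
      exact (tStructure C).isLE_of_le (N⟦n⟧) (-n) (-3)
    obtain ⟨L, hL, ⟨e'⟩⟩ := (tStructure_isLE_iff _ _).1 h₂
    apply (acyclic C).ι.map_injective
    exact eq_zero_of_iso_source e u.hom (eq_zero_of_iso_target e' _
      (quotient_hom_eq_zero (K := M₀.complex) (L := L.complex) _ (-2) (-3) h₁ hL (by omega)))

/-- It suffices to factor `w : X ⟶ A` through an object of the heart: heart objects live in degrees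
`≥ -2`, so they have no nonzero morphism to an object of `C` placed in degree `m ≤ -3`. -/
lemma isHereditary_of_effaceable (hC : ∀ (N : Ac C) (n : ℤ), (tStructure C).heart N → 1 ≤ n →
    (tStructure C).effaceable (N⟦n⟧)) : IsHereditary C := by
  refine isHereditary_of_exists_factorization fun X Y m hm A hA w g ↦ ?_
  obtain ⟨a, b, ha, hb⟩ := hA
  have hA : (tStructure C).IsGE A (a + 2) :=
    (tStructure_isGE_iff _ _).2 ⟨A, by rwa [add_sub_cancel_right], ⟨Iso.refl _⟩⟩
  obtain ⟨i₀, p₀, δ₀, hT₀⟩ := (tStructure C).exists_distTriang_truncLE_truncGE A 0 1 rfl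
  have hA₀ : (tStructure C).IsLE (((tStructure C).truncLE 0).obj A) 0 := inferInstance
  have hA₀' : (tStructure C).IsGE (((tStructure C).truncLE 0).obj A) (a + 2) := inferInstance
  obtain ⟨w₁, hw₁⟩ : ∃ w₁ : (HomotopyCategory.singleFunctor C 0).obj X ⟶
      (((tStructure C).truncLE 0).obj A).obj, w = w₁ ≫ i₀.hom :=
    exists_lift_of_distTriang (map_mk_distinguished (acyclic C).ι hT₀) w
      (single_hom_eq_zero_of_isGE _ _ inferInstance _)
  generalize ((tStructure C).truncLE 0).obj A = A₀ at *
  obtain ⟨i₁, π, δ, hT₁⟩ := (tStructure C).exists_distTriang_truncLE_truncGE A₀ (-1) 0 rfl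
  have hM : (tStructure C).heart (((tStructure C).truncGE 0).obj A₀) :=
    ((tStructure C).mem_heart_iff _).2 ⟨inferInstance, inferInstance⟩
  have hB : (tStructure C).IsLE (((tStructure C).truncLE (-1)).obj A₀) (-1) := inferInstance
  have hB' : (tStructure C).IsGE (((tStructure C).truncLE (-1)).obj A₀) (a + 2) := inferInstance
  generalize ((tStructure C).truncGE 0).obj A₀ = M at i₁ π δ hT₁ hM
  generalize ((tStructure C).truncLE (-1)).obj A₀ = B at i₁ π δ hT₁ hB hB'
  have hB₁ := (tStructure C).isLE_shift B (-1) 1 (-2) (by lia)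
  -- The obstruction `δ : M ⟶ B⟦1⟧` to splitting off the degree 0 cohomology `M` of `A₀` is killed
  -- by an epimorphism, which then lifts to `f : M' ⟶ A₀`. The boundedness of `A` enters here,
  -- through the dévissage of `B⟦1⟧`.
  obtain ⟨M', p, hp, hpδ⟩ := (tStructure C).effaceable_of_isLE hC (B⟦(1 : ℤ)⟧) (a + 1)
    ((tStructure C).isLE_of_le _ (-2) (-1)) ((tStructure C).isGE_shift B (a + 2) 1 (a + 1)
      (by lia)) ⟨M, hM⟩ δ
  obtain ⟨K, i, d, hK, hT⟩ := TStructure.exists_distTriang_of_epi p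
  have hK' := TStructure.heart_isLE hK
  obtain ⟨f, hf⟩ := exists_lift_of_distTriang (rotate_mk_distinguished hT₁) p.hom hpδ
  have hf' : p.hom.hom = f.hom ≫ π.hom := congrArg (acyclic C).ι.map hf
  -- Objects of `C` in degree 0 lift along epimorphisms of the heart, since they have no nonzero
  -- morphism to `K⟦1⟧`. The lift `v ≫ f` then agrees with `w₁`, because the difference comes from a
  -- morphism to `B`, which lies in degrees `≤ -1`.
  obtain ⟨v, hv⟩ : ∃ v : (HomotopyCategory.singleFunctor C 0).obj X ⟶ M'.obj.obj,
      w₁ ≫ π.hom = v ≫ p.hom.hom := by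
    exact exists_lift_of_distTriang (map_mk_distinguished (acyclic C).ι
      (rotate_mk_distinguished hT)) (w₁ ≫ π.hom) (single_hom_eq_zero_of_isLE _ (K⟦(1 : ℤ)⟧)
        ((tStructure C).isLE_shift K 0 1 (-1) (by lia)) _)
  obtain ⟨z, hz⟩ : ∃ z : (HomotopyCategory.singleFunctor C 0).obj X ⟶ B.obj,
      v ≫ f.hom - w₁ = z ≫ i₁.hom :=
    exists_lift_of_distTriang (map_mk_distinguished (acyclic C).ι hT₁) (v ≫ f.hom - w₁) (by
      rw [Preadditive.sub_comp, Category.assoc]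
      refine sub_eq_zero.2 (Eq.trans ?_ hv.symm)
      rw [hf']
      rfl)
  rw [single_hom_eq_zero_of_isLE _ _ hB z, zero_comp, sub_eq_zero] at hz
  refine ⟨M'.obj, isoClosure_boundedAcyclic_of_heart M'.property, v, f ≫ i₀, ?_,
    hom_single_eq_zero_of_isGE _ hm _ (TStructure.heart_isGE M'.property) _⟩
  rw [hw₁, ← hz]
  exact (Category.assoc _ _ _).symm

lemma isHereditary_iff_effaceable : IsHereditary C ↔
    ∀ (N : Ac C) (n : ℤ), (tStructure C).heart N → 1 ≤ n → (tStructure C).effaceable (N⟦n⟧) :=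
  ⟨fun hC N n ↦ hC.effaceable N n, isHereditary_of_effaceable⟩

end Exact

/-! ### Criterion for a realization functor to be an equivalence -/

namespace Exact

variable {C : Type u} [Category.{v} C] [Preadditive C] [HasZeroObject C] [HasBinaryBiproducts C]
  [ExactCategory C]

lemma hom_toBounded_shift_eq_zero {H : Type*} [Category* H] [Abelian H] [HasDerivedCategory H]
    {M N : H} {n : ℤ} (hn : n < 0) (f : (DerivedCategory.toBounded H).obj M ⟶
      ((DerivedCategory.toBounded H).obj N)⟦n⟧) : f = 0 := by
  apply DerivedCategory.Bounded.ι.map_injective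
  rw [← cancel_mono ((DerivedCategory.Bounded.ι.commShiftIso n).hom.app _), Functor.map_zero,
    zero_comp]
  have h₁ : (DerivedCategory.TStructure.t (C := H)).IsLE
      ((DerivedCategory.singleFunctor H 0).obj M) 0 := by
    infer_instance
  have h₂ : (DerivedCategory.TStructure.t (C := H)).IsGE
      ((DerivedCategory.singleFunctor H 0).obj N) 0 := by
    infer_instance
  exact DerivedCategory.TStructure.t.zero_of_isLE_of_isGE _ 0 (-n) (by lia) h₁
    (DerivedCategory.TStructure.t.isGE_shift ((DerivedCategory.singleFunctor H 0).obj N)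
      0 n (-n) (by lia))

variable (C) in
/-- The functor `heartToDerived` is fully faithful. -/
noncomputable def fullyFaithfulHeartToDerived : (heartToDerived C).FullyFaithful :=
  Functor.FullyFaithful.ofCompFaithful (G := DerivedCategory.Bounded.ι)
    (Functor.FullyFaithful.ofFullyFaithful (DerivedCategory.singleFunctor (Heart C) 0))

namespace RealizationFunctor

variable (F : RealizationFunctor C)

noncomputable instance : F.functor.CommShift ℤ := F.commShift

instance : F.functor.IsTriangulated := F.isTriangulated

/-- The composition of a realization functor and of the inclusion in `A(C)`. -/
noncomputable abbrev toAc : DerivedCategory.Bounded (Heart C) ⥤ Ac C :=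
  F.functor ⋙ (boundedAcyclic C).ι

/-- The image of an object of the heart by a realization functor. -/
noncomputable def objIso (M : Heart C) : F.toAc.obj ((heartToDerived C).obj M) ≅ M.obj :=
  F.iso.app M

lemma map_comp_objIso_hom {M N : Heart C} (f : M ⟶ N) :
    F.toAc.map ((heartToDerived C).map f) ≫ (F.objIso N).hom = (F.objIso M).hom ≫ f.hom :=
  F.iso.hom.naturality f

/-- The image of the shift of an object of the heart by a realization functor. -/
noncomputable def objShiftIso (M : Heart C) (n : ℤ) :
    F.toAc.obj (((heartToDerived C).obj M)⟦n⟧) ≅ M.obj⟦n⟧ :=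
  (F.toAc.commShiftIso n).app _ ≪≫ (shiftFunctor _ n).mapIso (F.objIso M)

lemma bijectiveOn_heart (M N : Heart C) :
    F.toAc.BijectiveOn ((heartToDerived C).obj M) ((heartToDerived C).obj N) := by
  refine ⟨fun f g hfg ↦ ?_, fun g ↦ ?_⟩
  · obtain ⟨f, rfl⟩ := (fullyFaithfulHeartToDerived C).map_surjective f
    obtain ⟨g, rfl⟩ := (fullyFaithfulHeartToDerived C).map_surjective g
    have h : f.hom = g.hom := by
      rw [← cancel_epi (F.objIso M).hom, ← map_comp_objIso_hom, hfg, map_comp_objIso_hom]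
    rw [show f = g from (tStructure C).heart.ι.map_injective h]
  · refine ⟨(heartToDerived C).map (ObjectProperty.homMk ((F.objIso M).inv ≫ g ≫
      (F.objIso N).hom)), ?_⟩
    rw [← cancel_mono (F.objIso N).hom, map_comp_objIso_hom]
    exact (F.objIso M).hom_inv_id_assoc _

lemma bijectiveOn_heart_shift (M N : Heart C) (n : ℤ) (hn : n ≤ 0) :
    F.toAc.BijectiveOn ((heartToDerived C).obj M) (((heartToDerived C).obj N)⟦n⟧) := by
  obtain rfl | hn := hn.eq_or_lt
  · exact (F.bijectiveOn_heart M N).of_iso (Iso.refl _)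
      ((shiftFunctorZero (DerivedCategory.Bounded (Heart C)) ℤ).symm.app _)
  · refine ⟨fun f g _ ↦ (hom_toBounded_shift_eq_zero hn f).trans
      (hom_toBounded_shift_eq_zero hn g).symm, fun g ↦ ⟨0, ?_⟩⟩
    rw [← cancel_epi (F.objIso M).inv, ← cancel_mono (F.objShiftIso N n).hom]
    rw [heart_hom_eq_zero (X := M) (Y := N)
      (((F.objIso M).inv ≫ g) ≫ (F.objShiftIso N n).hom) hn]
    simp

/-- If the functor is fully faithful, effaceability is transported from the derived category of the
heart. The converse is the criterion `bijectiveOn_of_effaceable`, whose assumption in degrees `≤ 0`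
always holds. -/
lemma bijectiveOn_iff_effaceable :
    (∀ X Y, F.toAc.BijectiveOn X Y) ↔ ∀ (N : Ac C) (n : ℤ), (tStructure C).heart N → 1 ≤ n →
      (tStructure C).effaceable (N⟦n⟧) := by
  refine ⟨fun h N n hN hn M u ↦ ?_, fun h ↦ DerivedCategory.bijectiveOn_of_effaceable F.toAc
    F.bijectiveOn_heart_shift (fun M N n hn (u : F.toAc.obj ((heartToDerived C).obj M) ⟶
      F.toAc.obj (((heartToDerived C).obj N)⟦n⟧)) ↦ ?_)⟩
  · obtain ⟨x, hx⟩ := (h _ _).2 ((F.objIso M).hom ≫ u ≫ (F.objShiftIso ⟨N, hN⟩ n).inv)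
    obtain ⟨M', p, hp, hpx⟩ := DerivedCategory.exists_epi_toBounded_map_comp_eq_zero
      (by omega) x
    refine ⟨M', p, hp, ?_⟩
    rw [← cancel_epi (F.objIso M').hom, ← cancel_mono (F.objShiftIso ⟨N, hN⟩ n).inv, comp_zero,
      zero_comp, Category.assoc, Category.assoc, ← reassoc_of% (F.map_comp_objIso_hom p), ← hx]
    exact (F.toAc.map_comp _ _).symm.trans ((congrArg F.toAc.map hpx).trans (F.toAc.map_zero _ _))
  · obtain ⟨M', p, hp, hpu⟩ := h N.obj n N.property hn M
      ((F.objIso M).inv ≫ u ≫ (F.objShiftIso N n).hom)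
    refine ⟨M', p, hp, ?_⟩
    have h₁ : F.toAc.map ((heartToDerived C).map p) =
        (F.objIso M').hom ≫ p.hom ≫ (F.objIso M).inv := by
      rw [← Category.assoc, ← map_comp_objIso_hom, Category.assoc, Iso.hom_inv_id,
        Category.comp_id]
    have h₂ : F.toAc.map ((heartToDerived C).map p) ≫ u = 0 := by
      rw [← cancel_mono (F.objShiftIso N n).hom, zero_comp, h₁]
      simp only [Category.assoc]
      rw [hpu, comp_zero]
    exact h₂

lemma isEquivalence_iff_bijectiveOn :
    F.functor.IsEquivalence ↔ ∀ X Y, F.toAc.BijectiveOn X Y := by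
  refine ⟨fun h X Y ↦ ⟨F.toAc.map_injective, F.toAc.map_surjective⟩, fun h ↦ ?_⟩
  have : F.toAc.Faithful := ⟨fun {X Y} ↦ @(h X Y).1⟩
  have : F.toAc.Full := ⟨fun {X Y} ↦ (h X Y).2⟩
  have : F.functor.Faithful := Functor.Faithful.of_comp F.functor (boundedAcyclic C).ι
  have : F.functor.Full := Functor.Full.of_comp_faithful F.functor (boundedAcyclic C).ι
  -- Essential surjectivity is automatic: the essential image of the fully faithful triangulated
  -- functor contains the heart, hence all objects bounded for the t-structure. The bound `a + 2`
  -- reflects that degree `n` of the t-structure allows complexes starting in degree `n - 2`.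
  have : F.functor.EssSurj := by
    refine ⟨fun A ↦ ?_⟩
    have h₁ : (tStructure C).heart ≤ F.toAc.essImage := fun M hM ↦
      ⟨_, ⟨F.objIso ⟨M, hM⟩⟩⟩
    obtain ⟨a, b, ha, hb⟩ := A.property
    have h₂ : (tStructure C).bounded A.obj :=
      ⟨⟨a + 2, ⟨A.obj, by rwa [add_sub_cancel_right], ⟨Iso.refl _⟩⟩⟩,
        ⟨b, ⟨A.obj, hb, ⟨Iso.refl _⟩⟩⟩⟩
    obtain ⟨X, ⟨e⟩⟩ := (tStructure C).bounded_le_of_heart_le F.toAc.essImage h₁ _ h₂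
    exact ⟨X, ⟨(boundedAcyclic C).fullyFaithfulι.preimageIso e⟩⟩
  exact { }

lemma isEquivalence_iff_isHereditary : F.functor.IsEquivalence ↔ IsHereditary C := by
  rw [isEquivalence_iff_bijectiveOn, bijectiveOn_iff_effaceable, isHereditary_iff_effaceable]

end RealizationFunctor

end Exact

/-! ### Additive presheaves and the Yoneda embedding -/

namespace CategoryTheory

open Opposite

section

variable {D : Type*} [Category* D] [Preadditive D] {A : Type*} [Category* A] [Abelian A]

lemma Functor.additive_of_mono {F G : D ⥤ A} (i : F ⟶ G) [Mono i] (hG : G.Additive) :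
    F.Additive where
  map_add {X Y f g} := by
    have : Mono (i.app Y) := inferInstance
    rw [← cancel_mono (i.app Y), i.naturality, G.map_add, Preadditive.comp_add,
      Preadditive.add_comp, i.naturality, i.naturality]

lemma Functor.additive_of_epi {F G : D ⥤ A} (p : F ⟶ G) [Epi p] (hF : F.Additive) :
    G.Additive where
  map_add {X Y f g} := by
    have : Epi (p.app X) := inferInstance
    rw [← cancel_epi (p.app X), ← p.naturality, F.map_add, Preadditive.comp_add,
      Preadditive.add_comp, p.naturality, p.naturality]

variable (D A)

instance : (additiveFunctor D A).IsClosedUnderSubobjects where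
  prop_of_mono i _ hG := Functor.additive_of_mono i hG

instance : (additiveFunctor D A).IsClosedUnderQuotients where
  prop_of_epi p _ hF := Functor.additive_of_epi p hF

instance : (additiveFunctor D A).ContainsZero where
  exists_zero := ⟨0, isZero_zero _, ⟨fun {X Y f g} ↦
    ((Functor.isZero_iff _).1 (isZero_zero (D ⥤ A)) X).eq_of_src _ _⟩⟩

instance (J : Type*) [Category* J] [HasLimitsOfShape J A] :
    (additiveFunctor D A).IsClosedUnderLimitsOfShape J where
  limitsOfShape_le := by
    rintro F ⟨p⟩
    refine ⟨fun {X Y f g} ↦ ?_⟩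
    have hl := isLimitOfPreserves ((evaluation D A).obj Y) p.isLimit
    refine hl.hom_ext fun j ↦ ?_
    have := p.prop_diag_obj j
    rw [additiveFunctor_iff] at this
    have h (a : X ⟶ Y) : F.map a ≫ (p.π.app j).app Y = (p.π.app j).app X ≫ (p.diag.obj j).map a :=
      (p.π.app j).naturality a
    change F.map (f + g) ≫ (p.π.app j).app Y = (F.map f + F.map g) ≫ (p.π.app j).app Y
    rw [Preadditive.add_comp, h, h, h, Functor.map_add, Preadditive.comp_add]

instance : (additiveFunctor D A).IsClosedUnderFiniteProducts where
  isClosedUnderLimitsOfShape J _ := inferInstance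

/-- Additive functors inherit an abelian structure from all functors, being closed under subobjects,
quotients and finite products. -/
noncomputable instance : Abelian (D ⥤+ A) :=
  inferInstanceAs (Abelian (additiveFunctor D A).FullSubcategory)

end

variable (C : Type u) [Category.{v} C] [Preadditive C]

/-- The category of (right) modules over a preadditive category. -/
abbrev AdditivePresheaf := Cᵒᵖ ⥤+ AddCommGrpCat.{v}

namespace AdditivePresheaf

/-- The Yoneda embedding in the category of additive presheaves. -/
def yoneda : C ⥤ AdditivePresheaf C :=
  (additiveFunctor _ _).lift preadditiveYoneda (fun X ↦ inferInstanceAs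
    (preadditiveYoneda.obj X).Additive)

/-- The functor `yoneda` is fully faithful. -/
noncomputable def fullyFaithfulYoneda : (yoneda C).FullyFaithful :=
  Functor.FullyFaithful.ofCompFaithful (G := (additiveFunctor _ _).ι)
    (Functor.FullyFaithful.ofFullyFaithful preadditiveYoneda)

instance : (yoneda C).Full := (fullyFaithfulYoneda C).full

instance : (yoneda C).Faithful := (fullyFaithfulYoneda C).faithful

instance : (yoneda C).Additive where
  map_add {X Y f g} := by
    ext T h
    exact Preadditive.comp_add _ _ _ _ _ _

variable {C}

instance (X : C) : Projective ((yoneda C).obj X) where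
  factors {F G} f p _ := by
    -- An epimorphism of additive presheaves is thus pointwise surjective. By the Yoneda lemma,
    -- lifting `f` amounts to lifting the element that is the image of `𝟙 X`.
    have : (additiveFunctor Cᵒᵖ AddCommGrpCat.{v}).ι.PreservesEpimorphisms :=
      ObjectProperty.preservesEpimorphisms_ι_of_isNormalMonoCategory _
    have : Epi p.hom := inferInstanceAs (Epi ((additiveFunctor _ _).ι.map p))
    have : Epi (p.hom.app (op X)) := inferInstance
    obtain ⟨x, hx⟩ := (AddCommGrpCat.epi_iff_surjective (p.hom.app (op X))).1 inferInstance
      (f.hom.app (op X) (𝟙 X))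
    have hadd (T : Cᵒᵖ) (a b : T.unop ⟶ X) :
        F.obj.map (a + b).op x = F.obj.map a.op x + F.obj.map b.op x := by
      rw [op_add, Functor.map_add]
      rfl
    let l : preadditiveYoneda.obj X ⟶ F.obj :=
      { app T := AddCommGrpCat.ofHom (AddMonoidHom.mk'
          (fun (a : T.unop ⟶ X) ↦ F.obj.map a.op x) (hadd T))
        naturality T T' g := by
          ext a
          exact ConcreteCategory.congr_hom (F.obj.map_comp (Quiver.Hom.op a) g) x }
    refine ⟨ObjectProperty.homMk l, ?_⟩
    ext T (a : T.unop ⟶ X)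
    refine (ConcreteCategory.congr_hom (p.hom.naturality a.op) x).trans
      ((congrArg (G.obj.map a.op) hx).trans ?_)
    refine (ConcreteCategory.congr_hom (f.hom.naturality a.op) (𝟙 X)).symm.trans ?_
    exact congrArg (f.hom.app T) (Category.comp_id a)

/-- The Yoneda embedding preserves kernels. Lifts are chosen pointwise; their uniqueness, from `i`
being mono, makes them additive and natural. -/
lemma exact_yoneda_map {X Y Z : C} (i : X ⟶ Y) (p : Y ⟶ Z) (w : i ≫ p = 0)
    (hi : Mono i) (hl : ∀ {T : C} (x : T ⟶ Y), x ≫ p = 0 → ∃ y : T ⟶ X, y ≫ i = x) :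
    (ShortComplex.mk ((yoneda C).map i) ((yoneda C).map p)
      (by rw [← Functor.map_comp, w, Functor.map_zero])).Exact := by
  have : Mono ((yoneda C).map i) := by
    refine Preadditive.mono_of_cancel_zero _ (fun {G} k hk ↦ ?_)
    ext T g
    exact (cancel_mono i).1 ((ConcreteCategory.congr_hom
      (congrArg (fun a ↦ a.hom.app T) hk) g).trans zero_comp.symm)
  refine ShortComplex.exact_of_f_is_kernel _ (KernelFork.IsLimit.ofι' _ _ fun {G} k hk ↦ ?_)
  have hk' (T : Cᵒᵖ) (g : G.obj.obj T) : ∃ y : T.unop ⟶ X,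
      y ≫ i = (show T.unop ⟶ Y from k.hom.app T g) :=
    hl _ (ConcreteCategory.congr_hom (congrArg (fun a ↦ a.hom.app T) hk) g)
  choose y hy using hk'
  have hadd (T : Cᵒᵖ) (a b : G.obj.obj T) : y T (a + b) = y T a + y T b := by
    rw [← cancel_mono i, Preadditive.add_comp, hy, hy, hy]
    exact map_add (k.hom.app T).hom a b
  let l : G.obj ⟶ preadditiveYoneda.obj X :=
    { app T := AddCommGrpCat.ofHom (AddMonoidHom.mk' (y T) (hadd T))
      naturality T T' g := by
        ext a
        change y T' (G.obj.map g a) = g.unop ≫ y T a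
        rw [← cancel_mono i, hy, Category.assoc, hy]
        exact ConcreteCategory.congr_hom (k.hom.naturality g) a }
  refine ⟨ObjectProperty.homMk l, ?_⟩
  ext T a
  exact hy T a

end AdditivePresheaf

end CategoryTheory

/-! ### Acyclic complexes in the derived category of presheaves -/

namespace Exact

open DerivedCategory

variable (C : Type u) [Category.{v} C] [Preadditive C]

noncomputable instance : HasDerivedCategory (AdditivePresheaf C) := HasDerivedCategory.standard _

variable [HasZeroObject C] [HasBinaryBiproducts C] [ExactCategory C]

/-- The functor from the homotopy category of acyclic complexes in `C` to the derived category
of additive presheaves that is induced by the Yoneda embedding. -/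
noncomputable def yonedaDerived : Ac C ⥤ DerivedCategory (AdditivePresheaf C) :=
  (acyclic C).ι ⋙ (AdditivePresheaf.yoneda C).mapHomotopyCategory (ComplexShape.up ℤ) ⋙ Qh

noncomputable instance : (yonedaDerived C).CommShift ℤ :=
  inferInstanceAs (((acyclic C).ι ⋙
    (AdditivePresheaf.yoneda C).mapHomotopyCategory (ComplexShape.up ℤ) ⋙ Qh).CommShift ℤ)

instance : (yonedaDerived C).IsTriangulated :=
  inferInstanceAs (((acyclic C).ι ⋙
    (AdditivePresheaf.yoneda C).mapHomotopyCategory (ComplexShape.up ℤ) ⋙ Qh).IsTriangulated)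

variable {C}

/-- The complex of representable presheaves attached to an object of `A(C)`. -/
noncomputable abbrev yonedaComplex (X : Ac C) : CochainComplex (AdditivePresheaf C) ℤ :=
  ((AdditivePresheaf.yoneda C).mapHomologicalComplex (ComplexShape.up ℤ)).obj X.complex

/-- The image of an object by the functor `yonedaDerived`. -/
noncomputable def yonedaDerivedObjIso (X : Ac C) : (yonedaDerived C).obj X ≅
    Q.obj (yonedaComplex X) :=
  (quotientCompQhIso (AdditivePresheaf C)).app _

lemma isLE_yonedaDerived_obj (X : Ac C) (n : ℤ) (hX : (tStructure C).IsLE X n) :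
    ((yonedaDerived C).obj X).IsLE n := by
  obtain ⟨Y, hY, ⟨e⟩⟩ := (tStructure_isLE_iff _ _).1 hX
  have : (yonedaComplex Y).IsStrictlyLE n := by
    rw [CochainComplex.isStrictlyLE_iff]
    exact fun i hi ↦ Functor.map_isZero (AdditivePresheaf.yoneda C) (Y.complex.isZero_of_isStrictlyLE n i)
  have h : (Q.obj (yonedaComplex Y)).IsLE n := by
    rw [isLE_Q_obj_iff]
    infer_instance
  exact TStructure.t.isLE_of_iso ((yonedaDerived C).mapIso e ≪≫ yonedaDerivedObjIso Y).symm n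

/-- In an acyclic complex starting in degree `n - 2`, the first differential is a kernel of the
second. The complex of representables is therefore exact in degrees `n - 2` and `n - 1`, though
possibly not beyond; this accounts for the offset by 2 in the t-structure. -/
lemma isGE_yonedaDerived_obj (X : Ac C) (n : ℤ) (hX : (tStructure C).IsGE X n) :
    ((yonedaDerived C).obj X).IsGE n := by
  obtain ⟨Y, hY, ⟨e⟩⟩ := (tStructure_isGE_iff _ _).1 hX
  have h : (Q.obj (yonedaComplex Y)).IsGE n := by
    rw [isGE_Q_obj_iff, CochainComplex.isGE_iff]
    intro i hi
    rw [HomologicalComplex.exactAt_iff' _ (i - 1) i (i + 1) (by simp) (by simp)]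
    obtain hi | rfl | rfl : i < n - 2 ∨ i = n - 2 ∨ i = n - 1 := by omega
    · exact ShortComplex.exact_of_isZero_X₂ _
        (Functor.map_isZero (AdditivePresheaf.yoneda C) (Y.complex.isZero_of_isStrictlyGE (n - 2) i))
    · refine AdditivePresheaf.exact_yoneda_map (Y.complex.d _ _) (Y.complex.d _ _) (by simp)
        ⟨fun _ _ _ ↦ (Y.complex.isZero_of_isStrictlyGE (n - 2) (n - 2 - 1)).eq_of_tgt _ _⟩
        (fun {T} x hx ↦ ⟨0, ?_⟩)
      have := mono_d Y.property (n₀ := n - 2) (n₁ := n - 2 + 1) rfl hY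
      rw [zero_comp, ← cancel_mono (Y.complex.d (n - 2) (n - 2 + 1)), hx, zero_comp]
    · obtain ⟨m, rfl⟩ : ∃ m, n = m + 2 := ⟨n - 2, by omega⟩
      have hY' : Y.complex.IsStrictlyGE m := by rwa [add_sub_cancel_right] at hY
      obtain ⟨k, hk⟩ : ∃ k, k = m + 2 - 1 := ⟨_, rfl⟩
      obtain rfl : m = k - 1 := by omega
      rw [← hk]
      exact AdditivePresheaf.exact_yoneda_map (Y.complex.d _ _) (Y.complex.d _ _) (by simp)
        (mono_d Y.property (by omega) hY')
        (fun {T} x hx ↦ exists_lift_d Y.property (by omega) rfl hY' x hx)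
  exact TStructure.t.isGE_of_iso ((yonedaDerived C).mapIso e ≪≫ yonedaDerivedObjIso Y).symm n

/-- A bounded above complex of representables is K-projective, so morphisms from it in the derived
category are homotopy classes, on which the Yoneda embedding is bijective. Nothing is required of
the target `Y`. -/
lemma bijectiveOn_yonedaDerived (X Y : Ac C) (hX : (boundedAcyclic C).isoClosure X) :
    (yonedaDerived C).BijectiveOn X Y := by
  obtain ⟨(X' : Ac C), ⟨a, b, (ha : X'.complex.IsStrictlyGE a),
    (hb : X'.complex.IsStrictlyLE b)⟩, ⟨e⟩⟩ := hX
  refine Functor.BijectiveOn.of_iso (X := X') (Y := Y) ?_ e.symm (Iso.refl _)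
  have : (yonedaComplex X').IsStrictlyLE b := by
    rw [CochainComplex.isStrictlyLE_iff]
    exact fun i hi ↦ Functor.map_isZero (AdditivePresheaf.yoneda C) (X'.complex.isZero_of_isStrictlyLE b i)
  have (i : ℤ) : Projective
      ((yonedaComplex X').X i) :=
    inferInstanceAs (Projective ((AdditivePresheaf.yoneda C).obj (X'.complex.X i)))
  have := CochainComplex.isKProjective_of_projective
    (yonedaComplex X') b
  have h₁ := CochainComplex.IsKProjective.Qh_map_bijective
    (yonedaComplex X')
    (((AdditivePresheaf.yoneda C).mapHomotopyCategory (ComplexShape.up ℤ)).obj Y.obj)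
  have h₂ : Function.Bijective (((acyclic C).ι ⋙
      (AdditivePresheaf.yoneda C).mapHomotopyCategory (ComplexShape.up ℤ)).map :
      (X' ⟶ Y) → _) := ⟨Functor.map_injective _, Functor.map_surjective _⟩
  exact h₁.comp h₂

end Exact

/-! ### Construction of a realization functor -/

namespace Exact

open DerivedCategory

section

variable {M : Type*} [Category* M] [Abelian M] [HasDerivedCategory M]

lemma hom_single_shift_eq_zero ⦃X Y : M⦄ ⦃n : ℤ⦄
    (f : (singleFunctor M 0).obj X ⟶ ((singleFunctor M 0).obj Y)⟦n⟧) (hn : n < 0) : f = 0 :=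
  TStructure.t.zero_of_isLE_of_isGE f 0 (-n) (by lia) inferInstance
    (TStructure.t.isGE_shift ((singleFunctor M 0).obj Y) 0 n (-n) (by lia))

/-- If a sequence `X₁ ⟶ X₂ ⟶ X₃` becomes a distinguished triangle in the derived category,
it is short exact. -/
lemma shortExact_of_distTriang_single (S : ShortComplex M)
    (δ : (singleFunctor M 0).obj S.X₃ ⟶ ((singleFunctor M 0).obj S.X₁)⟦(1 : ℤ)⟧)
    (hT : Triangle.mk ((singleFunctor M 0).map S.f) ((singleFunctor M 0).map S.g) δ ∈
      distTriang (DerivedCategory M)) : S.ShortExact := by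
  have h₁ := AbelianSubcategory.isLimitKernelForkOfDistTriang hom_single_shift_eq_zero _ _ _ hT
  have h₂ := AbelianSubcategory.isColimitCokernelCoforkOfDistTriang hom_single_shift_eq_zero
    _ _ _ hT
  exact
    { exact := S.exact_of_f_is_kernel h₁
      mono_f := mono_of_isLimit_fork h₁
      epi_g := epi_of_isColimit_cofork h₂ }

end

lemma distTriang_of_iso {D : Type*} [Category* D] [Preadditive D] [HasZeroObject D] [HasShift D ℤ]
    [∀ (n : ℤ), (shiftFunctor D n).Additive] [Pretriangulated D] {T : Triangle D}
    (hT : T ∈ distTriang D) {X Y Z : D} {f : X ⟶ Y} {g : Y ⟶ Z} (e₁ : X ≅ T.obj₁) (e₂ : Y ≅ T.obj₂)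
    (e₃ : Z ≅ T.obj₃) (comm₁ : f ≫ e₂.hom = e₁.hom ≫ T.mor₁)
    (comm₂ : g ≫ e₃.hom = e₂.hom ≫ T.mor₂) :
    Triangle.mk f g (e₃.hom ≫ T.mor₃ ≫ e₁.inv⟦(1 : ℤ)⟧') ∈ distTriang D := by
  have h : (e₃.hom ≫ T.mor₃ ≫ e₁.inv⟦(1 : ℤ)⟧') ≫ e₁.hom⟦(1 : ℤ)⟧' = e₃.hom ≫ T.mor₃ := by
    rw [Category.assoc, Category.assoc, ← Functor.map_comp, e₁.inv_hom_id, CategoryTheory.Functor.map_id,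
      Category.comp_id]
  exact isomorphic_distinguished _ hT _ (Triangle.isoMk _ _ e₁ e₂ e₃ comm₁ comm₂ h)

variable {C : Type u} [Category.{v} C] [Preadditive C] [HasZeroObject C] [HasBinaryBiproducts C]
  [ExactCategory C]

/-- Kernels of epimorphisms in the heart are computed by fibres in `A(C)`, so a short exact sequence
is a triangle after replacing its first term by an isomorphic one. -/
lemma exists_iso_of_shortExact (S : ShortComplex (Heart C)) (hS : S.ShortExact) :
    ∃ (S' : ShortComplex (Heart C)) (_ : S ≅ S') (δ : S'.X₃.obj ⟶ S'.X₁.obj⟦(1 : ℤ)⟧),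
      Triangle.mk S'.f.hom S'.g.hom δ ∈ distTriang (Ac C) := by
  have := hS.epi_g
  obtain ⟨K, i, δ, hT⟩ := AbelianSubcategory.exists_distinguished_triangle_of_epi
    (ι := (tStructure C).heart.ι) heart_hom_eq_zero heart_admissible S.g
  have h := AbelianSubcategory.isLimitKernelForkOfDistTriang (ι := (tStructure C).heart.ι)
    heart_hom_eq_zero _ _ _ hT
  have h' := hS.fIsKernel
  have w : i ≫ S.g = 0 := (tStructure C).heart.ι.map_injective
    (((Functor.map_comp _ _ _).trans (comp_distTriang_mor_zero₁₂ _ hT)).trans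
      (Functor.map_zero _ _ _).symm)
  let S' := ShortComplex.mk i S.g w
  refine ⟨S', ShortComplex.isoMk (IsLimit.conePointUniqueUpToIso h' h) (Iso.refl _) (Iso.refl _)
    ?_ ?_, δ, hT⟩
  · exact (IsLimit.conePointUniqueUpToIso_hom_comp h' h WalkingParallelPair.zero).trans
      (Category.comp_id _).symm
  · exact (Category.id_comp _).trans (Category.comp_id _).symm

variable (C)

lemma essImage_single_heart (X : Heart C) : (singleFunctor (AdditivePresheaf C) 0).essImage
    (((tStructure C).heart.ι ⋙ yonedaDerived C).obj X) := by
  have := isLE_yonedaDerived_obj X.obj 0 (TStructure.heart_isLE X.property)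
  have := isGE_yonedaDerived_obj X.obj 0 (TStructure.heart_isGE X.property)
  obtain ⟨M, ⟨e⟩⟩ := exists_iso_singleFunctor_obj_of_isGE_of_isLE
    ((yonedaDerived C).obj X.obj) 0
  exact ⟨M, ⟨e.symm⟩⟩

/-- The functor from the heart to the category of additive presheaves. -/
noncomputable def heartToPresheaf : Heart C ⥤ AdditivePresheaf C :=
  Functor.essImage.liftFunctor _ _ (essImage_single_heart C)

/-- The functor `heartToPresheaf` is induced by `yonedaDerived`. -/
noncomputable def heartToPresheafIso : heartToPresheaf C ⋙ singleFunctor (AdditivePresheaf C) 0 ≅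
    (tStructure C).heart.ι ⋙ yonedaDerived C :=
  Functor.essImage.liftFunctorCompIso _ _ _

instance : (heartToPresheaf C).Additive := by
  have := Functor.additive_of_iso (heartToPresheafIso C).symm
  exact Functor.additive_of_comp_faithful _ (singleFunctor (AdditivePresheaf C) 0)

/-- Short exact sequences and triangles correspond on both sides, and `yonedaDerived` preserves
triangles. -/
lemma shortExact_map_heartToPresheaf (S : ShortComplex (Heart C)) (hS : S.ShortExact) :
    (S.map (heartToPresheaf C)).ShortExact := by
  obtain ⟨S', e, δ, hT⟩ := exists_iso_of_shortExact S hS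
  refine ShortComplex.shortExact_of_iso
    ((heartToPresheaf C).mapShortComplex.mapIso e.symm) ?_
  have hT' := map_mk_distinguished (yonedaDerived C) hT
  exact shortExact_of_distTriang_single _ _ (distTriang_of_iso hT'
    ((heartToPresheafIso C).app S'.X₁) ((heartToPresheafIso C).app S'.X₂)
    ((heartToPresheafIso C).app S'.X₃) ((heartToPresheafIso C).hom.naturality S'.f)
    ((heartToPresheafIso C).hom.naturality S'.g))

lemma preservesFinite_heartToPresheaf : PreservesFiniteLimits (heartToPresheaf C) ∧
    PreservesFiniteColimits (heartToPresheaf C) :=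
  ((heartToPresheaf C).exact_tfae.out 0 3 rfl rfl).1 (shortExact_map_heartToPresheaf C)

instance : PreservesFiniteLimits (heartToPresheaf C) := (preservesFinite_heartToPresheaf C).1

instance : PreservesFiniteColimits (heartToPresheaf C) := (preservesFinite_heartToPresheaf C).2

/-- The functor from `D^b(A(C)^♥)` to the derived category of additive presheaves induced
by the exact functor `heartToPresheaf C`. -/
noncomputable abbrev derivedHeartToPresheaf :
    DerivedCategory.Bounded (Heart C) ⥤ DerivedCategory (AdditivePresheaf C) :=
  Bounded.ι ⋙ (heartToPresheaf C).mapDerivedCategory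

/-- The restriction of `derivedHeartToPresheaf C` to the heart. -/
noncomputable def heartToDerivedCompIso : heartToDerived C ⋙ derivedHeartToPresheaf C ≅
    (tStructure C).heart.ι ⋙ yonedaDerived C :=
  (heartToPresheaf C).mapDerivedCategorySingleFunctor 0 ≪≫ heartToPresheafIso C

/-- The restriction of `yonedaDerived C` to bounded acyclic complexes. -/
noncomputable abbrev yonedaDerivedBounded : Acb C ⥤ DerivedCategory (AdditivePresheaf C) :=
  (boundedAcyclic C).ι ⋙ yonedaDerived C

lemma bijective_yonedaDerivedBounded (X Y : Acb C) :
    Function.Bijective ((yonedaDerivedBounded C).map : (X ⟶ Y) → _) := by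
  have h₁ : Function.Bijective ((yonedaDerived C).map : (X.obj ⟶ Y.obj) → _) :=
    bijectiveOn_yonedaDerived _ _ ((boundedAcyclic C).le_isoClosure _ X.property)
  have h₂ : Function.Bijective ((boundedAcyclic C).ι.map : (X ⟶ Y) → _) :=
    ⟨Functor.map_injective _, Functor.map_surjective _⟩
  exact h₁.comp h₂

instance : (yonedaDerivedBounded C).Full := ⟨fun {X Y} ↦ (bijective_yonedaDerivedBounded C X Y).2⟩

instance : (yonedaDerivedBounded C).Faithful :=
  ⟨fun {X Y} ↦ @(bijective_yonedaDerivedBounded C X Y).1⟩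

/-- Dévissage: the essential image of a fully faithful triangulated functor is a triangulated
subcategory, and it contains the images of the heart objects. -/
lemma essImage_derivedHeartToPresheaf (X : DerivedCategory.Bounded (Heart C)) :
    (yonedaDerivedBounded C).essImage ((derivedHeartToPresheaf C).obj X) := by
  refine TStructure.t.onBounded.bounded_le_of_heart_le
    ((yonedaDerivedBounded C).essImage.inverseImage (derivedHeartToPresheaf C))
    (fun X hX ↦ ?_) X ?_
  · obtain ⟨M, ⟨e⟩⟩ := exists_iso_toBounded_obj X hX
    obtain ⟨Y, hY, ⟨e'⟩⟩ := isoClosure_boundedAcyclic_of_heart M.property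
    exact ⟨⟨Y, hY⟩, ⟨(yonedaDerived C).mapIso e'.symm ≪≫ (heartToDerivedCompIso C).symm.app M ≪≫
      (derivedHeartToPresheaf C).mapIso e.symm⟩⟩
  · rw [onBounded_bounded]
    trivial

/-- The triangulated functor `D^b(A(C)^♥) ⥤ A^b(C)` extending the inclusion of the heart. -/
noncomputable def realization : DerivedCategory.Bounded (Heart C) ⥤ Acb C :=
  Functor.essImage.liftFunctor _ _ (essImage_derivedHeartToPresheaf C)

/-- The defining property of the functor `realization C`. -/
noncomputable def realizationIso :
    realization C ⋙ yonedaDerivedBounded C ≅ derivedHeartToPresheaf C :=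
  Functor.essImage.liftFunctorCompIso _ _ _

noncomputable instance : (realization C).CommShift ℤ :=
  Functor.CommShift.ofComp (realizationIso C) ℤ

instance : NatTrans.CommShift (realizationIso C).hom ℤ :=
  Functor.CommShift.ofComp_compatibility (realizationIso C) ℤ

/-- The fully faithful triangulated functor `yonedaDerivedBounded C` detects distinguished
triangles, and its composite with `realization C` is triangulated. -/
instance : (realization C).IsTriangulated :=
  (Functor.isTriangulated_iff_comp_right (realizationIso C)).2 inferInstance

/-- The functor induced by `yonedaDerived C` on the objects that are isomorphic to bounded acyclic
complexes. -/
noncomputable abbrev yonedaDerivedIsoClosure :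
    (boundedAcyclic C).isoClosure.FullSubcategory ⥤ DerivedCategory (AdditivePresheaf C) :=
  (boundedAcyclic C).isoClosure.ι ⋙ yonedaDerived C

lemma bijective_yonedaDerivedIsoClosure (X Y : (boundedAcyclic C).isoClosure.FullSubcategory) :
    Function.Bijective ((yonedaDerivedIsoClosure C).map : (X ⟶ Y) → _) := by
  have h₁ : Function.Bijective ((yonedaDerived C).map : (X.obj ⟶ Y.obj) → _) :=
    bijectiveOn_yonedaDerived _ _ X.property
  have h₂ : Function.Bijective ((boundedAcyclic C).isoClosure.ι.map : (X ⟶ Y) → _) :=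
    ⟨Functor.map_injective _, Functor.map_surjective _⟩
  exact h₁.comp h₂

instance : (yonedaDerivedIsoClosure C).Full :=
  ⟨fun {X Y} ↦ (bijective_yonedaDerivedIsoClosure C X Y).2⟩

instance : (yonedaDerivedIsoClosure C).Faithful :=
  ⟨fun {X Y} ↦ @(bijective_yonedaDerivedIsoClosure C X Y).1⟩

/-- The restriction of the functor `realization C` to the heart is the inclusion. -/
noncomputable def heartToDerivedCompRealizationIso :
    heartToDerived C ⋙ realization C ⋙ (boundedAcyclic C).ι ≅ (tStructure C).heart.ι :=
  -- Heart objects are only isomorphic to bounded complexes, so the comparison takes place in the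
  -- isomorphism closure. The two functors agree after composition with the fully faithful functor
  -- to the derived category of presheaves, which can be cancelled.
  Functor.isoWhiskerRight (Functor.fullyFaithfulCancelRight (yonedaDerivedIsoClosure C)
    (F := (boundedAcyclic C).isoClosure.lift (heartToDerived C ⋙ realization C ⋙
      (boundedAcyclic C).ι) (fun X ↦ (boundedAcyclic C).le_isoClosure _
        ((realization C).obj ((heartToDerived C).obj X)).property))
    (G := (boundedAcyclic C).isoClosure.lift (tStructure C).heart.ι
      (fun X ↦ isoClosure_boundedAcyclic_of_heart X.property))
    (Functor.isoWhiskerLeft (heartToDerived C) (realizationIso C) ≪≫ heartToDerivedCompIso C))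
    (boundedAcyclic C).isoClosure.ι

/-- The realization functor which is obtained using the derived category of additive
presheaves. -/
noncomputable def realizationFunctor : RealizationFunctor C where
  functor := realization C
  iso := heartToDerivedCompRealizationIso C

end Exact

theorem proposition2p4 (E : Type u) [Category.{v} E] [Preadditive E] [HasZeroObject E]
    [HasBinaryBiproducts E] [Exact.ExactCategory E] [IsIdempotentComplete E] :
    Nonempty (Exact.RealizationFunctor E) ∧
      ∀ F : Exact.RealizationFunctor E, F.functor.IsEquivalence ↔ Exact.IsHereditary E := by
  exact ⟨⟨Exact.realizationFunctor E⟩, fun F ↦ F.isEquivalence_iff_isHereditary⟩
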